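/- **Setting.** For integers $B,d\ge 1$, the Butterfly graph of degree $B$ and depth $d$ has layers $0,\dots,d$ of $B^d$ nodes each, the nodes of every layer being indexed by $\{0,\dots,B^d-1\}$. There is an edge from node $j$ of layer $l$ to node $k$ of layer $l+1$ ($0\le l<d$) iff the base-$B$ representations of $j$ and $k$ agree in all digits except possibly digit $l$ (digit $0$ is the least significant). Nodes of layer $0$ are sources, nodes of layer $d$ are sinks; there is a unique path from every source to every sink. In *0-XOR in Multiple Butterflies* of degree $B$ and depth up to $d$ with $b$-bit strings there are Butterfly graphs $G_d,\dots,G_1$ of degree $B$, where $G_i$ has depth $i$. Updates arrive in epochs $d,d-1,\dots,1$ (in this order); the updates of epoch $i$ assign a $b$-bit string to each edge of $G_i$. After all epochs, a query $(s,t)$ with $s,t\in\{0,\dots,B^d-1\}$ is asked. Its answer is $1$ if for at least one $i\in\{1,\dots,d\}$ the bitwise XOR of the strings along the path in $G_i$ from the source of index $\lfloor s/B^{d-i}\rfloor$ to the sink of index $\lfloor t/B^{d-i}\rfloor$ is the all-zero string, and $0$ otherwise. A data structure in the cell probe model has a memory of $2^w$ cells (with addresses $0,\dots,2^w-1$) of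 $w$ bits each, with fixed initial contents. The updates of an epoch are processed by changing the contents of memory cells; the new contents are an arbitrary function of the old memory contents and of the updates of the epoch, and only the number of changed cells is counted. A query is answered by a decision tree, which adaptively probes memory cells and then gives the answer; the query time is the number of probes. A data structure may be randomized, that is, be drawn at random from the deterministic ones; it has to answer every query correctly after every sequence of updates with probability $1$. **Theorem.** There is a constant $d_0$ such that for every constant $K>0$ there is a constant $c>0$ with the following property. Let $d\ge d_0$, $t_u\ge 1$ and $w\ge 1$ be integers and let $B=(d\,t_u\,w)^{12}$. Consider any data structure with $w$-bit cells for 0-XOR in Multiple Butterflies of degree $B$ and depth up to $d$ with $(\lceil\lg_2 d\rceil+6)$-bit strings which, with probability $1$, for every sequence of updates changes at most $K\,t_u\,d\,B^{i+1}$ cells in epoch $i$, for every $i\in\{1,\dots,d\}$. Then its expected query time $t_q$ satisfies $$t_q\;\ge\; c\cdot\frac{\lg_2^{3/2} n}{\lg_2^{2}(t_u w)},$$ where $n=\sum_{i=1}^d (i+1)B^i$ is the total number of nodes in all the Butterfly graphs $G_1,\dots,G_d$. Here $t_q$ is the expected number of probes over the random choices of the data structure, independent uniformly random bit strings on all edges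 of all the graphs and an independent uniformly random query $(s,t)$; in particular the bound holds for the maximum over all updates and queries of the expected number of probes. -/

import Mathlib

open scoped ENNReal

noncomputable section

namespace ButterflyXor

/-! ### Butterfly graphs -/

/-- Nodes of the Butterfly graph of degree `B` and depth `d`: there are `d + 1` layers
`0, …, d`, each with the `B ^ d` nodes indexed by the integers `0, …, B ^ d - 1`.
Layer `0` holds the sources, layer `d` the sinks. -/
abbrev Node (B d : ℕ) : Type := Fin (d + 1) × Fin (B ^ d)

/-- The total number of nodes in the Butterfly graphs of degree `B` and depths `1, …, d`. -/
def totalNodes (B d : ℕ) : ℕ := Fintype.card (Σ i : Fin d, Node B (i + 1))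

/-- The base-`B` digits of an index `j < B ^ d`: digit number `c` is `j / B ^ c % B`, so digit
number `0` is the least significant one. -/
def digit {B d : ℕ} (j : Fin (B ^ d)) : Fin d → Fin B := finFunctionFinEquiv.symm j

/-- Edges of the Butterfly graph of degree `B` and depth `d`. The triple `(l, j, k)` is the edge
from node `j` of layer `l` to node `k` of layer `l + 1`; it is present exactly if `j` and `k`
agree in all base-`B` digits other than digit `l`. -/
abbrev Edge (B d : ℕ) : Type :=
  {e : Fin d × Fin (B ^ d) × Fin (B ^ d) // ∀ c : Fin d, c ≠ e.1 → digit e.2.1 c = digit e.2.2 c}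

/-- The node in layer `l` on the unique path from source `s` to sink `t`: the digits with number
less than `l` have already been changed to those of `t`, the others are still those of `s`. -/
def pathNode {B d : ℕ} (s t : Fin (B ^ d)) (l : ℕ) : Fin (B ^ d) :=
  finFunctionFinEquiv fun c : Fin d => if (c : ℕ) < l then digit t c else digit s c

theorem digit_pathNode {B d : ℕ} (s t : Fin (B ^ d)) (l : ℕ) (c : Fin d) :
    digit (pathNode s t l) c = if (c : ℕ) < l then digit t c else digit s c := by
  simp [digit, pathNode]

/-- The edge leaving layer `l` on the unique path from source `s` to sink `t`. -/
def pathEdge {B d : ℕ} (s t : Fin (B ^ d)) (l : Fin d) : Edge B d :=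
  ⟨(l, pathNode s t l, pathNode s t (l + 1)), by
    intro c hc
    have h : (c : ℕ) ≠ l := fun h => hc (Fin.ext h)
    have h' : (c : ℕ) < l ↔ (c : ℕ) < l + 1 := by omega
    simp only [digit_pathNode, h']⟩

/-! ### The problem: 0-XOR in one and in multiple Butterflies -/

/-- Strings of `b` bits; bitwise XOR is addition of vectors over the field with two elements. -/
abbrev Bits (b : ℕ) : Type := Fin b → ZMod 2

/-- An assignment of a `b`-bit string to every edge of a Butterfly. -/
abbrev Assignment (B d b : ℕ) : Type := Edge B d → Bits b

/-- The XOR of the bit strings along the path from source `s` to sink `t`. -/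
def pathXor {B d b : ℕ} (I : Assignment B d b) (s t : Fin (B ^ d)) : Bits b :=
  ∑ l : Fin d, I (pathEdge s t l)

/-- The inputs of all epochs. The index `i : Fin d` stands for epoch number `i + 1`, whose updates
assign a `b`-bit string to every edge of the Butterfly of depth `i + 1`. -/
abbrev Updates (B d b : ℕ) : Type := (i : Fin d) → Assignment B (i + 1) b

/-- The index `⌊s / B ^ (d - (i + 1))⌋` that `s` specifies in the Butterfly of depth `i + 1`. -/
def indexIn {B d : ℕ} (i : Fin d) (s : Fin (B ^ d)) : Fin (B ^ ((i : ℕ) + 1)) :=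
  ⟨(s : ℕ) / B ^ (d - (i + 1)), by
    apply Nat.div_lt_of_lt_mul
    rw [← pow_add, Nat.sub_add_cancel (show (i : ℕ) + 1 ≤ d from i.isLt)]
    exact s.isLt⟩

/-- The answer to the query `(s, t)` is `1` iff in at least one of the Butterflies the path between
the source and the sink specified by `(s, t)` has the all-zero string as XOR. -/
def IsYes {B d b : ℕ} (U : Updates B d b) (s t : Fin (B ^ d)) : Prop :=
  ∃ i : Fin d, pathXor (U i) (indexIn i s) (indexIn i t) = 0

/-! ### The cell probe model with `w`-bit cells -/

/-- Memory contents: there are `2 ^ w` cells with addresses `0, …, 2 ^ w - 1`, and each cell holds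
one of `2 ^ w` values (`w` bits). -/
abbrev Memory (w : ℕ) : Type := Fin (2 ^ w) → Fin (2 ^ w)

/-- A query algorithm: a decision tree whose inner nodes are labeled by the address of the cell to
probe and have one child for each possible contents of it, and whose leaves carry the answer. -/
inductive ProbeTree (w : ℕ) : Type
  | answer (a : Bool) : ProbeTree w
  | probe (address : Fin (2 ^ w)) (next : Fin (2 ^ w) → ProbeTree w) : ProbeTree w

/-- The answer that a query algorithm gives on memory `m`. -/
def ProbeTree.output {w : ℕ} (m : Memory w) : ProbeTree w → Bool
  | .answer a => a
  | .probe address next => (next (m address)).output m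

/-- The number of probes that a query algorithm makes on memory `m`. -/
def ProbeTree.probes {w : ℕ} (m : Memory w) : ProbeTree w → ℕ
  | .answer _ => 0
  | .probe address next => (next (m address)).probes m + 1

/-- A deterministic dynamic data structure in the cell probe model for 0-XOR in Multiple
Butterflies: initial memory contents, for every epoch a way to process the updates of that epoch,
and a query algorithm for every query. Computation is free, so processing an epoch is an arbitrary
map from the updates of the epoch and the old memory contents to the new memory contents; the
number of cells updated by it is counted in `updatedCells` below. -/
structure DataStructure (w B d b : ℕ) where
  init : Memory w
  update : (i : Fin d) → Assignment B (i + 1) b → Memory w → Memory w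
  query : Fin (B ^ d) → Fin (B ^ d) → ProbeTree w

namespace DataStructure

variable {w B d b : ℕ} (D : DataStructure w B d b)

/-- The memory after the first `k` epochs. Epochs arrive in the order `d, d - 1, …, 1`; with
`Fin.rev ⟨k, _⟩` standing for epoch number `d - k`, that one is processed after `k` others. -/
def memoryAfter (U : Updates B d b) : ℕ → Memory w
  | 0 => D.init
  | k + 1 =>
    if h : k < d then D.update (Fin.rev ⟨k, h⟩) (U (Fin.rev ⟨k, h⟩)) (memoryAfter U k)
    else memoryAfter U k

/-- The cells whose contents are changed when the updates of epoch number `i + 1` are processed,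
which happens after `d - (i + 1)` other epochs. -/
def updatedCells (U : Updates B d b) (i : Fin d) : Finset (Fin (2 ^ w)) :=
  {a | D.memoryAfter U (d - (i + 1) + 1) a ≠ D.memoryAfter U (d - (i + 1)) a}

/-- The query algorithm always gives the right answer after all epochs. -/
def Correct : Prop :=
  ∀ (U : Updates B d b) (s t : Fin (B ^ d)),
    (D.query s t).output (D.memoryAfter U d) = true ↔ IsYes U s t

/-- The number of probes used for the query `(s, t)` after all epochs with updates `U`. -/
def queryProbes (U : Updates B d b) (s t : Fin (B ^ d)) : ℕ :=
  (D.query s t).probes (D.memoryAfter U d)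

/-- The average number of probes over uniformly random bit strings on all edges of all the
Butterflies and an independent uniformly random query. -/
def averageProbes : ℝ≥0∞ :=
  (∑ U : Updates B d b, ∑ s : Fin (B ^ d), ∑ t : Fin (B ^ d), (D.queryProbes U s t : ℝ≥0∞)) /
    (Fintype.card (Updates B d b × Fin (B ^ d) × Fin (B ^ d)) : ℝ≥0∞)

end DataStructure

end ButterflyXor

end

namespace ButterflyXor

open Finset

/-! Fix all updates except those of one epoch, with Butterfly depth I ≥ d/2. Attribute each memory
cell to the last epoch that changes it. If the average number of probes were at most T, then for
some such epoch most queries would read at most t = O(T) cells, of which only m = O(T/d) belong to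
this epoch. The strings are long enough that most answers are 0, and an answer 0 certifies that the
XOR in this Butterfly is nonzero.

Such a query has a low-degree simulation. Let N be the memory with the epoch undone and M the final
memory. Guess a set S of at most m cells where they differ, run the query on N overwritten by M on
S, and test that it reads all of S and no other differing cell. The last test is a NOR of at most t
bits; `exists_nor_newton` replaces it by a Chebyshev-type polynomial of degree D = O(√(ts) + s) with
error 2^{-s}. Since only (t+1)^m guesses are consistent (`ProbeTree.card_guess_le`), the indicator
of a good query becomes, up to a small error, a sum over sets R of at most u = m + D differing
cells, each term depending only on N and the contents of R (`ProbeTree.abs_sum_guess_sub_good_le`).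

Multiply it by `centered` of the path XOR, which has mean zero and is 1 on nonzero strings, and call
the result Y. A product of Y over g queries again has the form above. For fixed cell contents, a
2r-th moment over the random edge strings expands into 2rg paths, and a term vanishes unless every
edge used is used twice. Random paths overlap that much with probability at most (4/x)^{Irg}, where
x is about the sixth power of d·t_u·w (`moment_le`). This beats the at most 4^{w(p+gu)} possible
cell contents, p being the number of cells changed later, so the correlation is exponentially small
once g is large (`correlation_pow_le`, `Parameters.abs_correlation_le`). But if three quarters of
the queries were good, the product of 1 + Y over many random queries would often be huge, while its
expansion into subproducts is small. This contradiction is `Parameters.not_good`.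

The simulation is impossible as long as u is at most a small multiple of d. With s about m lg t + lg
d, the main term of u is √(t·m·lg t), about T·√(lg B / d), so T may be of order d^{3/2}/√(lg B).
Correctness forces d ≤ w, because the memory must be able to store B^d independent bits; hence lg B
= O(lg(t_u w)), and lg n ≤ 2d·lg B gives the stated form. -/

/-! ### Chebyshev approximation of NOR -/

open Polynomial in
theorem one_add_sq_mul_le_eval_T (n : ℕ) {y : ℝ} (hy : 0 ≤ y) :
    1 + (n : ℝ) ^ 2 * y ≤ (Chebyshev.T ℝ n).eval (1 + y) := by
  -- The induction carries the increments along: T_{n+2} − T_{n+1} exceeds T_{n+1} − T_n by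
  -- 2y·T_{n+1} ≥ 2y at the point 1 + y.
  suffices h : 1 + (n : ℝ) ^ 2 * y ≤ (Chebyshev.T ℝ n).eval (1 + y) ∧
      y + 2 * n * y ≤ (Chebyshev.T ℝ (n + 1 : ℤ)).eval (1 + y) -
        (Chebyshev.T ℝ n).eval (1 + y) from h.1
  induction n with
  | zero => simp
  | succ n ih =>
    obtain ⟨h1, h2⟩ := ih
    have h3 : 1 + ((n + 1 : ℕ) : ℝ) ^ 2 * y ≤ (Chebyshev.T ℝ (n + 1 : ℤ)).eval (1 + y) := by
      push_cast; nlinarith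
    refine ⟨by exact_mod_cast h3, ?_⟩
    have h4 : Chebyshev.T ℝ ((n + 1 : ℕ) + 1 : ℤ) =
        2 * X * Chebyshev.T ℝ (n + 1 : ℤ) - Chebyshev.T ℝ n := by
      have := Chebyshev.T_add_two ℝ (n : ℤ)
      rw [← this]; push_cast; ring_nf
    have h5 : (1 : ℝ) ≤ (Chebyshev.T ℝ (n + 1 : ℤ)).eval (1 + y) := by
      have : 0 ≤ ((n + 1 : ℕ) : ℝ) ^ 2 * y := by positivity
      linarith
    rw [h4]
    simp only [eval_sub, eval_mul, eval_X, eval_ofNat]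
    push_cast
    have h6 := mul_le_mul_of_nonneg_left h5 hy
    nlinarith

open Polynomial in
-- T_n(1 − βx), with β chosen so that x = j lands on the largest zero cos(π/(2n)) of T_n. Since 1 −
-- cos z ≤ z²/2 and t < n²j, the points 0, …, t stay in [−1, 1].
theorem exists_polynomial_root (t j : ℕ) (hj : 1 ≤ j) :
    ∃ P : ℝ[X], P.natDegree ≤ Nat.sqrt (t / j) + 1 ∧ P.eval 0 = 1 ∧ P.eval (j : ℝ) = 0 ∧
      ∀ v : ℕ, v ≤ t → |P.eval (v : ℝ)| ≤ 1 := by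
  set n := Nat.sqrt (t / j) + 1 with hn
  have hn0 : (0 : ℝ) < n := by positivity
  have hj0 : (0 : ℝ) < j := by exact_mod_cast hj
  set β : ℝ := (1 - Real.cos (Real.pi / (2 * n))) / j with hβ
  have hβ0 : 0 ≤ β := div_nonneg (sub_nonneg.2 (Real.cos_le_one _)) hj0.le
  have hβt : β * t ≤ 2 := by
    have h1 : (t : ℝ) ≤ n ^ 2 * j := by
      have h2 : t / j < n * n := Nat.lt_succ_sqrt _
      have h3 : t < n * n * j := (Nat.div_lt_iff_lt_mul hj).1 h2
      have : (t : ℝ) ≤ ((n * n * j : ℕ) : ℝ) := by exact_mod_cast h3.le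
      push_cast at this; nlinarith
    have h2 := Real.one_sub_sq_div_two_le_cos (x := Real.pi / (2 * n))
    have h3 : (Real.pi / (2 * n)) ^ 2 / 2 * n ^ 2 ≤ 2 := by
      have : (Real.pi / (2 * n)) ^ 2 / 2 * n ^ 2 = Real.pi ^ 2 / 8 := by field_simp; ring
      rw [this]; nlinarith [Real.pi_le_four, Real.pi_pos]
    rw [hβ, div_mul_eq_mul_div, div_le_iff₀ hj0]
    have h4 : 0 ≤ 1 - Real.cos (Real.pi / (2 * n)) := sub_nonneg.2 (Real.cos_le_one _)
    calc (1 - Real.cos (Real.pi / (2 * n))) * t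
        ≤ (1 - Real.cos (Real.pi / (2 * n))) * (n ^ 2 * j) := mul_le_mul_of_nonneg_left h1 h4
      _ ≤ (Real.pi / (2 * n)) ^ 2 / 2 * (n ^ 2 * j) := by
          apply mul_le_mul_of_nonneg_right (by linarith) (by positivity)
      _ = ((Real.pi / (2 * n)) ^ 2 / 2 * n ^ 2) * j := by ring
      _ ≤ 2 * j := mul_le_mul_of_nonneg_right h3 hj0.le
  refine ⟨(Chebyshev.T ℝ n).comp (1 - C β * X), ?_, ?_, ?_, ?_⟩
  · refine natDegree_comp_le.trans ?_
    rw [Chebyshev.natDegree_T]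
    have : (1 - C β * X : ℝ[X]).natDegree ≤ 1 := by compute_degree
    simpa using Nat.mul_le_mul_left n this
  · simp
  · have : 1 - β * j = Real.cos (Real.pi / (2 * n)) := by rw [hβ]; field_simp; ring
    simp only [eval_comp, eval_sub, eval_mul, eval_one, eval_C, eval_X, this]
    rw [Chebyshev.T_real_cos]
    rw [← Real.cos_pi_div_two]; congr 1; push_cast; field_simp
  · intro v hv
    simp only [eval_comp, eval_sub, eval_mul, eval_one, eval_C, eval_X]
    apply Chebyshev.abs_eval_T_real_le_one
    have : β * v ≤ β * t := mul_le_mul_of_nonneg_left (by exact_mod_cast hv) hβ0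
    have : 0 ≤ β * v := by positivity
    rw [abs_le]; constructor <;> linarith

open Polynomial in
-- The affine map sends [s, t] into [−1, 1] and 0 to 1 + 2s/t, where T_n already exceeds 2 because
-- n²s > t. Dividing by this value normalizes at 0.
theorem exists_polynomial_le_half (t s : ℕ) (hs : 1 ≤ s) :
    ∃ P : ℝ[X], P.natDegree ≤ Nat.sqrt (t / s) + 1 ∧ P.eval 0 = 1 ∧
      ∀ v : ℕ, s ≤ v → v ≤ t → |P.eval (v : ℝ)| ≤ 1 / 2 := by
  set n := Nat.sqrt (t / s) + 1 with hn
  have hs0 : (0 : ℝ) < s := by exact_mod_cast hs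
  set c : ℝ := (Chebyshev.T ℝ n).eval (1 + 2 * s / t) with hc
  have hc1 : 1 ≤ c := by
    have := one_add_sq_mul_le_eval_T n (y := 2 * s / t) (by positivity)
    have h : 0 ≤ (n : ℝ) ^ 2 * (2 * s / t) := by positivity
    linarith
  refine ⟨C (1 / c) * (Chebyshev.T ℝ n).comp (C (1 + 2 * s / t : ℝ) - C (2 / t : ℝ) * X), ?_, ?_, ?_⟩
  · refine (natDegree_C_mul_le _ _).trans (natDegree_comp_le.trans ?_)
    rw [Chebyshev.natDegree_T]
    have : (C (1 + 2 * s / t : ℝ) - C (2 / t : ℝ) * X : ℝ[X]).natDegree ≤ 1 := by compute_degree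
    simpa using Nat.mul_le_mul_left n this
  · simp only [eval_mul, eval_comp, eval_sub, eval_C, eval_X, mul_zero, sub_zero, ← hc]
    field_simp
  · intro v hv hvt
    have ht0 : (0 : ℝ) < t := by
      have : 1 ≤ t := hs.trans (hv.trans hvt)
      exact_mod_cast this
    have hc2 : 2 ≤ c := by
      have h0 := one_add_sq_mul_le_eval_T n (y := 2 * s / t) (by positivity)
      have h1 : (t : ℝ) ≤ n ^ 2 * s := by
        have h2 : t / s < n * n := Nat.lt_succ_sqrt _
        have h3 : t < n * n * s := (Nat.div_lt_iff_lt_mul hs).1 h2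
        have : (t : ℝ) ≤ ((n * n * s : ℕ) : ℝ) := by exact_mod_cast h3.le
        push_cast at this; nlinarith
      have h4 : 1 ≤ (n : ℝ) ^ 2 * (2 * s / t) := by
        rw [← mul_div_assoc, le_div_iff₀ ht0]; nlinarith
      linarith
    simp only [eval_mul, eval_comp, eval_sub, eval_C, eval_X]
    have h1 : |(Chebyshev.T ℝ n).eval (1 + 2 * s / t - 2 / t * v : ℝ)| ≤ 1 := by
      apply Chebyshev.abs_eval_T_real_le_one
      have hv' : (s : ℝ) ≤ v := by exact_mod_cast hv
      have hvt' : (v : ℝ) ≤ t := by exact_mod_cast hvt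
      have e : (1 + 2 * s / t - 2 / t * v : ℝ) = (t + 2 * s - 2 * v) / t := by field_simp
      rw [e, abs_le, le_div_iff₀ ht0, div_le_iff₀ ht0]
      constructor <;> linarith
    rw [abs_mul, abs_of_pos (by positivity)]
    have h2 : 1 / c ≤ 1 / 2 := one_div_le_one_div_of_le (by norm_num) hc2
    have h3 : 0 ≤ 1 / c := by positivity
    nlinarith [abs_nonneg ((Chebyshev.T ℝ n).eval (1 + 2 * s / t - 2 / t * v : ℝ))]

theorem sum_sqrt_div_le (t s : ℕ) :
    ∑ j ∈ Finset.range s, (Nat.sqrt (t / (j + 1)) : ℝ) ≤ 2 * √(t * s) := by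
  induction s with
  | zero => simp
  | succ s ih =>
    rw [Finset.sum_range_succ]
    have h1 : (Nat.sqrt (t / (s + 1)) : ℝ) ≤ √t / √(s + 1) := by
      rw [← Real.sqrt_div (by positivity)]
      refine Real.nat_sqrt_le_real_sqrt.trans (Real.sqrt_le_sqrt ?_)
      exact_mod_cast Nat.cast_div_le (α := ℝ) (m := t) (n := s + 1)
    have h2 : 1 / √(s + 1 : ℝ) ≤ 2 * (√(s + 1) - √s) := by
      have hp : 0 < √(s + 1 : ℝ) := Real.sqrt_pos.2 (by positivity)
      rw [div_le_iff₀ hp]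
      have e1 : √(s + 1 : ℝ) ^ 2 = s + 1 := Real.sq_sqrt (by positivity)
      have e2 : √(s : ℝ) ^ 2 = s := Real.sq_sqrt (by positivity)
      nlinarith [sq_nonneg (√(s + 1 : ℝ) - √s)]
    have h3 : √(t * s : ℝ) = √t * √s := Real.sqrt_mul (by positivity) _
    have h4 : √(t * (s + 1 : ℕ) : ℝ) = √t * √(s + 1) := by
      push_cast; exact Real.sqrt_mul (by positivity) _
    rw [h3] at ih
    rw [h4]
    have h5 : √t / √(s + 1 : ℝ) = √t * (1 / √(s + 1 : ℝ)) := by ring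
    nlinarith [Real.sqrt_nonneg (t : ℝ), mul_le_mul_of_nonneg_left h2 (Real.sqrt_nonneg (t : ℝ))]

open Polynomial in
-- One factor for each of the points 1, …, s gives exact zeros there, and beyond s the s-th power of
-- a polynomial bounded by 1/2 gives the error. The exact zeros save degree: the j-th one costs only
-- about √(t/j), and these costs add up to O(√(ts) + s), whereas the s-th power of a polynomial that
-- is small on all of {1, …, t} would cost s√t.
theorem exists_nor_polynomial (t s : ℕ) (hs : 1 ≤ s) :
    ∃ P : ℝ[X], (P.natDegree : ℝ) ≤ 3 * √(t * s) + 2 * s ∧ P.eval 0 = 1 ∧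
      ∀ v : ℕ, 1 ≤ v → v ≤ t → |P.eval (v : ℝ)| ≤ (1 / 2) ^ s := by
  choose! R hRd hR0 hRj hRle using exists_polynomial_root t
  obtain ⟨H, hHd, hH0, hHle⟩ := exists_polynomial_le_half t s hs
  refine ⟨(∏ j ∈ Finset.range s, R (j + 1)) * H ^ s, ?_, ?_, ?_⟩
  · have h1 : ((∏ j ∈ Finset.range s, R (j + 1)) * H ^ s).natDegree ≤
        ∑ j ∈ Finset.range s, (Nat.sqrt (t / (j + 1)) + 1) + s * (Nat.sqrt (t / s) + 1) := by
      refine natDegree_mul_le.trans (add_le_add ?_ ?_)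
      · exact (natDegree_prod_le _ _).trans (Finset.sum_le_sum fun j _ => hRd (j + 1) (by omega))
      · exact natDegree_pow_le.trans (Nat.mul_le_mul_left _ hHd)
    have h2 : (((∏ j ∈ Finset.range s, R (j + 1)) * H ^ s).natDegree : ℝ) ≤
        ∑ j ∈ Finset.range s, (Nat.sqrt (t / (j + 1)) : ℝ) + s + s * (Nat.sqrt (t / s) + 1) := by
      have := (Nat.cast_le (α := ℝ)).2 h1
      push_cast [Finset.sum_add_distrib] at this
      simpa using this
    have h3 := sum_sqrt_div_le t s
    have hs0 : (0 : ℝ) < s := by exact_mod_cast hs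
    have h4 : (s : ℝ) * Nat.sqrt (t / s) ≤ √(t * s) := by
      have h5 : (Nat.sqrt (t / s) : ℝ) ≤ √(t / s : ℝ) :=
        Real.nat_sqrt_le_real_sqrt.trans (Real.sqrt_le_sqrt Nat.cast_div_le)
      have h6 : (s : ℝ) * √(t / s : ℝ) = √(t * s) := by
        rw [show (t * s : ℝ) = s ^ 2 * (t / s) by field_simp, Real.sqrt_mul (by positivity),
          Real.sqrt_sq hs0.le]
      rw [← h6]; exact mul_le_mul_of_nonneg_left h5 hs0.le
    linarith
  · rw [eval_mul, eval_prod, eval_pow, hH0, one_pow, mul_one]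
    exact Finset.prod_eq_one fun j _ => hR0 (j + 1) (by omega)
  · intro v hv hvt
    rw [eval_mul, eval_prod, eval_pow, abs_mul, abs_pow]
    by_cases hvs : v ≤ s
    · rw [Finset.prod_eq_zero (i := v - 1) (Finset.mem_range.2 (by omega))]
      · simp
      · have := hRj v hv
        rwa [Nat.sub_add_cancel hv]
    · have h1 : |∏ j ∈ Finset.range s, (R (j + 1)).eval (v : ℝ)| ≤ 1 := by
        rw [Finset.abs_prod]
        exact Finset.prod_le_one (fun _ _ => abs_nonneg _) fun j _ => hRle (j + 1) (by omega) v hvt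
      have h2 := pow_le_pow_left₀ (abs_nonneg _) (hHle v (by omega) hvt) s
      calc _ ≤ 1 * (1 / 2 : ℝ) ^ s := mul_le_mul h1 h2 (by positivity) zero_le_one
        _ = _ := one_mul _

/-- A low-degree approximation of the indicator of `v = 0` on `{0, …, t}`, in terms of the
coefficients of its Newton expansion. -/
theorem exists_nor_newton (t s : ℕ) (hs : 1 ≤ s) :
    ∃ (D : ℕ) (α : ℕ → ℝ), (D : ℝ) ≤ 3 * √(t * s) + 2 * s ∧ (∀ r, |α r| ≤ 2 ^ r) ∧
      (∀ r, D < r → α r = 0) ∧ α 0 = 1 ∧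
      ∀ v, 1 ≤ v → v ≤ t → |∑ r ∈ Finset.range (v + 1), (v.choose r : ℝ) * α r| ≤ (1 / 2) ^ s := by
  obtain ⟨P, hd, h0, hle⟩ := exists_nor_polynomial t s hs
  have habs : ∀ v : ℕ, v ≤ t → |P.eval (v : ℝ)| ≤ 1 := by
    intro v hv
    rcases Nat.eq_zero_or_pos v with rfl | hp
    · simp [h0]
    · exact (hle v hp hv).trans (pow_le_one₀ (by norm_num) (by norm_num))
  have hΔ : ∀ r, r ≤ t → |(fwdDiff (1 : ℝ))^[r] (fun x => P.eval x) 0| ≤ 2 ^ r := by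
    intro r hr
    rw [fwdDiff_iter_eq_sum_shift]
    refine (Finset.abs_sum_le_sum_abs _ _).trans ?_
    calc _ ≤ ∑ k ∈ Finset.range (r + 1), (r.choose k : ℝ) := by
          refine Finset.sum_le_sum fun k hk => ?_
          have hk' : k ≤ r := by simpa [Nat.lt_succ_iff] using hk
          have := habs k (hk'.trans hr)
          simp only [zero_add, nsmul_eq_mul, mul_one, zsmul_eq_mul, abs_mul]
          push_cast
          rw [abs_mul, abs_pow, abs_neg, abs_one, one_pow, one_mul, Nat.abs_cast]
          nlinarith [Nat.cast_nonneg (α := ℝ) (r.choose k)]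
      _ = 2 ^ r := by exact_mod_cast Nat.sum_range_choose r
  -- The coefficients are the forward differences at 0. Those with r ≤ t involve only values bounded
  -- by 1, hence are at most 2^r; the others are never needed for v ≤ t and are set to 0 so that the
  -- bound holds for all r.
  refine ⟨P.natDegree, fun r => if r ≤ t then (fwdDiff (1 : ℝ))^[r] (fun x => P.eval x) 0 else 0,
    hd, ?_, ?_, ?_, ?_⟩
  · intro r
    dsimp only
    split_ifs with h
    · exact hΔ r h
    · simp
  · intro r hr
    have := Polynomial.fwdDiff_iter_eq_zero_of_degree_lt hr
    simp [this]
  · simp [h0]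
  · intro v hv hvt
    have h1 := shift_eq_sum_fwdDiff_iter (1 : ℝ) (fun x => P.eval x) v 0
    have h2 : ∑ r ∈ Finset.range (v + 1), (v.choose r : ℝ) *
        (if r ≤ t then (fwdDiff (1 : ℝ))^[r] (fun x => P.eval x) 0 else 0) = P.eval (v : ℝ) := by
      have h3 : P.eval (v : ℝ) = ∑ r ∈ Finset.range (v + 1),
          v.choose r • (fwdDiff (1 : ℝ))^[r] (fun x => P.eval x) 0 := by
        simpa using h1
      rw [h3]
      refine Finset.sum_congr rfl fun r hr => ?_
      have : r ≤ t := by have := Finset.mem_range.1 hr; omega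
      simp [this]
    rw [h2]
    exact hle v hv hvt

/-! ### Low-degree simulation of a query algorithm -/

/-- The set of addresses that a query algorithm probes on memory `m`. -/
def ProbeTree.probed {w : ℕ} (m : Memory w) : ProbeTree w → Finset (Fin (2 ^ w))
  | .answer _ => ∅
  | .probe address next => insert address ((next (m address)).probed m)

variable {w : ℕ}

theorem ProbeTree.card_probed_le (m : Memory w) (τ : ProbeTree w) :
    (τ.probed m).card ≤ τ.probes m := by
  induction τ with
  | answer a => simp [probed, probes]
  | probe a next ih => exact (card_insert_le _ _).trans (Nat.succ_le_succ (ih _))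

theorem ProbeTree.eq_of_agree {m m' : Memory w} (τ : ProbeTree w)
    (h : ∀ a ∈ τ.probed m, m a = m' a) :
    τ.output m = τ.output m' ∧ τ.probes m = τ.probes m' ∧ τ.probed m = τ.probed m' := by
  induction τ with
  | answer a => simp [probed, probes, output]
  | probe a next ih =>
    have ha : m a = m' a := h a (by simp [probed])
    have := ih (m a) fun c hc => h c (by simp [probed, hc])
    simp only [probed, probes, output, ← ha]
    exact ⟨this.1, by rw [this.2.1], by rw [this.2.2]⟩

/-- The cells in which two memory contents differ. -/
def diff (N M : Memory w) : Finset (Fin (2 ^ w)) := {a | M a ≠ N a}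

@[simp] theorem mem_diff {N M : Memory w} {a : Fin (2 ^ w)} : a ∈ diff N M ↔ M a ≠ N a := by
  simp [diff]

theorem diff_piecewise {N M : Memory w} {R : Finset (Fin (2 ^ w))} (hR : R ⊆ diff N M) :
    diff N (R.piecewise M N) = R := by
  ext a
  by_cases h : a ∈ R
  · simpa [h] using hR h
  · simp [h]

theorem piecewise_piecewise {N M : Memory w} {S R : Finset (Fin (2 ^ w))} (h : S ⊆ R) :
    S.piecewise (R.piecewise M N) N = S.piecewise M N := by
  ext a
  by_cases h1 : a ∈ S
  · simp [h1, h h1]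
  · simp [h1]

theorem piecewise_diff (N M : Memory w) : (diff N M).piecewise M N = M := by
  ext a
  by_cases h : M a = N a <;> simp [Finset.piecewise, h]

/-- The query algorithm answers `0` with at most `t` probes on memory `m`, and probes all
cells in `S`. -/
def ProbeTree.Rejects (τ : ProbeTree w) (t : ℕ) (m : Memory w) (S : Finset (Fin (2 ^ w))) : Prop :=
  τ.output m = false ∧ τ.probes m ≤ t ∧ S ⊆ τ.probed m

/-- S is determined by which of the at most t probes hit it, at most m of them. In the induction the
first probed address a is either outside S, and M is made to agree with N at a, or inside S, and N
is made to agree with M at a while the budget m drops by one. Either way a leaves the set of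
differing cells, so that repeated probes of a do no harm. -/
theorem ProbeTree.card_guess_le (τ : ProbeTree w) (t m : ℕ) (N M : Memory w) :
    #{S ∈ (diff N M).powerset | #S ≤ m ∧ τ.probes (S.piecewise M N) ≤ t ∧
      S ⊆ τ.probed (S.piecewise M N)} ≤ (t + 1) ^ m := by
  classical
  induction τ generalizing t m N M with
  | answer a =>
    have : ({S ∈ (diff N M).powerset | #S ≤ m ∧ (answer a).probes (S.piecewise M N) ≤ t ∧
      S ⊆ (answer a).probed (S.piecewise M N)}) ⊆ {∅} := by
      intro S hS
      simp only [mem_filter, probed, subset_empty] at hS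
      simp [hS.2.2.2]
    refine (card_le_card this).trans ?_
    simpa using Nat.one_le_pow _ _ (Nat.succ_pos t)
  | probe a next ih =>
    rcases t with _ | t
    · simp [probes]
    have hout : #{S ∈ (diff N M).powerset | (#S ≤ m ∧ (probe a next).probes (S.piecewise M N) ≤ t + 1 ∧
        S ⊆ (probe a next).probed (S.piecewise M N)) ∧ a ∉ S} ≤ (t + 1) ^ m := by
      refine le_trans (card_le_card ?_) (ih (N a) t m N (Function.update M a (N a)))
      intro S hS
      rw [mem_filter, mem_powerset] at hS ⊢
      obtain ⟨h1, ⟨h2, h3, h4⟩, h5⟩ := hS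
      simp only [probes, probed] at h3 h4
      have e : S.piecewise (Function.update M a (N a)) N = S.piecewise M N := by
        ext c
        by_cases hc : c ∈ S
        · have : c ≠ a := fun h => h5 (h ▸ hc)
          simp [hc, this]
        · simp [hc]
      have ea : S.piecewise M N a = N a := by simp [h5]
      rw [e]
      rw [ea] at h3 h4
      refine ⟨fun c hc => ?_, h2, by omega, ?_⟩
      · have : c ≠ a := fun h => h5 (h ▸ hc)
        simpa [this] using h1 hc
      · intro c hc
        have : c ≠ a := fun h => h5 (h ▸ hc)
        simpa [this] using h4 hc
    have hin : #{S ∈ (diff N M).powerset | (#S ≤ m ∧ (probe a next).probes (S.piecewise M N) ≤ t + 1 ∧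
        S ⊆ (probe a next).probed (S.piecewise M N)) ∧ a ∈ S} ≤ if m = 0 then 0 else (t + 1) ^ (m - 1) := by
      split_ifs with hm
      · subst hm
        refine (card_eq_zero.2 (filter_eq_empty_iff.2 fun S _ hS => ?_)).le
        have := hS.1.1
        simp at this
        simp [this] at hS
      · refine le_trans ?_ (ih (M a) t (m - 1) (Function.update N a (M a)) M)
        refine card_le_card_of_injOn (fun S => S.erase a) ?_ ?_
        · intro S hS
          rw [mem_coe, mem_filter, mem_powerset] at hS ⊢
          obtain ⟨h1, ⟨h2, h3, h4⟩, h5⟩ := hS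
          simp only [probes, probed] at h3 h4
          have e : (S.erase a).piecewise M (Function.update N a (M a)) = S.piecewise M N := by
            ext c
            by_cases hca : c = a
            · subst hca; simp [h5]
            · by_cases hc : c ∈ S <;> simp [hc, hca, Finset.piecewise]
          have ea : S.piecewise M N a = M a := by simp [h5]
          rw [e]
          rw [ea] at h3 h4
          refine ⟨fun c hc => ?_, ?_, by omega, ?_⟩
          · simp only [mem_erase] at hc
            simpa [hc.1] using h1 hc.2
          · rw [card_erase_of_mem h5]; omega
          · intro c hc
            simp only [mem_erase] at hc
            simpa [hc.1] using h4 hc.2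
        · intro S hS S' hS' h
          rw [mem_coe, mem_filter] at hS hS'
          rw [← insert_erase hS.2.2, ← insert_erase hS'.2.2]
          exact congrArg _ h
    have hsplit := card_filter_add_card_filter_not (s := {S ∈ (diff N M).powerset | #S ≤ m ∧
      (probe a next).probes (S.piecewise M N) ≤ t + 1 ∧
      S ⊆ (probe a next).probed (S.piecewise M N)}) (fun S => a ∈ S)
    rw [filter_filter, filter_filter] at hsplit
    rw [← hsplit]
    refine (add_le_add hin hout).trans ?_
    split_ifs with hm
    · simp [hm]
    · obtain ⟨m, rfl⟩ := Nat.exists_eq_succ_of_ne_zero hm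
      simp only [Nat.succ_eq_add_one, Nat.add_sub_cancel]
      calc (t + 1) ^ m + (t + 1) ^ (m + 1) = (t + 1) ^ m * (t + 1 + 1) := by ring
        _ ≤ (t + 1 + 1) ^ m * (t + 1 + 1) := by gcongr; omega
        _ = _ := by ring

theorem sum_powerset_sum_powerset {ι : Type*} [DecidableEq ι] (A : Finset ι)
    (f : Finset ι → Finset ι → ℝ) :
    ∑ R ∈ A.powerset, ∑ S ∈ R.powerset, f S (R \ S) =
      ∑ S ∈ A.powerset, ∑ S' ∈ (A \ S).powerset, f S S' := by
  rw [sum_sigma', sum_sigma']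
  refine sum_bij' (fun x _ => ⟨x.2, x.1 \ x.2⟩) (fun x _ => ⟨x.1 ∪ x.2, x.1⟩) ?_ ?_ ?_ ?_ ?_
  · rintro ⟨R, S⟩ h
    simp only [mem_sigma, mem_powerset] at h ⊢
    exact ⟨h.2.trans h.1, sdiff_subset_sdiff h.1 le_rfl⟩
  · rintro ⟨S, S'⟩ h
    simp only [mem_sigma, mem_powerset] at h ⊢
    exact ⟨union_subset h.1 (h.2.trans sdiff_subset), subset_union_left⟩
  · rintro ⟨R, S⟩ h
    simp only [mem_sigma, mem_powerset] at h ⊢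
    simp [union_sdiff_of_subset h.2]
  · rintro ⟨S, S'⟩ h
    simp only [mem_sigma, mem_powerset] at h ⊢
    have : Disjoint S S' := disjoint_sdiff.mono_right h.2
    simp [union_sdiff_cancel_left this]
  · rintro ⟨R, S⟩ h
    rfl

open Classical in
/-- The contribution of the probed set `diff N N'` to the low-degree simulation of a query
algorithm that knows `N` and those contents of `N'` that differ from `N`: it guesses which of
these cells are read, and of which of them only the address is looked at. -/
noncomputable def ProbeTree.guess (τ : ProbeTree w) (t m : ℕ) (α : ℕ → ℝ) (N N' : Memory w) : ℝ :=
  ∑ S ∈ (diff N N').powerset,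
    if #S ≤ m ∧ τ.Rejects t (S.piecewise N' N) S ∧ diff N N' \ S ⊆ τ.probed (S.piecewise N' N)
    then α #(diff N N' \ S) else 0

open Classical in
-- Split R into the cells S whose contents are used and the remaining cells S', which are only
-- required to be probed. For fixed S, the possible S' are the subsets of the probed differing cells
-- outside S, so summing α over them gives the Newton expansion at their number.
theorem ProbeTree.sum_guess (τ : ProbeTree w) (t m : ℕ) (α : ℕ → ℝ) (N M : Memory w) :
    ∑ R ∈ (diff N M).powerset, τ.guess t m α N (R.piecewise M N) =
      ∑ S ∈ (diff N M).powerset, if #S ≤ m ∧ τ.Rejects t (S.piecewise M N) S then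
        ∑ r ∈ range (#((diff N M ∩ τ.probed (S.piecewise M N)) \ S) + 1),
          ((#((diff N M ∩ τ.probed (S.piecewise M N)) \ S)).choose r : ℝ) * α r else 0 := by
  have h1 : ∑ R ∈ (diff N M).powerset, τ.guess t m α N (R.piecewise M N) =
      ∑ R ∈ (diff N M).powerset, ∑ S ∈ R.powerset, (fun S S' =>
        if #S ≤ m ∧ τ.Rejects t (S.piecewise M N) S ∧ S' ⊆ τ.probed (S.piecewise M N)
          then α #S' else 0) S (R \ S) := by
    refine sum_congr rfl fun R hR => ?_
    rw [guess, diff_piecewise (mem_powerset.1 hR)]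
    refine sum_congr rfl fun S hS => ?_
    rw [piecewise_piecewise (mem_powerset.1 hS)]
  rw [h1, sum_powerset_sum_powerset (diff N M) (fun S S' =>
        if #S ≤ m ∧ τ.Rejects t (S.piecewise M N) S ∧ S' ⊆ τ.probed (S.piecewise M N)
          then α #S' else 0)]
  refine sum_congr rfl fun S _ => ?_
  split_ifs with h
  · simp only [h, true_and]
    rw [← sum_filter]
    have e : ({S' ∈ (diff N M \ S).powerset | S' ⊆ τ.probed (S.piecewise M N)} : Finset _) =
        ((diff N M ∩ τ.probed (S.piecewise M N)) \ S).powerset := by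
      ext S'
      simp only [mem_filter, mem_powerset, subset_iff, mem_sdiff, mem_inter]
      exact ⟨fun h x hx => ⟨⟨(h.1 hx).1, h.2 hx⟩, (h.1 hx).2⟩,
        fun h => ⟨fun x hx => ⟨(h hx).1.1, (h hx).2⟩, fun x hx => (h hx).1.2⟩⟩
    rw [e, sum_powerset_apply_card]
    simp
  · refine sum_eq_zero fun S' _ => if_neg fun h' => h ⟨h'.1, h'.2.1⟩

/-- The query algorithm answers `0` on memory `M` with at most `t` probes, at
most `m` of them to cells where `M` differs from `N`. -/
def ProbeTree.good (τ : ProbeTree w) (t m : ℕ) (N M : Memory w) : Prop :=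
  τ.output M = false ∧ τ.probes M ≤ t ∧ #(diff N M ∩ τ.probed M) ≤ m

open Classical in
-- Only S₀ = `diff N M ∩ τ.probed M` is probed completely without any other differing cell being
-- probed: for such a guess the run agrees with the run on M. It contributes exactly 1 if the query
-- is good. Each other consistent guess leaves v ≥ 1 unguessed cells and contributes at most ε.
theorem ProbeTree.abs_sum_guess_sub_good_le (τ : ProbeTree w) (t m : ℕ) (α : ℕ → ℝ) (N M : Memory w)
    {ε : ℝ} (h0 : α 0 = 1)
    (hα : ∀ v, 1 ≤ v → v ≤ t → |∑ r ∈ range (v + 1), (v.choose r : ℝ) * α r| ≤ ε) (hε : 0 ≤ ε) :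
    |∑ R ∈ (diff N M).powerset, τ.guess t m α N (R.piecewise M N) -
      (if τ.good t m N M then 1 else 0)| ≤ ε * (t + 1) ^ m := by
  set V : Finset (Fin (2 ^ w)) → Finset (Fin (2 ^ w)) := fun S =>
    (diff N M ∩ τ.probed (S.piecewise M N)) \ S with hV
  have hgood : (if τ.good t m N M then (1 : ℝ) else 0) = ∑ S ∈ (diff N M).powerset,
      if #S ≤ m ∧ τ.Rejects t (S.piecewise M N) S then (if V S = ∅ then 1 else 0) else 0 := by
    have hagree : ∀ S ⊆ diff N M, V S = ∅ → ∀ a ∈ τ.probed (S.piecewise M N),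
        S.piecewise M N a = M a := by
      intro S hS hVS a ha
      by_cases haS : a ∈ S
      · simp [haS]
      · have : a ∉ V S := by simp [hVS]
        simp only [hV, mem_sdiff, mem_inter, mem_diff, ha, haS] at this
        simp only [Finset.piecewise, haS, if_false]
        by_contra hne
        simp at this
        exact hne this.symm
    set S₀ := diff N M ∩ τ.probed M with hS₀
    have hag0 : ∀ a ∈ τ.probed M, M a = S₀.piecewise M N a := by
      intro a ha
      by_cases hne : M a = N a
      · simp [Finset.piecewise, hne]
      · have : a ∈ S₀ := by simp [hS₀, hne, ha]
        simp [this]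
    obtain ⟨e1, e2, e3⟩ := τ.eq_of_agree hag0
    have hV0 : V S₀ = ∅ := by
      simp only [hV, ← e3]
      simp [hS₀]
    rw [sum_eq_single S₀]
    · simp only [Rejects, ← e1, ← e2, ← e3, hV0, if_true, good]
      have : S₀ ⊆ τ.probed M := inter_subset_right
      simp only [this, and_true]
      congr 1
      simp only [eq_iff_iff]; tauto
    · intro S hS hne
      rw [mem_powerset] at hS
      split_ifs with h1 h2
      · exfalso
        obtain ⟨-, -, f3⟩ := τ.eq_of_agree (hagree S hS h2)
        apply hne
        apply subset_antisymm
        · intro a ha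
          exact mem_inter.2 ⟨hS ha, f3 ▸ h1.2.2.2 ha⟩
        · have := sdiff_eq_empty_iff_subset.1 h2
          rw [f3] at this
          exact this
      · rfl
      · rfl
    · intro h
      exact absurd (mem_powerset.2 inter_subset_left) h
  rw [τ.sum_guess, hgood, ← sum_sub_distrib]
  refine (abs_sum_le_sum_abs _ _).trans ?_
  calc _ ≤ ∑ S ∈ (diff N M).powerset, if #S ≤ m ∧ τ.probes (S.piecewise M N) ≤ t ∧
          S ⊆ τ.probed (S.piecewise M N) then ε else 0 := by
        refine sum_le_sum fun S hS => ?_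
        by_cases h : #S ≤ m ∧ τ.Rejects t (S.piecewise M N) S
        · rw [if_pos h, if_pos h]
          by_cases hv : V S = ∅
          · have hv' : (diff N M ∩ τ.probed (S.piecewise M N)) \ S = ∅ := hv
            simp [hv, hv', h0, hε, h.2.2, h.1]
          · have hv' : ¬ (diff N M ∩ τ.probed (S.piecewise M N)) \ S = ∅ := hv
            rw [if_neg hv', sub_zero, if_pos ⟨h.1, h.2.2⟩]
            refine hα _ (card_pos.2 (nonempty_iff_ne_empty.2 hv)) ?_
            refine (card_le_card (sdiff_subset.trans inter_subset_right)).trans ?_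
            exact (τ.card_probed_le _).trans h.2.2.1
        · rw [if_neg h, if_neg h, sub_zero, abs_zero]
          split_ifs <;> simp [hε]
    _ = ε * #{S ∈ (diff N M).powerset | #S ≤ m ∧ τ.probes (S.piecewise M N) ≤ t ∧
          S ⊆ τ.probed (S.piecewise M N)} := by
        rw [← sum_filter, sum_const, nsmul_eq_mul, mul_comm]
    _ ≤ _ := by
        refine mul_le_mul_of_nonneg_left ?_ hε
        exact_mod_cast τ.card_guess_le t m N M

theorem sum_choose_two_pow_le (v t D : ℕ) (hv : v ≤ t) :
    ∑ r ∈ range (v + 1), (v.choose r : ℝ) * (if r ≤ D then 2 ^ r else 0) ≤ (2 * t + 1) ^ D := by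
  calc _ ≤ ∑ r ∈ range (v + 1), (if r ≤ D then (D.choose r : ℝ) * (2 * t) ^ r else 0) := by
        refine sum_le_sum fun r _ => ?_
        split_ifs with h
        · have h1 : (v.choose r : ℝ) ≤ t ^ r := by
            exact_mod_cast (Nat.choose_le_pow v r).trans (Nat.pow_le_pow_left hv r)
          have h2 : (1 : ℝ) ≤ D.choose r := by exact_mod_cast Nat.choose_pos h
          rw [mul_pow]
          have h3 : (0 : ℝ) ≤ 2 ^ r * t ^ r := by positivity
          nlinarith [mul_le_mul_of_nonneg_right h1 (show (0 : ℝ) ≤ 2 ^ r by positivity)]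
        · simp
    _ = ∑ r ∈ range (v + 1) with r ≤ D, (D.choose r : ℝ) * (2 * t) ^ r := by rw [sum_filter]
    _ ≤ ∑ r ∈ range (D + 1), (D.choose r : ℝ) * (2 * t) ^ r := by
        refine sum_le_sum_of_subset_of_nonneg ?_ fun _ _ _ => by positivity
        intro r hr
        simp only [mem_filter, mem_range] at hr ⊢
        omega
    _ = (2 * t + 1) ^ D := by
        rw [add_pow]
        refine sum_congr rfl fun r _ => ?_
        simp [mul_comm]

theorem ProbeTree.sum_abs_guess_le (τ : ProbeTree w) (t m D : ℕ) (α : ℕ → ℝ) (N M : Memory w)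
    (h2 : ∀ r, |α r| ≤ 2 ^ r) (hD : ∀ r, D < r → α r = 0) :
    ∑ R ∈ (diff N M).powerset, |τ.guess t m α N (R.piecewise M N)| ≤
      (t + 1) ^ m * (2 * t + 1) ^ D := by
  classical
  -- Majorizing |α| by nonnegative coefficients allows `sum_guess` to be used again for the sum of
  -- absolute values.
  set β : ℕ → ℝ := fun r => if r ≤ D then 2 ^ r else 0 with hβ
  have hαβ : ∀ r, |α r| ≤ β r := by
    intro r
    simp only [hβ]
    split_ifs with h
    · exact h2 r
    · rw [hD r (by omega), abs_zero]
  calc _ ≤ ∑ R ∈ (diff N M).powerset, τ.guess t m β N (R.piecewise M N) := by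
        refine sum_le_sum fun R _ => (abs_sum_le_sum_abs _ _).trans (sum_le_sum fun S _ => ?_)
        split_ifs
        · exact hαβ _
        · simp
    _ ≤ ∑ S ∈ (diff N M).powerset, if #S ≤ m ∧ τ.probes (S.piecewise M N) ≤ t ∧
          S ⊆ τ.probed (S.piecewise M N) then (2 * t + 1 : ℝ) ^ D else 0 := by
        rw [τ.sum_guess]
        refine sum_le_sum fun S _ => ?_
        by_cases h : #S ≤ m ∧ τ.Rejects t (S.piecewise M N) S
        · rw [if_pos h, if_pos ⟨h.1, h.2.2⟩]
          refine sum_choose_two_pow_le _ t D ?_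
          refine (card_le_card (sdiff_subset.trans inter_subset_right)).trans ?_
          exact (τ.card_probed_le _).trans h.2.2.1
        · rw [if_neg h]
          split_ifs <;> positivity
    _ = #{S ∈ (diff N M).powerset | #S ≤ m ∧ τ.probes (S.piecewise M N) ≤ t ∧
          S ⊆ τ.probed (S.piecewise M N)} * (2 * t + 1 : ℝ) ^ D := by
        rw [← sum_filter, sum_const, nsmul_eq_mul]
    _ ≤ _ := by
        refine mul_le_mul_of_nonneg_right ?_ (by positivity)
        exact_mod_cast τ.card_guess_le t m N M

theorem ProbeTree.guess_eq_zero (τ : ProbeTree w) (t m D : ℕ) (α : ℕ → ℝ) (N N' : Memory w)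
    (hD : ∀ r, D < r → α r = 0) (h : m + D < #(diff N N')) : τ.guess t m α N N' = 0 := by
  classical
  refine sum_eq_zero fun S hS => ?_
  split_ifs with h1
  · apply hD
    have := card_sdiff_add_card_eq_card (mem_powerset.1 hS)
    omega
  · rfl

/-! ### Products of simulated answers, and counting of memories -/

/-- Products of functions that are sums over the sets of differing cells are of the same form. -/
theorem exists_prod_expansion {ι : Type*} (G : Finset ι) (c : ι → Memory w → Memory w → ℝ) (C : ℝ)
    (u : ℕ) (hC : ∀ j N M, ∑ R ∈ (diff N M).powerset, |c j N (R.piecewise M N)| ≤ C)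
    (hu : ∀ j N N', u < #(diff N N') → c j N N' = 0) :
    ∃ ψ : Memory w → Memory w → ℝ,
      (∀ N M, ∏ j ∈ G, ∑ R ∈ (diff N M).powerset, c j N (R.piecewise M N) =
        ∑ R ∈ (diff N M).powerset, ψ N (R.piecewise M N)) ∧
      (∀ N M, ∑ R ∈ (diff N M).powerset, |ψ N (R.piecewise M N)| ≤ C ^ #G) ∧
      (∀ N N', #G * u < #(diff N N') → ψ N N' = 0) := by
  classical
  induction G using Finset.induction_on with
  | empty =>
    have key : ∀ N M : Memory w, ∑ R ∈ (diff N M).powerset,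
        (if diff N (R.piecewise M N) = ∅ then (1 : ℝ) else 0) = 1 := by
      intro N M
      rw [sum_eq_single ∅]
      · rw [diff_piecewise (empty_subset _)]; simp
      · intro R hR hne
        rw [diff_piecewise (mem_powerset.1 hR), if_neg hne]
      · intro h; simp at h
    refine ⟨fun N N' => if diff N N' = ∅ then 1 else 0, fun N M => ?_, fun N M => ?_,
      fun N N' h => ?_⟩
    · rw [key]; simp
    · simp only [abs_ite, abs_one, abs_zero, card_empty, pow_zero]; exact (key N M).le
    · have : diff N N' ≠ ∅ := by
        intro h'; simp [h'] at h
      simp [this]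
  | insert j G hj ih =>
    obtain ⟨ψ, h1, h2, h3⟩ := ih
    -- A product of two sums over sets is grouped by the union of the two sets. The coefficient of R
    -- then depends only on N and on the contents of the cells in R.
    have conv : ∀ (N M : Memory w) (f g : Memory w → Memory w → ℝ),
        ∑ R ∈ (diff N M).powerset, ∑ x ∈ R.powerset ×ˢ R.powerset with x.1 ∪ x.2 = R,
          f N (x.1.piecewise (R.piecewise M N) N) * g N (x.2.piecewise (R.piecewise M N) N) =
        (∑ R ∈ (diff N M).powerset, f N (R.piecewise M N)) *
          ∑ R ∈ (diff N M).powerset, g N (R.piecewise M N) := by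
      intro N M f g
      rw [sum_mul_sum, ← sum_product']
      rw [← sum_fiberwise_of_maps_to (s := (diff N M).powerset ×ˢ (diff N M).powerset)
        (t := (diff N M).powerset) (g := fun x => x.1 ∪ x.2)]
      · refine sum_congr rfl fun R hR => ?_
        have hR' := mem_powerset.1 hR
        have e : ({x ∈ R.powerset ×ˢ R.powerset | x.1 ∪ x.2 = R} : Finset _) =
            {x ∈ (diff N M).powerset ×ˢ (diff N M).powerset | x.1 ∪ x.2 = R} := by
          ext ⟨x, y⟩
          simp only [mem_filter, mem_product, mem_powerset]
          constructor
          · rintro ⟨⟨h1, h2⟩, h3⟩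
            exact ⟨⟨h1.trans hR', h2.trans hR'⟩, h3⟩
          · rintro ⟨_, h3⟩
            exact ⟨⟨h3 ▸ subset_union_left, h3 ▸ subset_union_right⟩, h3⟩
        rw [e]
        refine sum_congr rfl fun x hx => ?_
        simp only [mem_filter, mem_product, mem_powerset] at hx
        rw [piecewise_piecewise (hx.2 ▸ subset_union_left),
          piecewise_piecewise (hx.2 ▸ subset_union_right)]
      · rintro ⟨x, y⟩ h
        simp only [mem_product, mem_powerset] at h ⊢
        exact union_subset h.1 h.2
    refine ⟨fun N N' => ∑ x ∈ (diff N N').powerset ×ˢ (diff N N').powerset with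
      x.1 ∪ x.2 = diff N N', c j N (x.1.piecewise N' N) * ψ N (x.2.piecewise N' N),
      fun N M => ?_, fun N M => ?_, fun N N' h => ?_⟩
    · rw [prod_insert hj, h1, ← conv N M (c j) ψ]
      refine sum_congr rfl fun R hR => ?_
      dsimp only
      rw [diff_piecewise (mem_powerset.1 hR)]
    · have hC0 : 0 ≤ C := (sum_nonneg fun _ _ => abs_nonneg _).trans (hC j N M)
      rw [card_insert_of_notMem hj, pow_succ']
      refine le_trans ?_ (mul_le_mul (hC j N M) (h2 N M) (sum_nonneg fun _ _ => abs_nonneg _) hC0)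
      rw [← conv N M (fun N N' => |c j N N'|) (fun N N' => |ψ N N'|)]
      refine sum_le_sum fun R hR => ?_
      dsimp only
      rw [diff_piecewise (mem_powerset.1 hR)]
      refine (abs_sum_le_sum_abs _ _).trans (le_of_eq ?_)
      exact sum_congr rfl fun x _ => abs_mul _ _
    · refine sum_eq_zero fun x hx => ?_
      simp only [mem_filter, mem_product, mem_powerset] at hx
      have hc : #(diff N N') ≤ #x.1 + #x.2 := hx.2 ▸ card_union_le _ _
      rw [card_insert_of_notMem hj, add_mul, one_mul] at h
      by_cases hx1 : u < #x.1
      · rw [hu j N _ (by rwa [diff_piecewise hx.1.1]), zero_mul]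
      · rw [h3 N (x.2.piecewise N' N) (by rw [diff_piecewise hx.1.2]; omega), mul_zero]

theorem card_hamming_ball_le (M₀ : Memory w) (p : ℕ) :
    #{N : Memory w | #(diff M₀ N) ≤ p} ≤ 4 ^ (w * p) := by
  classical
  -- A memory in the ball is described by p pairs of an address and its contents, 2w bits each.
  -- Unused pairs are padded with the address 0 and its true contents.
  let f : (Fin p → Fin (2 ^ w) × Fin (2 ^ w)) → Memory w := fun e a =>
    if h : ∃ n, (e n).1 = a then (e h.choose).2 else M₀ a
  have hsub : ({N : Memory w | #(diff M₀ N) ≤ p} : Finset _) ⊆ univ.image f := by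
    intro N hN
    simp only [mem_filter, mem_univ, true_and] at hN
    obtain ⟨e, he⟩ : ∃ e : Fin p → Fin (2 ^ w), ∀ a ∈ diff M₀ N, ∃ n, e n = a := by
      let en := (diff M₀ N).equivFin
      refine ⟨fun n => if h : n.1 < #(diff M₀ N) then (en.symm ⟨n, h⟩).1 else ⟨0, by positivity⟩, ?_⟩
      intro a ha
      refine ⟨⟨en ⟨a, ha⟩, (en ⟨a, ha⟩).2.trans_le hN⟩, ?_⟩
      simp
    refine mem_image.2 ⟨fun n => (e n, N (e n)), mem_univ _, ?_⟩
    ext a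
    simp only [f]
    split_ifs with h
    · rw [h.choose_spec]
    · have : a ∉ diff M₀ N := fun ha => h (he a ha)
      simp only [mem_diff, not_not] at this
      rw [this]
  refine (card_le_card hsub).trans (card_image_le.trans ?_)
  simp only [card_univ, Fintype.card_fun, Fintype.card_prod, Fintype.card_fin]
  rw [← pow_add, ← pow_mul, show (4 : ℕ) = 2 ^ 2 by rfl, ← pow_mul]
  apply le_of_eq; congr 1; ring

/-- Resampling one coordinate preserves the uniform distribution: exchanging its old value with the
new one is an involution. -/
theorem sum_sum_update {ι α : Type*} [Fintype ι] [DecidableEq ι] [Fintype α] (i : ι)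
    (f : (ι → α) → ℝ) :
    ∑ Q, ∑ c, f (Function.update Q i c) = Fintype.card α * ∑ Q, f Q := by
  let e : (ι → α) × α ≃ (ι → α) × α :=
    { toFun := fun x => (Function.update x.1 i x.2, x.1 i)
      invFun := fun x => (Function.update x.1 i x.2, x.1 i)
      left_inv := fun x => by simp
      right_inv := fun x => by simp }
  have h := e.sum_comp fun x => f x.1
  rw [Fintype.sum_prod_type, Fintype.sum_prod_type] at h
  simp only [e, Equiv.coe_fn_mk, sum_const, card_univ, nsmul_eq_mul] at h
  rw [h, mul_sum]

/-- A sequence of nonnegative factors, each with a bounded sum over its last coordinate. -/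
theorem sum_prod_adapted_le {n B : ℕ} (hB : 0 < B) (f : Fin n → (Fin n → Fin B) → ℝ) (C : ℝ)
    (h0 : ∀ l t, 0 ≤ f l t) (hdep : ∀ l t t', (∀ c ≤ l, t c = t' c) → f l t = f l t')
    (hsum : ∀ l t, ∑ c, f l (Function.update t l c) ≤ C) (hC : 0 ≤ C) :
    ∑ t, ∏ l, f l t ≤ C ^ n := by
  have hB' : (0 : ℝ) < B := by exact_mod_cast hB
  -- The sum always runs over all n coordinates, so taking in one more factor multiplies the bound
  -- by C / B; the powers of B keep this free of divisions.
  have key : ∀ k, k ≤ n →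
      (B : ℝ) ^ k * ∑ t, ∏ l with l.val < k, f l t ≤ (B : ℝ) ^ n * C ^ k := by
    intro k
    induction k with
    | zero => intro _; simp
    | succ k ih =>
      intro hk
      let i : Fin n := ⟨k, hk⟩
      have hfil : univ.filter (fun l : Fin n => l.val < k + 1) =
          insert i (univ.filter fun l : Fin n => l.val < k) := by
        ext l
        simp only [mem_filter, mem_univ, true_and, mem_insert, Fin.ext_iff, i]
        omega
      have hni : i ∉ univ.filter fun l : Fin n => l.val < k := by simp [i]
      have h1 := sum_sum_update i fun t => ∏ l with l.val < k + 1, f l t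
      rw [Fintype.card_fin] at h1
      have h2 : ∑ t, ∑ c, ∏ l with l.val < k + 1, f l (Function.update t i c) ≤
          ∑ t, (∏ l with l.val < k, f l t) * C := by
        refine sum_le_sum fun t _ => ?_
        have h3 : ∀ c, ∏ l with l.val < k + 1, f l (Function.update t i c) =
            (∏ l with l.val < k, f l t) * f i (Function.update t i c) := by
          intro c
          rw [hfil, prod_insert hni, mul_comm]
          congr 1
          refine prod_congr rfl fun l hl => hdep _ _ _ fun c' hc' => ?_
          have hl' : l.val < k := by simpa using hl
          have : c' ≠ i := by
            rintro rfl
            have : i.val ≤ l.val := hc'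
            simp [i] at this; omega
          simp [this]
        simp only [h3, ← mul_sum]
        exact mul_le_mul_of_nonneg_left (hsum i t) (prod_nonneg fun l _ => h0 l t)
      rw [h1, ← sum_mul] at h2
      calc (B : ℝ) ^ (k + 1) * ∑ t, ∏ l with l.val < k + 1, f l t
          = B ^ k * (B * ∑ t, ∏ l with l.val < k + 1, f l t) := by ring
        _ ≤ B ^ k * ((∑ t, ∏ l with l.val < k, f l t) * C) := by gcongr
        _ = (B ^ k * ∑ t, ∏ l with l.val < k, f l t) * C := by ring
        _ ≤ (B ^ n * C ^ k) * C := mul_le_mul_of_nonneg_right (ih (by omega)) hC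
        _ = _ := by ring
  have h := key n le_rfl
  have : univ.filter (fun l : Fin n => l.val < n) = univ := by ext l; simp
  rw [this] at h
  exact le_of_mul_le_mul_left h (by positivity)

/-! ### Random paths in a Butterfly and the edges they share -/

/-- A query in one Butterfly: a source and a sink. -/
abbrev Path (B I : ℕ) : Type := Fin (B ^ I) × Fin (B ^ I)

variable {B I : ℕ}

/-- The edges on the path of a query. -/
def pathEdges (q : Path B I) : Finset (Edge B I) := univ.image (pathEdge q.1 q.2)

@[simp] theorem pathEdge_layer (s t : Fin (B ^ I)) (l : Fin I) : (pathEdge s t l).1.1 = l := rfl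

@[simp] theorem pathEdge_source (s t : Fin (B ^ I)) (l : Fin I) :
    (pathEdge s t l).1.2.1 = pathNode s t l := rfl

@[simp] theorem pathEdge_target (s t : Fin (B ^ I)) (l : Fin I) :
    (pathEdge s t l).1.2.2 = pathNode s t (l + 1) := rfl

theorem pathEdge_injective (s t : Fin (B ^ I)) : Function.Injective (pathEdge s t) := by
  intro l l' h
  have := congrArg (fun e : Edge B I => e.1.1) h
  simpa using this

theorem card_pathEdges (q : Path B I) : #(pathEdges q) = I := by
  simp [pathEdges, card_image_of_injective _ (pathEdge_injective q.1 q.2)]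

theorem card_pathEdges_inter (q : Path B I) (E : Finset (Edge B I)) :
    #(pathEdges q ∩ E) = #{l | pathEdge q.1 q.2 l ∈ E} := by
  rw [← card_image_of_injective _ (pathEdge_injective q.1 q.2)]
  congr 1
  ext e
  simp only [pathEdges, mem_inter, mem_image, mem_univ, true_and, mem_filter]
  constructor
  · rintro ⟨⟨l, rfl⟩, h⟩; exact ⟨l, h, rfl⟩
  · rintro ⟨l, h, rfl⟩; exact ⟨⟨l, rfl⟩, h⟩

/-- Every node has at most `lam` outgoing edges in `E`. -/
def OutBound (lam : ℕ) (E : Finset (Edge B I)) : Prop :=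
  ∀ (l : Fin I) (v : Fin (B ^ I)), #{e ∈ E | e.1.1 = l ∧ e.1.2.1 = v} ≤ lam

theorem OutBound.mono {lam : ℕ} {E E' : Finset (Edge B I)} (h : OutBound lam E') (hE : E ⊆ E') :
    OutBound lam E :=
  fun l v => (card_le_card (filter_subset_filter _ hE)).trans (h l v)

theorem pathNode_congr {s t t' : Fin (B ^ I)} {l : ℕ} (h : ∀ c : Fin I, c.val < l → digit t c = digit t' c) :
    pathNode s t l = pathNode s t' l := by
  unfold pathNode
  congr 1
  ext c
  split_ifs with hc
  · rw [h c hc]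
  · rfl

/-- From a fixed source, a random sink makes the path a random walk: at each layer it takes one of B
outgoing edges, of which at most `lam` lie in E. Each layer therefore contributes a factor of at
most 1 + x·lam/B ≤ 2 on average. -/
theorem sum_pow_card_inter_le (hB : 0 < B) {lam : ℕ} {E : Finset (Edge B I)} (hE : OutBound lam E)
    {x : ℝ} (hx : 1 ≤ x) (hxl : x * lam ≤ B) :
    ∑ q : Path B I, x ^ #(pathEdges q ∩ E) ≤ Fintype.card (Path B I) * 2 ^ I := by
  have hs : ∀ s : Fin (B ^ I), ∑ t, x ^ #(pathEdges (s, t) ∩ E) ≤ (2 * B : ℝ) ^ I := by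
    intro s
    have e1 : ∀ t, x ^ #(pathEdges (s, t) ∩ E) = ∏ l, if pathEdge s t l ∈ E then x else 1 := by
      intro t
      rw [card_pathEdges_inter, prod_ite]; simp
    simp only [e1]
    rw [← (finFunctionFinEquiv (m := B) (n := I)).sum_comp]
    refine sum_prod_adapted_le hB (fun l t => if pathEdge s (finFunctionFinEquiv t) l ∈ E then x else 1)
      _ ?_ ?_ ?_ (by positivity)
    · intro l t; split_ifs <;> linarith
    · intro l t t' h
      have : pathEdge s (finFunctionFinEquiv t) l = pathEdge s (finFunctionFinEquiv t') l := by
        apply Subtype.ext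
        refine Prod.ext rfl (Prod.ext (pathNode_congr fun c hc => ?_) (pathNode_congr fun c hc => ?_))
        · simpa [digit] using h c (le_of_lt hc)
        · simpa [digit] using h c (Fin.le_def.2 (Nat.lt_succ_iff.1 hc))
      simp only [this]
    · intro l t
      have hinj : #{c : Fin B | pathEdge s (finFunctionFinEquiv (Function.update t l c)) l ∈ E} ≤ lam := by
        refine le_trans ?_ (hE l (pathNode s (finFunctionFinEquiv t) l))
        refine card_le_card_of_injOn
          (fun c => pathEdge s (finFunctionFinEquiv (Function.update t l c)) l) ?_ ?_
        · intro c hc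
          rw [mem_coe, mem_filter] at hc ⊢
          refine ⟨hc.2, rfl, ?_⟩
          rw [pathEdge_source]
          refine pathNode_congr fun c' hc' => ?_
          have : c' ≠ l := fun h => by simp [h] at hc'
          simp [digit, this]
        · intro c _ c' _ h
          have h1 := congrArg (fun e : Edge B I => digit e.1.2.2 l) h
          simp only [pathEdge_target, digit_pathNode] at h1
          simpa [digit] using h1
      calc ∑ c, (if pathEdge s (finFunctionFinEquiv (Function.update t l c)) l ∈ E then x else 1)
          ≤ ∑ c, (1 + if pathEdge s (finFunctionFinEquiv (Function.update t l c)) l ∈ E then x else 0) := by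
            refine sum_le_sum fun c _ => ?_
            split_ifs <;> linarith
        _ = B + #{c : Fin B | pathEdge s (finFunctionFinEquiv (Function.update t l c)) l ∈ E} * x := by
            rw [sum_add_distrib, ← sum_filter]; simp
        _ ≤ B + lam * x := by gcongr
        _ ≤ 2 * B := by linarith
  rw [Fintype.sum_prod_type]
  calc _ ≤ ∑ _s : Fin (B ^ I), (2 * B : ℝ) ^ I := sum_le_sum fun s _ => hs s
    _ = _ := by simp [mul_pow]; ring

/-- The edges on the paths of the queries `Q j`, `j ∈ 𝒢`. -/
def edgesOf {ι : Type*} (𝒢 : Finset ι) (Q : ι → Path B I) : Finset (Edge B I) :=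
  𝒢.biUnion fun j => pathEdges (Q j)

theorem card_edgesOf_le {ι : Type*} (𝒢 : Finset ι) (Q : ι → Path B I) :
    #(edgesOf 𝒢 Q) ≤ I * #𝒢 := by
  refine card_biUnion_le.trans ?_
  simp [card_pathEdges, mul_comm]

open Classical in
-- The exponent counts repeated edges. When the paths are drawn one after the other, a new path adds
-- as many repetitions as it has edges in common with the earlier ones, which
-- `sum_pow_card_inter_le` controls.
theorem sum_pow_covered_le {ι : Type*} [Fintype ι] [DecidableEq ι] (hB : 0 < B) (𝒢 : Finset ι) {lam : ℕ}
    {x : ℝ} (hx : 1 ≤ x) (hxl : x * lam ≤ B) :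
    ∑ Q : ι → Path B I, (if OutBound lam (edgesOf 𝒢 Q) then x ^ (I * #𝒢 - #(edgesOf 𝒢 Q)) else 0) ≤
      Fintype.card (ι → Path B I) * (2 ^ I) ^ #𝒢 := by
  induction 𝒢 using Finset.induction_on with
  | empty =>
    calc _ ≤ ∑ Q : ι → Path B I, (1 : ℝ) := sum_le_sum fun Q _ => by split_ifs <;> simp
      _ = _ := by simp
  | insert j 𝒢 hj ih =>
    have hP : (0 : ℝ) < Fintype.card (Path B I) := by
      have : 0 < B ^ I := by positivity
      simp only [Fintype.card_prod, Fintype.card_fin]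
      positivity
    have hx0 : 0 ≤ x := by linarith
    have hupd : ∀ (Q : ι → Path B I) (q : Path B I), edgesOf (insert j 𝒢) (Function.update Q j q) = pathEdges q ∪ edgesOf 𝒢 Q := by
      intro Q q
      simp only [edgesOf, biUnion_insert, Function.update_self]
      congr 1
      refine biUnion_congr rfl fun j' hj' => ?_
      have : j' ≠ j := fun h => hj (h ▸ hj')
      simp [this]
    have h1 := sum_sum_update j fun Q : ι → Path B I =>
      if OutBound lam (edgesOf (insert j 𝒢) Q) then
        x ^ (I * #(insert j 𝒢) - #(edgesOf (insert j 𝒢) Q)) else 0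
    have h2 : ∀ Q : ι → Path B I, ∑ q, (if OutBound lam (edgesOf (insert j 𝒢) (Function.update Q j q)) then
        x ^ (I * #(insert j 𝒢) - #(edgesOf (insert j 𝒢) (Function.update Q j q))) else 0) ≤
        (if OutBound lam (edgesOf 𝒢 Q) then x ^ (I * #𝒢 - #(edgesOf 𝒢 Q)) else 0) *
          (Fintype.card (Path B I) * 2 ^ I) := by
      intro Q
      simp only [hupd]
      -- More edges can only destroy `OutBound`, so the condition may be checked before the new path
      -- is added.
      by_cases hO : OutBound lam (edgesOf 𝒢 Q)
      · rw [if_pos hO]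
        refine le_trans ?_ (mul_le_mul_of_nonneg_left (sum_pow_card_inter_le hB hO hx hxl)
          (pow_nonneg hx0 _))
        rw [mul_sum]
        refine sum_le_sum fun q _ => ?_
        split_ifs
        · rw [← pow_add]
          apply le_of_eq
          congr 1
          have e1 := card_union_add_card_inter (pathEdges q) (edgesOf 𝒢 Q)
          have e2 := card_pathEdges q
          have e3 := card_edgesOf_le 𝒢 Q
          have e4 : #(pathEdges q ∩ edgesOf 𝒢 Q) ≤ I :=
            (card_le_card inter_subset_left).trans e2.le
          rw [card_insert_of_notMem hj, mul_add, mul_one]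
          omega
        · positivity
      · have : ∀ q, ¬ OutBound lam (pathEdges q ∪ edgesOf 𝒢 Q) :=
          fun q h => hO (h.mono subset_union_right)
        simp [this, hO]
    have h3 := sum_le_sum fun Q (_ : Q ∈ univ) => h2 Q
    rw [h1, ← sum_mul] at h3
    have e : ((2 : ℝ) ^ I) ^ #(insert j 𝒢) = (2 ^ I) ^ #𝒢 * 2 ^ I := by
      rw [card_insert_of_notMem hj, pow_succ]
    rw [e]
    refine le_of_mul_le_mul_left (h3.trans ?_) hP
    calc _ ≤ (Fintype.card (ι → Path B I) * (2 ^ I) ^ #𝒢) * (Fintype.card (Path B I) * 2 ^ I : ℝ) :=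
          mul_le_mul_of_nonneg_right ih (by positivity)
      _ = _ := by ring

theorem pathXor_add_single {b : ℕ} (X : Assignment B I b) (e : Edge B I) (y : Bits b) (q : Path B I) :
    pathXor (X + Pi.single e y) q.1 q.2 =
      pathXor X q.1 q.2 + if e ∈ pathEdges q then y else 0 := by
  simp only [pathXor, Pi.add_apply, sum_add_distrib]
  congr 1
  split_ifs with h
  · obtain ⟨l, -, rfl⟩ := mem_image.1 h
    rw [sum_eq_single l]
    · simp
    · intro l' _ hl'
      exact Pi.single_eq_of_ne (fun h => hl' (pathEdge_injective _ _ h)) _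
    · simp
  · refine sum_eq_zero fun l _ => Pi.single_eq_of_ne (fun h' => h ?_) _
    rw [← h']
    exact mem_image_of_mem _ (mem_univ _)

theorem sum_assignment_translate {b : ℕ} (e : Edge B I) (f : Assignment B I b → ℝ) :
    Fintype.card (Bits b) * ∑ X, f X = ∑ X, ∑ y : Bits b, f (X + (Pi.single e y : Assignment B I b)) := by
  rw [sum_comm]
  have : ∀ y : Bits b, ∑ X : Assignment B I b, f (X + (Pi.single e y : Assignment B I b)) = ∑ X, f X :=
    fun y => Equiv.sum_comp (Equiv.addRight (Pi.single e y : Assignment B I b)) f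
  simp [this]

/-- Averaging over the string of an edge that only the path of j uses makes the XOR of this path
uniform and leaves the other factors unchanged. -/
theorem sum_prod_eq_zero_of_uncovered {b : ℕ} {ι : Type*} (𝒢 : Finset ι) (Q : ι → Path B I)
    (κ : Bits b → ℝ) (hκ : ∑ y, κ y = 0) {j : ι} (hj : j ∈ 𝒢) {e : Edge B I}
    (he : e ∈ pathEdges (Q j)) (hne : ∀ j' ∈ 𝒢, j' ≠ j → e ∉ pathEdges (Q j')) :
    ∑ X : Assignment B I b, ∏ j ∈ 𝒢, κ (pathXor X (Q j).1 (Q j).2) = 0 := by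
  classical
  have h := sum_assignment_translate e fun X : Assignment B I b =>
    ∏ j ∈ 𝒢, κ (pathXor X (Q j).1 (Q j).2)
  have hc : (Fintype.card (Bits b) : ℝ) ≠ 0 := by
    exact_mod_cast Fintype.card_ne_zero
  refine (mul_eq_zero.1 (h.trans ?_)).resolve_left hc
  refine sum_eq_zero fun X _ => ?_
  have h1 : ∀ y : Bits b, ∏ j ∈ 𝒢, κ (pathXor (X + Pi.single e y) (Q j).1 (Q j).2) =
      κ (pathXor X (Q j).1 (Q j).2 + y) * ∏ j' ∈ 𝒢.erase j, κ (pathXor X (Q j').1 (Q j').2) := by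
    intro y
    rw [← mul_prod_erase _ _ hj, pathXor_add_single, if_pos he]
    congr 1
    refine prod_congr rfl fun j' hj' => ?_
    rw [pathXor_add_single, if_neg (hne j' (mem_of_mem_erase hj') (ne_of_mem_erase hj')), add_zero]
  simp only [h1, ← sum_mul]
  have h2 : ∑ y, κ (pathXor X (Q j).1 (Q j).2 + y) = ∑ y, κ y :=
    Equiv.sum_comp (Equiv.addLeft (pathXor X (Q j).1 (Q j).2)) κ
  rw [h2, hκ, zero_mul]

/-- Double counting: if the sum does not vanish, then each edge is on at least two of the paths, and
each path has I edges. -/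
theorem two_mul_card_edgesOf_le {b : ℕ} {ι : Type*} (𝒢 : Finset ι) (Q : ι → Path B I)
    (κ : Bits b → ℝ) (hκ : ∑ y, κ y = 0)
    (h : ∑ X : Assignment B I b, ∏ j ∈ 𝒢, κ (pathXor X (Q j).1 (Q j).2) ≠ 0) :
    2 * #(edgesOf 𝒢 Q) ≤ I * #𝒢 := by
  classical
  have h1 : ∀ e ∈ edgesOf 𝒢 Q, 2 ≤ #{j ∈ 𝒢 | e ∈ pathEdges (Q j)} := by
    intro e he
    obtain ⟨j, hj, hej⟩ := mem_biUnion.1 he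
    by_contra hlt
    refine h (sum_prod_eq_zero_of_uncovered 𝒢 Q κ hκ hj hej fun j' hj' hne hej' => hlt ?_)
    exact one_lt_card.2 ⟨j, by simp [hj, hej], j', by simp [hj', hej'], hne.symm⟩
  have h2 := sum_card_bipartiteAbove_eq_sum_card_bipartiteBelow
    (s := edgesOf 𝒢 Q) (t := 𝒢) (fun e j => e ∈ pathEdges (Q j))
  have h3 : ∑ e ∈ edgesOf 𝒢 Q, 2 ≤ ∑ e ∈ edgesOf 𝒢 Q,
      #(bipartiteAbove (fun e j => e ∈ pathEdges (Q j)) 𝒢 e) := sum_le_sum h1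
  rw [h2] at h3
  have h4 : ∑ j ∈ 𝒢, #(bipartiteBelow (fun e j => e ∈ pathEdges (Q j)) (edgesOf 𝒢 Q) j) ≤ ∑ j ∈ 𝒢, I := by
    refine sum_le_sum fun j _ => ?_
    refine (card_le_card fun e he => ?_).trans (card_pathEdges (Q j)).le
    exact (mem_filter.1 he).2
  have := h3.trans h4
  simp only [sum_const, smul_eq_mul] at this
  linarith [mul_comm #𝒢 I]

/-- Every node that is not a sink is on at most `μ` of the paths. -/
def Spread {k : ℕ} (μ : ℕ) (Q : Fin k → Path B I) : Prop :=
  ∀ (l : Fin I) (v : Fin (B ^ I)), #{j | pathNode (Q j).1 (Q j).2 l = v} ≤ μ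

/-- Every used edge leaving v belongs to a path that visits v, and each of the R tuples has at most
μ of these. -/
theorem outBound_of_spread {R k μ : ℕ} (G : Finset (Fin k)) (Q : Fin R → Fin k → Path B I)
    (h : ∀ n, Spread μ (Q n)) :
    OutBound (R * μ) (edgesOf (univ ×ˢ G) (fun x : Fin R × Fin k => Q x.1 x.2)) := by
  classical
  intro l v
  have h1 : #{x : Fin R × Fin k | pathNode (Q x.1 x.2).1 (Q x.1 x.2).2 l = v} ≤ R * μ := by
    have : ({x : Fin R × Fin k | pathNode (Q x.1 x.2).1 (Q x.1 x.2).2 l = v} : Finset _) =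
        univ.biUnion fun n =>
          (univ.filter fun j => pathNode (Q n j).1 (Q n j).2 l = v).image fun j => (n, j) := by
      ext ⟨n, j⟩
      simp
    rw [this]
    refine card_biUnion_le.trans ((sum_le_sum fun n _ => card_image_le.trans (h n l v)).trans ?_)
    simp
  refine le_trans ?_ h1
  refine le_trans (card_le_card ?_) (card_image_le (f := fun x : Fin R × Fin k =>
    pathEdge (Q x.1 x.2).1 (Q x.1 x.2).2 l))
  intro e he
  obtain ⟨he, hl, hv⟩ := mem_filter.1 he
  obtain ⟨x, -, hx⟩ := mem_biUnion.1 he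
  obtain ⟨l', -, rfl⟩ := mem_image.1 hx
  simp only [pathEdge_layer] at hl
  subst hl
  exact mem_image.2 ⟨x, by simpa using hv, rfl⟩

/-- The layer-l nodes of the paths from s to t and from t to s together contain all digits of s and
t. If the first node is prescribed, the second determines the query. -/
theorem card_pathNode_eq_le (l : ℕ) (v : Fin (B ^ I)) :
    #{q : Path B I | pathNode q.1 q.2 l = v} ≤ B ^ I := by
  have : #{q : Path B I | pathNode q.1 q.2 l = v} ≤ #(univ : Finset (Fin (B ^ I))) := by
    refine card_le_card_of_injOn (fun q => pathNode q.2 q.1 l) (fun _ _ => by simp) ?_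
    intro q hq q' hq' h
    rw [mem_coe, mem_filter] at hq hq'
    have h1 : pathNode q.1 q.2 l = pathNode q'.1 q'.2 l := hq.2.trans hq'.2.symm
    have hd : ∀ c, digit q.1 c = digit q'.1 c ∧ digit q.2 c = digit q'.2 c := by
      intro c
      have e1 := congrArg (fun x => digit x c) h1
      have e2 := congrArg (fun x => digit x c) h
      simp only [digit_pathNode] at e1 e2
      split_ifs at e1 e2 <;> exact ⟨by assumption, by assumption⟩
    refine Prod.ext ?_ ?_
    · exact finFunctionFinEquiv.symm.injective (funext fun c => (hd c).1)
    · exact finFunctionFinEquiv.symm.injective (funext fun c => (hd c).2)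
  simpa using this

/-- A Chernoff bound with base 2: a random path visits a given node of a given layer with
probability at most 1/B^I, so the expectation of 2 to the number of visits is at most exp(k/B^I). A
union bound over the I·B^I non-sink nodes follows. -/
theorem card_not_spread_le (hB : 0 < B) (k μ : ℕ) [DecidablePred (Spread μ : (Fin k → Path B I) → Prop)] :
    (#{Q : Fin k → Path B I | ¬ Spread μ Q} : ℝ) * 2 ^ μ ≤
      I * B ^ I * (Fintype.card (Fin k → Path B I) * Real.exp (k / B ^ I)) := by
  classical
  have hBI : (0 : ℝ) < (B : ℝ) ^ I := by positivity
  have h1 : ∀ (l : Fin I) (v : Fin (B ^ I)),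
      (#{Q : Fin k → Path B I | μ < #{j | pathNode (Q j).1 (Q j).2 l = v}} : ℝ) * 2 ^ μ ≤
        Fintype.card (Fin k → Path B I) * Real.exp (k / B ^ I) := by
    intro l v
    have e1 : ∀ Q : Fin k → Path B I, (2 : ℝ) ^ #{j | pathNode (Q j).1 (Q j).2 l = v} =
        ∏ j, if pathNode (Q j).1 (Q j).2 l = v then 2 else 1 := by
      intro Q; rw [prod_ite]; simp
    calc _ = ∑ Q : Fin k → Path B I with μ < #{j | pathNode (Q j).1 (Q j).2 l = v}, (2 : ℝ) ^ μ := by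
          simp
      _ ≤ ∑ Q : Fin k → Path B I with μ < #{j | pathNode (Q j).1 (Q j).2 l = v},
            (2 : ℝ) ^ #{j | pathNode (Q j).1 (Q j).2 l = v} := by
          refine sum_le_sum fun Q hQ => ?_
          exact pow_le_pow_right₀ (by norm_num) (mem_filter.1 hQ).2.le
      _ ≤ ∑ Q : Fin k → Path B I, (2 : ℝ) ^ #{j | pathNode (Q j).1 (Q j).2 l = v} :=
          sum_le_sum_of_subset_of_nonneg (filter_subset _ _) fun _ _ _ => by positivity
      _ = (∑ q : Path B I, if pathNode q.1 q.2 l = v then (2 : ℝ) else 1) ^ k := by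
          simp only [e1]
          rw [Fintype.sum_pow]
      _ ≤ ((B : ℝ) ^ I * B ^ I * (1 + 1 / B ^ I)) ^ k := by
          refine pow_le_pow_left₀ (sum_nonneg fun _ _ => by split_ifs <;> norm_num) ?_ k
          have e2 : ∀ q : Path B I, (if pathNode q.1 q.2 l = v then (2 : ℝ) else 1) =
              1 + if pathNode q.1 q.2 l = v then 1 else 0 := by
            intro q; split_ifs <;> norm_num
          simp only [e2, sum_add_distrib]
          have h3 : (#{q : Path B I | pathNode q.1 q.2 l = v} : ℝ) ≤ (B : ℝ) ^ I := by
            exact_mod_cast card_pathNode_eq_le l.val v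
          have h4 : ((B : ℝ) ^ I * B ^ I * (1 + 1 / B ^ I)) = B ^ I * B ^ I + B ^ I := by
            field_simp
          rw [h4, sum_boole]
          simpa using h3
      _ ≤ ((B : ℝ) ^ I * B ^ I * Real.exp (1 / B ^ I)) ^ k := by
          gcongr
          linarith [Real.add_one_le_exp (1 / (B : ℝ) ^ I)]
      _ = _ := by
          rw [mul_pow, ← Real.exp_nat_mul]
          simp [div_eq_mul_inv]
  have h2 : ({Q : Fin k → Path B I | ¬ Spread μ Q} : Finset _) ⊆
      (univ : Finset (Fin I × Fin (B ^ I))).biUnion fun x =>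
        {Q | μ < #{j | pathNode (Q j).1 (Q j).2 x.1 = x.2}} := by
    intro Q hQ
    simp only [Spread, not_forall, not_le, mem_filter, mem_univ, true_and] at hQ
    obtain ⟨l, v, h⟩ := hQ
    exact mem_biUnion.2 ⟨(l, v), mem_univ _, by simpa using h⟩
  have h3 : (#{Q : Fin k → Path B I | ¬ Spread μ Q} : ℝ) ≤ ∑ x : Fin I × Fin (B ^ I),
      (#{Q : Fin k → Path B I | μ < #{j | pathNode (Q j).1 (Q j).2 x.1 = x.2}} : ℝ) := by
    exact_mod_cast (card_le_card h2).trans card_biUnion_le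
  calc _ ≤ (∑ x : Fin I × Fin (B ^ I),
      (#{Q : Fin k → Path B I | μ < #{j | pathNode (Q j).1 (Q j).2 x.1 = x.2}} : ℝ)) * 2 ^ μ := by gcongr
    _ ≤ ∑ x : Fin I × Fin (B ^ I), (Fintype.card (Fin k → Path B I) * Real.exp (k / B ^ I) : ℝ) := by
        rw [sum_mul]
        exact sum_le_sum fun x _ => h1 x.1 x.2
    _ = _ := by simp

/-! ### Moments and correlation with the path XORs -/

open Classical in
-- Expanding the power gives 2r tuples of queries, and a term survives the average over X only if
-- the paths cover each used edge twice. Here ψ stands for the simulated answers at fixed cell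
-- contents: it may depend arbitrarily on the queries but not on X.
theorem moment_le {b r k μ : ℕ} (hB : 0 < B) (G : Finset (Fin k)) (κ : Bits b → ℝ)
    (hκ : ∑ y, κ y = 0) {c C x : ℝ} (hκc : ∀ y, |κ y| ≤ c) (ψ : (Fin k → Path B I) → ℝ)
    (hψ : ∀ Q, |ψ Q| ≤ C) (hsp : ∀ Q, ψ Q ≠ 0 → Spread μ Q) (hx : 1 ≤ x)
    (hxl : x * (2 * r * μ : ℕ) ≤ B) :
    (∑ X : Assignment B I b, (∑ Q, ψ Q * ∏ j ∈ G, κ (pathXor X (Q j).1 (Q j).2)) ^ (2 * r)) *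
        x ^ (I * (r * #G)) ≤
      Fintype.card (Assignment B I b) * (C * c ^ #G) ^ (2 * r) *
        (Fintype.card (Fin k → Path B I) ^ (2 * r) * 4 ^ (I * (r * #G))) := by
  have hc0 : 0 ≤ c := (abs_nonneg _).trans (hκc 0)
  have hx0 : 0 ≤ x := by linarith
  set 𝒢 : Finset (Fin (2 * r) × Fin k) := univ ×ˢ G with h𝒢
  have hcard : #𝒢 = 2 * r * #G := by simp [h𝒢]
  let unc : (Fin (2 * r) → Fin k → Path B I) → Fin (2 * r) × Fin k → Path B I := fun 𝒬 x => 𝒬 x.1 x.2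
  let Bad : (Fin (2 * r) → Fin k → Path B I) → Prop := fun 𝒬 =>
    OutBound (2 * r * μ) (edgesOf 𝒢 (unc 𝒬)) ∧ #(edgesOf 𝒢 (unc 𝒬)) ≤ I * (r * #G)
  have h1 : ∑ X : Assignment B I b, (∑ Q, ψ Q * ∏ j ∈ G, κ (pathXor X (Q j).1 (Q j).2)) ^ (2 * r) =
      ∑ 𝒬 : Fin (2 * r) → Fin k → Path B I, (∏ n, ψ (𝒬 n)) *
        ∑ X : Assignment B I b, ∏ y ∈ 𝒢, κ (pathXor X (unc 𝒬 y).1 (unc 𝒬 y).2) := by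
    simp only [Fintype.sum_pow, prod_mul_distrib]
    rw [sum_comm]
    refine sum_congr rfl fun 𝒬 _ => ?_
    rw [← mul_sum]
    congr 1
    refine sum_congr rfl fun X _ => ?_
    rw [h𝒢, prod_product]
  have h2 : ∀ 𝒬 : Fin (2 * r) → Fin k → Path B I, (∏ n, ψ (𝒬 n)) *
        ∑ X : Assignment B I b, ∏ y ∈ 𝒢, κ (pathXor X (unc 𝒬 y).1 (unc 𝒬 y).2) ≤
      if Bad 𝒬 then Fintype.card (Assignment B I b) * (C * c ^ #G) ^ (2 * r) else 0 := by
    intro 𝒬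
    split_ifs with hbad
    · refine (le_abs_self _).trans ?_
      rw [abs_mul, abs_prod]
      have e1 : ∏ n, |ψ (𝒬 n)| ≤ C ^ (2 * r) := by
        refine (prod_le_prod (fun _ _ => abs_nonneg _) fun n _ => hψ (𝒬 n)).trans ?_
        simp
      have e2 : |∑ X : Assignment B I b, ∏ y ∈ 𝒢, κ (pathXor X (unc 𝒬 y).1 (unc 𝒬 y).2)| ≤
          Fintype.card (Assignment B I b) * c ^ (2 * r * #G) := by
        refine (abs_sum_le_sum_abs _ _).trans ?_
        calc _ ≤ ∑ X : Assignment B I b, c ^ (2 * r * #G) := by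
              refine sum_le_sum fun X _ => ?_
              rw [abs_prod, ← hcard]
              refine (prod_le_prod (fun _ _ => abs_nonneg _) fun y _ => hκc _).trans ?_
              simp
          _ = _ := by rw [sum_const, card_univ, nsmul_eq_mul]
      calc _ ≤ C ^ (2 * r) * (Fintype.card (Assignment B I b) * c ^ (2 * r * #G)) :=
            mul_le_mul e1 e2 (abs_nonneg _) ((prod_nonneg fun _ _ => abs_nonneg _).trans e1)
        _ = _ := by rw [mul_pow, ← pow_mul]; ring
    · by_cases hz : ∏ n, ψ (𝒬 n) = 0
      · simp [hz]
      by_cases hs : ∑ X : Assignment B I b, ∏ y ∈ 𝒢, κ (pathXor X (unc 𝒬 y).1 (unc 𝒬 y).2) = 0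
      · rw [hs, mul_zero]
      · exfalso
        refine hbad ⟨?_, ?_⟩
        · exact outBound_of_spread G 𝒬 fun n => hsp _ fun h => hz (prod_eq_zero (mem_univ n) h)
        · have := two_mul_card_edgesOf_le 𝒢 (unc 𝒬) κ hκ hs
          rw [hcard] at this
          nlinarith
  -- A bad family repeats at least half of its 2·I·r·#G edge slots, so weighting each repetition by
  -- x bounds the number of bad families.
  have h3 : (#{𝒬 | Bad 𝒬} : ℝ) * x ^ (I * (r * #G)) ≤
      Fintype.card (Fin k → Path B I) ^ (2 * r) * 4 ^ (I * (r * #G)) := by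
    have h4 := sum_pow_covered_le (I := I) (ι := Fin (2 * r) × Fin k) hB 𝒢 hx hxl
    rw [← (Equiv.curry (Fin (2 * r)) (Fin k) (Path B I)).symm.sum_comp] at h4
    have e1 : (Fintype.card (Fin (2 * r) × Fin k → Path B I) : ℝ) * (2 ^ I) ^ #𝒢 =
        Fintype.card (Fin k → Path B I) ^ (2 * r) * 4 ^ (I * (r * #G)) := by
      rw [hcard, Fintype.card_congr (Equiv.curry (Fin (2 * r)) (Fin k) (Path B I)),
        Fintype.card_fun (α := Fin (2 * r)), Fintype.card_fin, ← pow_mul,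
        show (4 : ℝ) = 2 ^ 2 by norm_num, ← pow_mul]
      push_cast
      congr 2
      ring
    rw [e1] at h4
    refine le_trans ?_ h4
    calc _ = ∑ 𝒬 with Bad 𝒬, x ^ (I * (r * #G)) := by simp
      _ ≤ ∑ 𝒬 with Bad 𝒬, x ^ (I * #𝒢 - #(edgesOf 𝒢 (unc 𝒬))) := by
          refine sum_le_sum fun 𝒬 h𝒬 => pow_le_pow_right₀ hx ?_
          have := (mem_filter.1 h𝒬).2.2
          have e : I * #𝒢 = 2 * (I * (r * #G)) := by rw [hcard]; ring
          omega
      _ ≤ _ := by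
          rw [sum_filter]
          refine sum_le_sum fun 𝒬 _ => ?_
          have e : (Equiv.curry (Fin (2 * r)) (Fin k) (Path B I)).symm 𝒬 = unc 𝒬 := rfl
          rw [e]
          by_cases hb : Bad 𝒬
          · rw [if_pos hb, if_pos hb.1]
          · rw [if_neg hb]; split_ifs <;> positivity
  have hC0 : 0 ≤ (C * c ^ #G) ^ (2 * r) := (even_two_mul r).pow_nonneg _
  calc _ ≤ (∑ 𝒬, if Bad 𝒬 then Fintype.card (Assignment B I b) * (C * c ^ #G) ^ (2 * r) else 0) *
        x ^ (I * (r * #G)) := by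
        rw [h1]
        exact mul_le_mul_of_nonneg_right (sum_le_sum fun 𝒬 _ => h2 𝒬) (by positivity)
    _ = Fintype.card (Assignment B I b) * (C * c ^ #G) ^ (2 * r) *
        (#{𝒬 | Bad 𝒬} * x ^ (I * (r * #G))) := by
        rw [← sum_filter, sum_const, nsmul_eq_mul]; ring
    _ ≤ _ := mul_le_mul_of_nonneg_left h3 (by positivity)

theorem sum_pow_le_card_pow_mul {ι : Type*} (s : Finset ι) (f : ι → ℝ) (hf : ∀ i ∈ s, 0 ≤ f i)
    (n : ℕ) (hn : 1 ≤ n) : (∑ i ∈ s, f i) ^ n ≤ (#s : ℝ) ^ (n - 1) * ∑ i ∈ s, f i ^ n := by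
  obtain ⟨n, rfl⟩ := Nat.exists_eq_succ_of_ne_zero (show n ≠ 0 by omega)
  exact pow_sum_le_card_mul_sum_pow hf n

open Classical in
/-- The correlation of the simulated answers with the XORs of the queries in `G`. -/
theorem correlation_pow_le {w B I b r k μ p u : ℕ} (hB : 0 < B) (hr : 1 ≤ r) (G : Finset (Fin k))
    (κ : Bits b → ℝ) (hκ : ∑ y, κ y = 0) {c C x Nmax : ℝ} (hκc : ∀ y, |κ y| ≤ c)
    (g : Path B I → Memory w → Memory w → ℝ)
    (hC : ∀ q N M, ∑ R ∈ (diff N M).powerset, |g q N (R.piecewise M N)| ≤ C)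
    (hu : ∀ q N N', u < #(diff N N') → g q N N' = 0)
    (M₀ : Memory w) (N M : Assignment B I b → Memory w) (hN : ∀ X, #(diff M₀ (N X)) ≤ p)
    (hNmax : ∀ X, (#{R ∈ (diff (N X) (M X)).powerset | #R ≤ #G * u} : ℝ) ≤ Nmax)
    (hx : 1 ≤ x) (hxl : x * (2 * r * μ : ℕ) ≤ B) :
    (∑ X, ∑ Q : Fin k → Path B I, (if Spread μ Q then 1 else 0) * ∏ j ∈ G,
        ((∑ R ∈ (diff (N X) (M X)).powerset, g (Q j) (N X) (R.piecewise (M X) (N X))) *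
          κ (pathXor X (Q j).1 (Q j).2))) ^ (2 * r) * x ^ (I * (r * #G)) ≤
      (Fintype.card (Assignment B I b) * Nmax * (C * c) ^ #G *
        Fintype.card (Fin k → Path B I)) ^ (2 * r) * 4 ^ (w * (p + #G * u)) *
        4 ^ (I * (r * #G)) := by
  have hx0 : 0 ≤ x := by linarith
  choose ψ hψ1 hψ2 hψ3 using fun Q : Fin k → Path B I =>
    exists_prod_expansion G (fun j => g (Q j)) C u (fun j => hC (Q j)) (fun j => hu (Q j))
  have hψle : ∀ Q N N', |ψ Q N N'| ≤ C ^ #G := by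
    intro Q N N'
    refine le_trans ?_ (hψ2 Q N N')
    have := single_le_sum (f := fun R => |ψ Q N (R.piecewise N' N)|) (fun _ _ => abs_nonneg _)
      (mem_powerset_self (diff N N'))
    simpa [piecewise_diff] using this
  let Φ : Memory w → Memory w → Assignment B I b → ℝ := fun N N' X =>
    ∑ Q : Fin k → Path B I, ((if Spread μ Q then 1 else 0) * ψ Q N N') *
      ∏ j ∈ G, κ (pathXor X (Q j).1 (Q j).2)
  let 𝓡 : Assignment B I b → Finset (Finset (Fin (2 ^ w))) := fun X =>
    {R ∈ (diff (N X) (M X)).powerset | #R ≤ #G * u}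
  have hV : ∑ X, ∑ Q : Fin k → Path B I, (if Spread μ Q then 1 else 0) * ∏ j ∈ G,
        ((∑ R ∈ (diff (N X) (M X)).powerset, g (Q j) (N X) (R.piecewise (M X) (N X))) *
          κ (pathXor X (Q j).1 (Q j).2)) =
      ∑ X, ∑ R ∈ 𝓡 X, Φ (N X) (R.piecewise (M X) (N X)) X := by
    refine sum_congr rfl fun X _ => ?_
    simp only [Φ]
    rw [sum_comm]
    refine sum_congr rfl fun Q _ => ?_
    rw [prod_mul_distrib, hψ1, ← sum_mul, ← mul_sum, mul_assoc]
    congr 2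
    refine (sum_filter_of_ne fun R hR hne => ?_).symm
    by_contra hlt
    refine hne (hψ3 Q _ _ ?_)
    rw [diff_piecewise (mem_powerset.1 hR)]
    omega
  -- The actual contents N X and R depend on X, while `moment_le` needs fixed ones. W sums the
  -- moments over all pairs of memories in Hamming balls that contain the actual pair. This union
  -- bound costs a factor 4^{w(p + #G·u)}, of which only the 2r-th root matters in the end.
  let ball : Memory w → ℕ → Finset (Memory w) := fun M₀ p => {N | #(diff M₀ N) ≤ p}
  let W : Assignment B I b → ℝ := fun X =>
    ∑ N ∈ ball M₀ p, ∑ N' ∈ ball N (#G * u), Φ N N' X ^ (2 * r)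
  have hev : ∀ y : ℝ, 0 ≤ y ^ (2 * r) := fun y => (even_two_mul r).pow_nonneg y
  have hΦW : ∀ X, ∀ R ∈ 𝓡 X, |Φ (N X) (R.piecewise (M X) (N X)) X| ^ (2 * r) ≤ W X := by
    intro X R hR
    obtain ⟨hR1, hR2⟩ := mem_filter.1 hR
    rw [(even_two_mul r).pow_abs]
    have h1 : N X ∈ ball M₀ p := by simp [ball, hN X]
    have h2 : R.piecewise (M X) (N X) ∈ ball (N X) (#G * u) := by
      simp only [ball, mem_filter, mem_univ, true_and]
      rwa [diff_piecewise (mem_powerset.1 hR1)]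
    refine le_trans ?_ (single_le_sum (f := fun N => ∑ N' ∈ ball N (#G * u), Φ N N' X ^ (2 * r))
      (fun _ _ => sum_nonneg fun _ _ => hev _) h1)
    exact single_le_sum (f := fun N' => Φ (N X) N' X ^ (2 * r)) (fun _ _ => hev _) h2
  have hW0 : ∀ X, 0 ≤ W X := fun X => sum_nonneg fun _ _ => sum_nonneg fun _ _ => hev _
  have hNmax0 : 0 ≤ Nmax := (Nat.cast_nonneg _).trans (hNmax 0)
  have h2r : 1 ≤ 2 * r := by omega
  have hX : ∀ X, (∑ R ∈ 𝓡 X, |Φ (N X) (R.piecewise (M X) (N X)) X|) ^ (2 * r) ≤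
      Nmax ^ (2 * r) * W X := by
    intro X
    refine (sum_pow_le_card_pow_mul _ _ (fun _ _ => abs_nonneg _) _ h2r).trans ?_
    have h1 : ∑ R ∈ 𝓡 X, |Φ (N X) (R.piecewise (M X) (N X)) X| ^ (2 * r) ≤ #(𝓡 X) * W X := by
      rw [← nsmul_eq_mul]
      exact sum_le_card_nsmul _ _ _ (hΦW X)
    calc _ ≤ (#(𝓡 X) : ℝ) ^ (2 * r - 1) * (#(𝓡 X) * W X) :=
          mul_le_mul_of_nonneg_left h1 (pow_nonneg (Nat.cast_nonneg _) _)
      _ = (#(𝓡 X) : ℝ) ^ (2 * r) * W X := by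
          rw [← mul_assoc, ← pow_succ, Nat.sub_add_cancel h2r]
      _ ≤ _ := mul_le_mul_of_nonneg_right (pow_le_pow_left₀ (Nat.cast_nonneg _) (hNmax X) _) (hW0 X)
  have hV2 : (∑ X, ∑ R ∈ 𝓡 X, Φ (N X) (R.piecewise (M X) (N X)) X) ^ (2 * r) ≤
      (Fintype.card (Assignment B I b) : ℝ) ^ (2 * r - 1) * (Nmax ^ (2 * r) * ∑ X, W X) := by
    rw [← (even_two_mul r).pow_abs]
    calc _ ≤ (∑ X, ∑ R ∈ 𝓡 X, |Φ (N X) (R.piecewise (M X) (N X)) X|) ^ (2 * r) := by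
          refine pow_le_pow_left₀ (abs_nonneg _) ?_ _
          exact (abs_sum_le_sum_abs _ _).trans (sum_le_sum fun X _ => abs_sum_le_sum_abs _ _)
      _ ≤ (Fintype.card (Assignment B I b) : ℝ) ^ (2 * r - 1) *
          ∑ X, (∑ R ∈ 𝓡 X, |Φ (N X) (R.piecewise (M X) (N X)) X|) ^ (2 * r) := by
          rw [← card_univ]
          exact sum_pow_le_card_pow_mul _ _ (fun _ _ => sum_nonneg fun _ _ => abs_nonneg _) _ h2r
      _ ≤ _ := by
          rw [mul_sum univ _ (Nmax ^ (2 * r))]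
          exact mul_le_mul_of_nonneg_left (sum_le_sum fun X _ => hX X)
            (pow_nonneg (Nat.cast_nonneg _) _)
  have hmom : ∀ N N', (∑ X, Φ N N' X ^ (2 * r)) * x ^ (I * (r * #G)) ≤
      Fintype.card (Assignment B I b) * (C ^ #G * c ^ #G) ^ (2 * r) *
        (Fintype.card (Fin k → Path B I) ^ (2 * r) * 4 ^ (I * (r * #G))) := by
    intro N N'
    refine moment_le (μ := μ) hB G κ hκ hκc _ (fun Q => ?_) (fun Q hQ => ?_) hx hxl
    · split_ifs
      · rw [one_mul]; exact hψle Q N N'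
      · simpa using (abs_nonneg _).trans (hψle Q N N')
    · by_contra h; simp [h] at hQ
  have hball : ∀ M₀ p, (#(ball M₀ p) : ℝ) ≤ 4 ^ (w * p) := fun M₀ p => by
    exact_mod_cast card_hamming_ball_le M₀ p
  set K : ℝ := Fintype.card (Assignment B I b) * (C ^ #G * c ^ #G) ^ (2 * r) *
        (Fintype.card (Fin k → Path B I) ^ (2 * r) * 4 ^ (I * (r * #G))) with hK
  have hK0 : 0 ≤ K := mul_nonneg (mul_nonneg (Nat.cast_nonneg _) (hev _)) (by positivity)
  have hWsum : (∑ X, W X) * x ^ (I * (r * #G)) ≤ 4 ^ (w * (p + #G * u)) * K := by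
    have e : ∑ X, W X = ∑ N ∈ ball M₀ p, ∑ N' ∈ ball N (#G * u), ∑ X, Φ N N' X ^ (2 * r) := by
      simp only [W]
      rw [sum_comm]
      exact sum_congr rfl fun N _ => sum_comm
    rw [e, sum_mul]
    calc _ ≤ ∑ N ∈ ball M₀ p, (4 : ℝ) ^ (w * (#G * u)) * K := by
          refine sum_le_sum fun N _ => ?_
          rw [sum_mul]
          calc _ ≤ ∑ N' ∈ ball N (#G * u), K := sum_le_sum fun N' _ => hmom N N'
            _ = #(ball N (#G * u)) * K := by simp
            _ ≤ _ := mul_le_mul_of_nonneg_right (hball _ _) hK0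
      _ = #(ball M₀ p) * ((4 : ℝ) ^ (w * (#G * u)) * K) := by simp
      _ ≤ 4 ^ (w * p) * ((4 : ℝ) ^ (w * (#G * u)) * K) :=
          mul_le_mul_of_nonneg_right (hball _ _) (by positivity)
      _ = _ := by rw [mul_add, pow_add]; ring
  rw [hV]
  calc _ ≤ ((Fintype.card (Assignment B I b) : ℝ) ^ (2 * r - 1) * (Nmax ^ (2 * r) * ∑ X, W X)) *
        x ^ (I * (r * #G)) := mul_le_mul_of_nonneg_right hV2 (by positivity)
    _ = (Fintype.card (Assignment B I b) : ℝ) ^ (2 * r - 1) * Nmax ^ (2 * r) *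
        ((∑ X, W X) * x ^ (I * (r * #G))) := by ring
    _ ≤ (Fintype.card (Assignment B I b) : ℝ) ^ (2 * r - 1) * Nmax ^ (2 * r) *
        (4 ^ (w * (p + #G * u)) * K) := mul_le_mul_of_nonneg_left hWsum (by positivity)
    _ = _ := by
        rw [hK, ← mul_pow, mul_pow _ _ (2 * r), mul_pow _ _ (2 * r), mul_pow _ Nmax (2 * r)]
        rw [show (Fintype.card (Assignment B I b) : ℝ) ^ (2 * r) =
          (Fintype.card (Assignment B I b) : ℝ) ^ (2 * r - 1) * Fintype.card (Assignment B I b) by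
            rw [← pow_succ, Nat.sub_add_cancel h2r]]
        ring

/-- Each counted set R has weight y^(v − #R) ≥ 1, and the total of these weights over all subsets is
a binomial expansion. -/
theorem card_small_subsets_le {α : Type*} [DecidableEq α] (A : Finset α) (v : ℕ) {y : ℝ}
    (hy : 1 ≤ y) :
    (#{R ∈ A.powerset | #R ≤ v} : ℝ) ≤ y ^ v * Real.exp (#A / y) := by
  have hy0 : 0 < y := by linarith
  calc (#{R ∈ A.powerset | #R ≤ v} : ℝ) = ∑ R ∈ A.powerset with #R ≤ v, (1 : ℝ) := by simp
    _ ≤ ∑ R ∈ A.powerset with #R ≤ v, y ^ v * (1 / y) ^ #R := by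
        refine sum_le_sum fun R hR => ?_
        rw [one_div, inv_pow, ← div_eq_mul_inv, one_le_div (by positivity)]
        exact pow_le_pow_right₀ hy (mem_filter.1 hR).2
    _ ≤ ∑ R ∈ A.powerset, y ^ v * (1 / y) ^ #R :=
        sum_le_sum_of_subset_of_nonneg (filter_subset _ _) fun _ _ _ => by positivity
    _ = y ^ v * (1 / y + 1) ^ #A := by
        rw [← mul_sum]
        congr 1
        have := Finset.sum_pow_mul_eq_add_pow (1 / y) 1 A
        simpa using this
    _ ≤ y ^ v * (Real.exp (1 / y)) ^ #A := by
        gcongr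
        exact Real.add_one_le_exp _
    _ = _ := by
        rw [← Real.exp_nat_mul]
        congr 2
        ring

/-! ### Impossibility of good queries in a single Butterfly -/

/-- The indicator of a nonzero string, shifted at zero so that its sum over all strings
vanishes. -/
noncomputable def centered {b : ℕ} (y : Bits b) : ℝ := if y = 0 then 1 - 2 ^ b else 1

theorem sum_centered (b : ℕ) : ∑ y : Bits b, centered y = 0 := by
  have h : ∀ y : Bits b, centered y = 1 - if y = 0 then 2 ^ b else 0 := by
    intro y; unfold centered; split_ifs <;> simp
  simp [h, sum_sub_distrib, ZMod.card]

theorem abs_centered_le {b : ℕ} (y : Bits b) : |centered y| ≤ 2 ^ b := by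
  have h1 : (1 : ℝ) ≤ 2 ^ b := one_le_pow₀ (by norm_num)
  unfold centered
  split_ifs
  · rw [abs_le]; constructor <;> linarith
  · simpa using h1

theorem sum_sum_coordinate {α β : Type*} [Fintype α] [Nonempty α] [Fintype β] {k : ℕ}
    (f : β → α → ℝ) (j : Fin k) :
    (∑ X, ∑ Q : Fin k → α, f X (Q j)) * Fintype.card α =
      Fintype.card (Fin k → α) * ∑ X, ∑ q, f X q := by
  rw [mul_sum, sum_mul]
  refine sum_congr rfl fun X _ => ?_
  have h := sum_sum_update j fun Q : Fin k → α => f X (Q j)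
  simp only [Function.update_self, sum_const, card_univ, nsmul_eq_mul] at h
  rw [h, mul_comm]

open Classical in
/-- If queries are good with probability at least `3 / 4`, then at least half of `2 * h` independent
queries are good with probability at least `1 / 4`. -/
theorem card_half_good_ge {α β : Type*} [Fintype α] [Nonempty α] [Fintype β] {h : ℕ} (hh : 1 ≤ h)
    (good : β → α → Prop)
    (hgood : 3 * (Fintype.card β * Fintype.card α : ℝ) ≤ 4 * ∑ X, ∑ q, if good X q then 1 else 0) :
    (Fintype.card β * Fintype.card (Fin (2 * h) → α) : ℝ) / 4 ≤
      ∑ X, ∑ Q : Fin (2 * h) → α, if h ≤ #{j | good X (Q j)} then 1 else 0 := by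
  have hα : (0 : ℝ) < Fintype.card α := by exact_mod_cast Fintype.card_pos
  have hh' : (1 : ℝ) ≤ h := by exact_mod_cast hh
  have h1 : ∀ j : Fin (2 * h), 3 / 4 * (Fintype.card β * Fintype.card (Fin (2 * h) → α) : ℝ) ≤
      ∑ X, ∑ Q : Fin (2 * h) → α, if good X (Q j) then (1 : ℝ) else 0 := by
    intro j
    have e := sum_sum_coordinate (fun X q => if good X q then (1 : ℝ) else 0) j
    refine le_of_mul_le_mul_right ?_ hα
    rw [e]
    have hc : (0 : ℝ) ≤ Fintype.card (Fin (2 * h) → α) := Nat.cast_nonneg _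
    nlinarith [mul_le_mul_of_nonneg_left hgood hc]
  have h2 : ∑ X, ∑ Q : Fin (2 * h) → α, (#{j | good X (Q j)} : ℝ) =
      ∑ j : Fin (2 * h), ∑ X, ∑ Q : Fin (2 * h) → α, if good X (Q j) then (1 : ℝ) else 0 := by
    have : ∀ X, ∑ Q : Fin (2 * h) → α, (#{j | good X (Q j)} : ℝ) =
        ∑ j : Fin (2 * h), ∑ Q : Fin (2 * h) → α, if good X (Q j) then (1 : ℝ) else 0 := by
      intro X
      rw [sum_comm]
      simp
    simp only [this]
    exact sum_comm
  have h3 : 2 * h * (3 / 4 * (Fintype.card β * Fintype.card (Fin (2 * h) → α) : ℝ)) ≤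
      ∑ X, ∑ Q : Fin (2 * h) → α, (#{j | good X (Q j)} : ℝ) := by
    rw [h2]
    refine le_trans (le_of_eq ?_) (sum_le_sum fun j _ => h1 j)
    simp
  -- The mean number of good queries is at least 3h/2. Bounding this number by h, plus 2h in the
  -- event that it reaches h, leaves h/2 for the event, hence probability 1/4.
  have h4 : ∑ X, ∑ Q : Fin (2 * h) → α, (#{j | good X (Q j)} : ℝ) ≤
      ∑ X : β, ∑ Q : Fin (2 * h) → α,
        ((h : ℝ) + 2 * h * if h ≤ #{j | good X (Q j)} then (1 : ℝ) else 0) := by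
    refine sum_le_sum fun X _ => sum_le_sum fun Q _ => ?_
    split_ifs with hc
    · have : #{j | good X (Q j)} ≤ 2 * h := by
        simpa using card_le_univ (univ.filter fun j => good X (Q j))
      have : (#{j | good X (Q j)} : ℝ) ≤ 2 * h := by exact_mod_cast this
      linarith
    · have : (#{j | good X (Q j)} : ℝ) ≤ h := by exact_mod_cast (not_le.1 hc).le
      linarith
  have h5 : ∑ X : β, ∑ Q : Fin (2 * h) → α, ((h : ℝ) + 2 * h * if h ≤ #{j | good X (Q j)} then (1 : ℝ) else 0) =
      h * (Fintype.card β * Fintype.card (Fin (2 * h) → α)) +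
        2 * h * ∑ X, ∑ Q : Fin (2 * h) → α, if h ≤ #{j | good X (Q j)} then 1 else 0 := by
    simp only [sum_add_distrib, ← mul_sum]
    simp only [sum_const, card_univ, nsmul_eq_mul]
    ring
  have h6 := h3.trans (h4.trans h5.le)
  have h7 : (h : ℝ) * ((Fintype.card β * Fintype.card (Fin (2 * h) → α) : ℝ) / 4) ≤
      h * ∑ X, ∑ Q : Fin (2 * h) → α, if h ≤ #{j | good X (Q j)} then 1 else 0 := by
    nlinarith
  exact le_of_mul_le_mul_left h7 (by linarith)

/-- The parameters for which a query algorithm cannot be simulated. -/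
structure Parameters (A B I b w p a t m D s : ℕ) : Prop where
  degree : B = A ^ 12
  two_le : 2 ≤ A
  depth : 1 ≤ I
  prefixCells : w * p ≤ A ^ 2 * (A ^ 2 * B ^ I)
  probedCells : w * (m + D) ≤ A ^ 2
  epochCells : a ≤ B * (A ^ 2 * B ^ I)
  time : 2 * t + 1 ≤ B
  error : (1 / 2 : ℝ) ^ s * (t + 1) ^ m * 2 ^ b ≤ 1 / 100
  spread : 8 * I * (B : ℝ) ^ I * Real.exp (16 * A ^ 2) ≤ 2 ^ (A ^ 4)
  advantage : (2 ^ 20 * 2 ^ b * (B : ℝ) ^ (2 * (m + D))) ^ 2 * 8 ^ I ≤ (A : ℝ) ^ (6 * I)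

section

variable {A B I b w p a t m D s : ℕ} (h : Parameters A B I b w p a t m D s)
include h

set_option maxHeartbeats 1000000 in
open Classical in
-- `correlation_pow_le` with r = A² and μ = A⁴. Per query of G, the choice of R costs 3·B^u, the
-- coefficients cost B^u, the factor `centered` costs 2^b, and the union over cell contents costs 4
-- after the 2r-th root is taken; the gain is (x/4)^{I/2}. The field `advantage` says that the gain
-- wins with 2^16 to spare.
theorem Parameters.abs_correlation_le {α : ℕ → ℝ} (hα2 : ∀ r, |α r| ≤ 2 ^ r)
    (hαD : ∀ r, D < r → α r = 0) {k : ℕ} (G : Finset (Fin k)) (hG : A ^ 2 * B ^ I ≤ #G)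
    (τ : Path B I → ProbeTree w) (M₀ : Memory w)
    (N M : Assignment B I b → Memory w) (hN : ∀ X, #(diff M₀ (N X)) ≤ p)
    (hM : ∀ X, #(diff (N X) (M X)) ≤ a) :
    |∑ X, ∑ Q : Fin k → Path B I, (if Spread (A ^ 4) Q then 1 else 0) * ∏ j ∈ G,
        ((∑ R ∈ (diff (N X) (M X)).powerset, (τ (Q j)).guess t m α (N X) (R.piecewise (M X) (N X))) *
          centered (pathXor X (Q j).1 (Q j).2))| ≤
      Fintype.card (Assignment B I b) * Fintype.card (Fin k → Path B I) *
        (1 / 2) ^ (16 * #G) := by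
  have hA2 : (2 : ℝ) ≤ A := by exact_mod_cast h.two_le
  have hA0 : (0 : ℝ) < A := by linarith
  have hBr : (B : ℝ) = (A : ℝ) ^ 12 := by rw [h.degree]; push_cast; rfl
  have hB1 : (1 : ℝ) ≤ B := by rw [hBr]; exact one_le_pow₀ (by linarith)
  have hB0 : 0 < B := by exact_mod_cast (by linarith : (0 : ℝ) < B)
  set g := #G with hg
  set u := m + D with hu
  set x : ℝ := A ^ 6 / 2 with hx
  have hx1 : 1 ≤ x := by
    rw [hx, le_div_iff₀ (by norm_num)]
    calc (1 : ℝ) * 2 ≤ 2 ^ 6 := by norm_num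
      _ ≤ A ^ 6 := by gcongr
  have hx0 : 0 < x := by linarith
  set 𝒱 : ℝ := ∑ X, ∑ Q : Fin k → Path B I, (if Spread (A ^ 4) Q then 1 else 0) * ∏ j ∈ G,
        ((∑ R ∈ (diff (N X) (M X)).powerset, (τ (Q j)).guess t m α (N X) (R.piecewise (M X) (N X))) *
          centered (pathXor X (Q j).1 (Q j).2)) with h𝒱
  have hNmax : ∀ X, (#{R ∈ (diff (N X) (M X)).powerset | #R ≤ g * u} : ℝ) ≤ (3 * (B : ℝ) ^ u) ^ g := by
    intro X
    refine (card_small_subsets_le _ _ hB1).trans ?_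
    have h1 : (#(diff (N X) (M X)) : ℝ) / B ≤ g := by
      rw [div_le_iff₀ (by linarith)]
      have : #(diff (N X) (M X)) ≤ g * B := by
        calc _ ≤ B * (A ^ 2 * B ^ I) := (hM X).trans h.epochCells
          _ ≤ B * g := by gcongr
          _ = g * B := mul_comm _ _
      exact_mod_cast this
    have h2 : Real.exp ((#(diff (N X) (M X)) : ℝ) / B) ≤ 3 ^ g := by
      calc _ ≤ Real.exp g := Real.exp_le_exp.2 h1
        _ = Real.exp 1 ^ g := by rw [← Real.exp_nat_mul, mul_one]
        _ ≤ 3 ^ g := by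
            gcongr
            exact (Real.exp_one_lt_d9.trans (by norm_num)).le
    calc _ ≤ (B : ℝ) ^ (g * u) * 3 ^ g := by gcongr
      _ = _ := by rw [mul_pow, ← pow_mul, mul_comm u g]; ring
  have hC : ∀ (q : Path B I) (N M : Memory w),
      ∑ R ∈ (diff N M).powerset, |(τ q).guess t m α N (R.piecewise M N)| ≤ (B : ℝ) ^ u := by
    intro q N M
    refine ((τ q).sum_abs_guess_le t m D α N M hα2 hαD).trans ?_
    have h1 : (2 * t + 1 : ℝ) ≤ B := by exact_mod_cast h.time
    have h2 : (t + 1 : ℝ) ≤ B := by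
      have : (0 : ℝ) ≤ t := Nat.cast_nonneg _
      linarith
    rw [hu, pow_add]
    gcongr
  have hxl : x * ((2 * A ^ 2 * A ^ 4 : ℕ) : ℝ) ≤ B := by
    rw [hx, hBr]; push_cast; apply le_of_eq; ring
  have key := correlation_pow_le (r := A ^ 2) (u := u) hB0 (Nat.one_le_pow _ _ (by have := h.two_le; omega)) G
    centered (sum_centered b) abs_centered_le (fun q => (τ q).guess t m α) hC
    (fun q N N' hlt => (τ q).guess_eq_zero t m D α N N' hαD hlt) M₀ N M hN hNmax hx1 hxl
  rw [← h𝒱] at key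
  set r := A ^ 2 with hr
  have hr1 : 1 ≤ r := Nat.one_le_pow _ _ (by have := h.two_le; omega)
  set S : ℝ := Fintype.card (Assignment B I b) * Fintype.card (Fin k → Path B I) with hS
  have hS0 : 0 ≤ S := by positivity
  have hw : w * (p + g * u) ≤ g * (2 * r) := by
    have h1 : w * p ≤ r * g := h.prefixCells.trans (Nat.mul_le_mul_left _ hG)
    have h2 : w * (g * u) ≤ g * r := by
      calc w * (g * u) = g * (w * u) := by ring
        _ ≤ g * r := Nat.mul_le_mul_left _ h.probedCells
    calc w * (p + g * u) = w * p + w * (g * u) := by ring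
      _ ≤ r * g + g * r := add_le_add h1 h2
      _ = g * (2 * r) := by ring
  have key2 : 𝒱 ^ (2 * r) * x ^ (I * (r * g)) ≤
      (S * (12 * 2 ^ b * (B : ℝ) ^ (2 * u)) ^ g) ^ (2 * r) * 4 ^ (I * (r * g)) := by
    refine key.trans ?_
    calc _ ≤ (Fintype.card (Assignment B I b) * (3 * (B : ℝ) ^ u) ^ g * ((B : ℝ) ^ u * 2 ^ b) ^ g *
        Fintype.card (Fin k → Path B I)) ^ (2 * r) * 4 ^ (g * (2 * r)) * 4 ^ (I * (r * g)) := by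
          gcongr
          norm_num
      _ = _ := by
          rw [pow_mul 4 g (2 * r), ← mul_pow]
          congr 2
          have e : 12 * 2 ^ b * (B : ℝ) ^ (2 * u) = (3 * (B : ℝ) ^ u) * ((B : ℝ) ^ u * 2 ^ b) * 4 := by
            rw [two_mul, pow_add]; ring
          rw [e, mul_pow _ (4 : ℝ), mul_pow _ ((B : ℝ) ^ u * 2 ^ b), hS]
          ring
  have key3 : 𝒱 ^ 2 * x ^ (I * g) ≤ (S * (12 * 2 ^ b * (B : ℝ) ^ (2 * u)) ^ g) ^ 2 * 4 ^ (I * g) := by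
    have e1 : 𝒱 ^ (2 * r) * x ^ (I * (r * g)) = (𝒱 ^ 2 * x ^ (I * g)) ^ r := by
      rw [mul_pow, ← pow_mul, ← pow_mul]; congr 2; ring
    have e2 : (S * (12 * 2 ^ b * (B : ℝ) ^ (2 * u)) ^ g) ^ (2 * r) * 4 ^ (I * (r * g)) =
        ((S * (12 * 2 ^ b * (B : ℝ) ^ (2 * u)) ^ g) ^ 2 * 4 ^ (I * g)) ^ r := by
      rw [mul_pow _ _ r, ← pow_mul, ← pow_mul]; congr 2; ring
    rw [e1, e2] at key2
    exact le_of_pow_le_pow_left₀ (by omega) (by positivity) key2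
  have hadv : ((2 : ℝ) ^ 16 * (12 * 2 ^ b * (B : ℝ) ^ (2 * u))) ^ 2 * 4 ^ I ≤ x ^ I := by
    have h1 := h.advantage
    have e : x ^ I * 2 ^ I = (A : ℝ) ^ (6 * I) := by
      rw [← mul_pow, hx, pow_mul]; congr 1; ring
    have h2 : (0 : ℝ) < 2 ^ I := by positivity
    refine le_of_mul_le_mul_right ?_ h2
    rw [e]
    refine le_trans ?_ h1
    rw [mul_assoc, ← mul_pow]
    norm_num only
    gcongr ?_ ^ 2 * _
    have : (0 : ℝ) ≤ 2 ^ b * (B : ℝ) ^ (2 * u) := by positivity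
    nlinarith
  have key4 : 𝒱 ^ 2 * ((2 : ℝ) ^ (16 * g)) ^ 2 ≤ S ^ 2 := by
    have h1 := pow_le_pow_left₀ (by positivity) hadv g
    have hxg : 0 < x ^ (I * g) := by positivity
    refine le_of_mul_le_mul_right ?_ hxg
    calc 𝒱 ^ 2 * ((2 : ℝ) ^ (16 * g)) ^ 2 * x ^ (I * g)
        = ((2 : ℝ) ^ (16 * g)) ^ 2 * (𝒱 ^ 2 * x ^ (I * g)) := by ring
      _ ≤ ((2 : ℝ) ^ (16 * g)) ^ 2 *
          ((S * (12 * 2 ^ b * (B : ℝ) ^ (2 * u)) ^ g) ^ 2 * 4 ^ (I * g)) := by gcongr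
      _ = S ^ 2 * (((2 : ℝ) ^ 16 * (12 * 2 ^ b * (B : ℝ) ^ (2 * u))) ^ 2 * 4 ^ I) ^ g := by
          rw [pow_mul 4 I g, pow_mul (2 : ℝ) 16 g]
          generalize (2 : ℝ) ^ 16 = y, (4 : ℝ) ^ I = f, 12 * 2 ^ b * (B : ℝ) ^ (2 * u) = z
          ring
      _ ≤ S ^ 2 * (x ^ I) ^ g := by gcongr
      _ = _ := by rw [← pow_mul]
  have key5 : |𝒱| * 2 ^ (16 * g) ≤ S := by
    apply abs_le_of_sq_le_sq' ?_ hS0 |>.2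
    rw [mul_pow, sq_abs]; exact key4
  rw [one_div, inv_pow, ← div_eq_mul_inv, le_div_iff₀ (by positivity)]
  exact key5

open Classical in
/-- No query algorithm answers `0` correctly and with few probes for three quarters of the inputs
and queries of one Butterfly. -/
theorem Parameters.not_good (hs : 1 ≤ s) (hD : 3 * √(t * s) + 2 * s < D + 1)
    (τ : Path B I → ProbeTree w) (M₀ : Memory w)
    (N M : Assignment B I b → Memory w) (hN : ∀ X, #(diff M₀ (N X)) ≤ p)
    (hM : ∀ X, #(diff (N X) (M X)) ≤ a)
    (hcorrect : ∀ X q, (τ q).output (M X) = false → pathXor X q.1 q.2 ≠ 0) :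
    4 * ∑ X, ∑ q, (if (τ q).good t m (N X) (M X) then (1 : ℝ) else 0) <
      3 * (Fintype.card (Assignment B I b) * Fintype.card (Path B I)) := by
  by_contra hcon
  rw [not_lt] at hcon
  obtain ⟨D', α, hD', hα2, hαD', hα0, hα⟩ := exists_nor_newton t s hs
  have hαD : ∀ r, D < r → α r = 0 := by
    intro r hr
    refine hαD' r (lt_of_le_of_lt ?_ hr)
    have : (D' : ℝ) < D + 1 := hD'.trans_lt hD
    have : D' < D + 1 := by exact_mod_cast this
    omega
  have hA2 : (2 : ℝ) ≤ A := by exact_mod_cast h.two_le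
  have hA0 : (0 : ℝ) < A := by linarith
  have hBr : (B : ℝ) = (A : ℝ) ^ 12 := by rw [h.degree]; push_cast; rfl
  have hB1 : (1 : ℝ) ≤ B := by rw [hBr]; exact one_le_pow₀ (by linarith)
  have hB0 : 0 < B := by exact_mod_cast (by linarith : (0 : ℝ) < B)
  -- The size of G from which on the correlation bound applies. The argument uses 16·k0 random
  -- queries, of which 8·k0 are good with probability at least 1/4.
  set k0 := A ^ 2 * B ^ I with hk0
  have hk2 : 2 ≤ k0 := by
    have h1 : 1 ≤ B ^ I := Nat.one_le_pow _ _ hB0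
    have h2 : 2 ^ 2 ≤ A ^ 2 := Nat.pow_le_pow_left h.two_le 2
    nlinarith
  have : Nonempty (Path B I) := ⟨(⟨0, by positivity⟩, ⟨0, by positivity⟩)⟩
  set S : ℝ := Fintype.card (Assignment B I b) * Fintype.card (Fin (2 * (8 * k0)) → Path B I) with hS
  have hS0 : 0 < S := by
    rw [hS]
    have h1 : (0 : ℝ) < Fintype.card (Assignment B I b) := by exact_mod_cast Fintype.card_pos
    have h2 : (0 : ℝ) < Fintype.card (Fin (2 * (8 * k0)) → Path B I) := by exact_mod_cast Fintype.card_pos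
    positivity
  let good : Assignment B I b → Path B I → Prop := fun X q => (τ q).good t m (N X) (M X)
  let Y : Assignment B I b → Path B I → ℝ := fun X q =>
    (∑ R ∈ (diff (N X) (M X)).powerset, (τ q).guess t m α (N X) (R.piecewise (M X) (N X))) *
      centered (pathXor X q.1 q.2)
  have h2b : (1 : ℝ) ≤ 2 ^ b := one_le_pow₀ (by norm_num)
  have hε0 : 0 ≤ (1 / 2 : ℝ) ^ s * (t + 1) ^ m := by positivity
  have hε1 : (1 / 2 : ℝ) ^ s * (t + 1) ^ m ≤ 1 / 100 := by
    have := h.error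
    nlinarith
  have hYgood : ∀ X q, good X q → 99 / 100 ≤ Y X q ∧ Y X q ≤ 101 / 100 := by
    intro X q hg
    have h1 := (τ q).abs_sum_guess_sub_good_le t m α (N X) (M X) hα0 hα (by positivity)
    have hc : centered (pathXor X q.1 q.2) = 1 := by
      unfold centered
      rw [if_neg (hcorrect X q hg.1)]
    have hg' : (τ q).good t m (N X) (M X) := hg
    simp only [Y, hc, mul_one]
    rw [if_pos hg'] at h1
    have := abs_le.1 (h1.trans hε1)
    constructor <;> linarith [this.1, this.2]
  have hYbad : ∀ X q, ¬ good X q → |Y X q| ≤ 1 / 100 := by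
    intro X q hg
    have h1 := (τ q).abs_sum_guess_sub_good_le t m α (N X) (M X) hα0 hα (by positivity)
    have hg' : ¬ (τ q).good t m (N X) (M X) := hg
    rw [if_neg hg', sub_zero] at h1
    simp only [Y, abs_mul]
    refine le_trans ?_ h.error
    exact mul_le_mul h1 (abs_centered_le _) (abs_nonneg _) hε0
  have hYabs : ∀ X q, |Y X q| ≤ 101 / 100 := by
    intro X q
    by_cases hg : good X q
    · have := hYgood X q hg
      rw [abs_le]; constructor <;> linarith [this.1, this.2]
    · exact (hYbad X q hg).trans (by norm_num)
  let sp : (Fin (2 * (8 * k0)) → Path B I) → ℝ := fun Q => if Spread (A ^ 4) Q then 1 else 0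
  have hsp0 : ∀ Q, 0 ≤ sp Q := fun Q => by simp only [sp]; split_ifs <;> norm_num
  have hsp1 : ∀ Q, sp Q ≤ 1 := fun Q => by simp only [sp]; split_ifs <;> norm_num
  have hsum : ∀ c : ℝ, ∑ _X : Assignment B I b, ∑ _Q : Fin (2 * (8 * k0)) → Path B I, c = S * c := by
    intro c
    simp only [sum_const, card_univ, nsmul_eq_mul, hS]; ring
  have hnotspread : ∑ Q : Fin (2 * (8 * k0)) → Path B I, (1 - sp Q) ≤
      Fintype.card (Fin (2 * (8 * k0)) → Path B I) / 8 := by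
    have h1 := card_not_spread_le (I := I) hB0 (2 * (8 * k0)) (A ^ 4)
    have h2 : (((2 * (8 * k0) : ℕ) : ℝ) / (B : ℝ) ^ I) = 16 * A ^ 2 := by
      rw [hk0]; push_cast
      field_simp
      ring
    rw [h2] at h1
    have h3 := h.spread
    have e : ∑ Q : Fin (2 * (8 * k0)) → Path B I, (1 - sp Q) =
        (#{Q : Fin (2 * (8 * k0)) → Path B I | ¬ Spread (A ^ 4) Q} : ℝ) := by
      rw [← sum_boole]
      refine sum_congr rfl fun Q _ => ?_
      simp only [sp]
      split_ifs <;> simp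
    rw [e]
    have h4 : (0 : ℝ) < 2 ^ (A ^ 4) := by positivity
    refine le_of_mul_le_mul_right (h1.trans ?_) h4
    have h5 : (0 : ℝ) ≤ Fintype.card (Fin (2 * (8 * k0)) → Path B I) := Nat.cast_nonneg _
    nlinarith [mul_le_mul_of_nonneg_left h3 h5]
  -- Dropping tuples that are not spread reduces the probability 1/4 to 1/8. On the rest, 8·k0
  -- factors are at least 2·0.99 and all others at least 0.99, and 0.99^16·2^8 > 200.
  have hlower : S / 8 * 200 ^ k0 ≤ ∑ X, ∑ Q, sp Q * ∏ j, (1 + Y X (Q j)) := by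
    have h1 := card_half_good_ge (h := 8 * k0) (by omega) good hcon
    have h2 : S / 8 ≤ ∑ X, ∑ Q : Fin (2 * (8 * k0)) → Path B I,
        sp Q * (if 8 * k0 ≤ #{j | good X (Q j)} then 1 else 0) := by
      have h3 : ∑ X, ∑ Q : Fin (2 * (8 * k0)) → Path B I,
          ((if 8 * k0 ≤ #{j | good X (Q j)} then (1 : ℝ) else 0) - (1 - sp Q)) ≤
          ∑ X, ∑ Q : Fin (2 * (8 * k0)) → Path B I,
            sp Q * (if 8 * k0 ≤ #{j | good X (Q j)} then 1 else 0) := by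
        refine sum_le_sum fun X _ => sum_le_sum fun Q _ => ?_
        split_ifs
        · linarith
        · linarith [hsp1 Q]
      refine le_trans ?_ h3
      simp only [sum_sub_distrib]
      have h4 : ∑ _X : Assignment B I b, ∑ Q : Fin (2 * (8 * k0)) → Path B I, (1 - sp Q) ≤ S / 8 := by
        rw [sum_const, card_univ, nsmul_eq_mul, hS]
        have := mul_le_mul_of_nonneg_left hnotspread
          (Nat.cast_nonneg (α := ℝ) (Fintype.card (Assignment B I b)))
        linarith
      simp only [sum_sub_distrib] at h4
      linarith
    refine (mul_le_mul_of_nonneg_right h2 (by positivity)).trans ?_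
    rw [sum_mul]
    refine sum_le_sum fun X _ => ?_
    rw [sum_mul]
    refine sum_le_sum fun Q _ => ?_
    rw [mul_assoc]
    refine mul_le_mul_of_nonneg_left ?_ (hsp0 Q)
    have hfac : ∀ j, (99 / 100 : ℝ) * (if good X (Q j) then 2 else 1) ≤ 1 + Y X (Q j) := by
      intro j
      split_ifs with hg
      · linarith [(hYgood X (Q j) hg).1]
      · linarith [(abs_le.1 (hYbad X (Q j) hg)).1]
    have hprod : ∏ j : Fin (2 * (8 * k0)), ((99 / 100 : ℝ) * (if good X (Q j) then 2 else 1)) ≤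
        ∏ j, (1 + Y X (Q j)) :=
      prod_le_prod (fun j _ => by split_ifs <;> norm_num) fun j _ => hfac j
    split_ifs with hg
    · refine le_trans ?_ hprod
      rw [prod_mul_distrib, prod_ite]
      simp only [prod_const, card_univ, Fintype.card_fin, one_pow, mul_one, one_mul]
      calc (200 : ℝ) ^ k0 ≤ ((99 / 100 : ℝ) ^ 16 * 2 ^ 8) ^ k0 := by
            gcongr; norm_num
        _ = (99 / 100 : ℝ) ^ (2 * (8 * k0)) * 2 ^ (8 * k0) := by
            rw [mul_pow, ← pow_mul, ← pow_mul]; congr 2; ring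
        _ ≤ _ := by
            gcongr ?_ * ?_
            exact pow_le_pow_right₀ (by norm_num : (1 : ℝ) ≤ 2) hg
    · rw [zero_mul]
      exact (prod_nonneg fun j _ => by split_ifs <;> norm_num).trans hprod
  have hexpand : ∑ X, ∑ Q, sp Q * ∏ j, (1 + Y X (Q j)) =
      ∑ G : Finset (Fin (2 * (8 * k0))), ∑ X, ∑ Q, sp Q * ∏ j ∈ G, Y X (Q j) := by
    simp only [prod_one_add, powerset_univ, mul_sum]
    have e : ∀ X, ∑ Q, ∑ G : Finset (Fin (2 * (8 * k0))), sp Q * ∏ j ∈ G, Y X (Q j) =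
        ∑ G : Finset (Fin (2 * (8 * k0))), ∑ Q, sp Q * ∏ j ∈ G, Y X (Q j) := fun X => sum_comm
    simp only [e]
    exact sum_comm
  -- Large G are covered by the correlation bound: there are at most 2^(16·k0) of them, each with
  -- 2^(−16·k0). For small G the trivial bound 1.01^#G is written as 10^#G·0.101^#G ≤
  -- 10^k0·0.101^#G, which can be summed over all G and gives (10·1.101^16)^k0 ≤ 47^k0.
  have hterm : ∀ G : Finset (Fin (2 * (8 * k0))), ∑ X, ∑ Q, sp Q * ∏ j ∈ G, Y X (Q j) ≤
      S * (10 ^ k0 * ((101 / 1000) ^ #G * 1 ^ (2 * (8 * k0) - #G)) + (1 / 2) ^ (16 * k0)) := by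
    intro G
    by_cases hG : k0 ≤ #G
    · refine (le_abs_self _).trans ((h.abs_correlation_le hα2 hαD G hG τ M₀ N M hN hM).trans ?_)
      refine mul_le_mul_of_nonneg_left ?_ hS0.le
      have : (1 / 2 : ℝ) ^ (16 * #G) ≤ (1 / 2) ^ (16 * k0) :=
        pow_le_pow_of_le_one (by norm_num) (by norm_num) (by omega)
      have h0 : (0 : ℝ) ≤ 10 ^ k0 * ((101 / 1000) ^ #G * 1 ^ (2 * (8 * k0) - #G)) := by positivity
      linarith
    · have h1 : ∑ X, ∑ Q, sp Q * ∏ j ∈ G, Y X (Q j) ≤ S * (101 / 100) ^ #G := by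
        rw [← hsum]
        refine sum_le_sum fun X _ => sum_le_sum fun Q _ => ?_
        have h2 : |∏ j ∈ G, Y X (Q j)| ≤ (101 / 100) ^ #G := by
          rw [abs_prod, ← prod_const]
          exact prod_le_prod (fun _ _ => abs_nonneg _) fun j _ => hYabs X (Q j)
        calc sp Q * ∏ j ∈ G, Y X (Q j) ≤ sp Q * (101 / 100) ^ #G :=
              mul_le_mul_of_nonneg_left ((le_abs_self _).trans h2) (hsp0 Q)
          _ ≤ 1 * (101 / 100) ^ #G := mul_le_mul_of_nonneg_right (hsp1 Q) (by positivity)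
          _ = _ := one_mul _
      refine h1.trans (mul_le_mul_of_nonneg_left ?_ hS0.le)
      have h3 : (101 / 100 : ℝ) ^ #G ≤ 10 ^ k0 * ((101 / 1000) ^ #G * 1 ^ (2 * (8 * k0) - #G)) := by
        have e : (101 / 100 : ℝ) ^ #G = 10 ^ #G * (101 / 1000) ^ #G := by
          rw [← mul_pow]; norm_num
        rw [e, one_pow, mul_one]
        gcongr
        · norm_num
        · omega
      have h4 : (0 : ℝ) ≤ (1 / 2) ^ (16 * k0) := by positivity
      linarith
  have hupper : ∑ X, ∑ Q, sp Q * ∏ j, (1 + Y X (Q j)) ≤ S * (47 ^ k0 + 1) := by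
    rw [hexpand]
    refine (sum_le_sum fun G _ => hterm G).trans ?_
    rw [← mul_sum]
    refine mul_le_mul_of_nonneg_left ?_ hS0.le
    rw [sum_add_distrib, ← mul_sum]
    have e1 := Fintype.sum_pow_mul_eq_add_pow (Fin (2 * (8 * k0))) (101 / 1000 : ℝ) 1
    rw [Fintype.card_fin] at e1
    rw [e1]
    have h1 : (10 : ℝ) ^ k0 * (101 / 1000 + 1) ^ (2 * (8 * k0)) ≤ 47 ^ k0 := by
      calc (10 : ℝ) ^ k0 * (101 / 1000 + 1) ^ (2 * (8 * k0)) =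
            (10 * (101 / 1000 + 1) ^ 16) ^ k0 := by
              rw [mul_pow, ← pow_mul]; congr 2; ring
        _ ≤ _ := by gcongr; norm_num
    have h2 : ∑ _G : Finset (Fin (2 * (8 * k0))), (1 / 2 : ℝ) ^ (16 * k0) = 1 := by
      rw [sum_const, card_univ, Fintype.card_finset, Fintype.card_fin, nsmul_eq_mul]
      push_cast
      rw [show 2 * (8 * k0) = 16 * k0 by ring, ← mul_pow]
      norm_num
    linarith
  have hfin := hlower.trans hupper
  have h1 : (200 : ℝ) ^ k0 / 8 ≤ 47 ^ k0 + 1 := by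
    refine le_of_mul_le_mul_left ?_ hS0
    linarith
  have h2 : (16 : ℝ) * 47 ^ k0 ≤ 200 ^ k0 := by
    calc (16 : ℝ) * 47 ^ k0 ≤ 4 ^ k0 * 47 ^ k0 := by
          gcongr
          calc (16 : ℝ) = 4 ^ 2 := by norm_num
            _ ≤ 4 ^ k0 := pow_le_pow_right₀ (by norm_num) hk2
      _ = 188 ^ k0 := by rw [← mul_pow]; norm_num
      _ ≤ _ := by gcongr; norm_num
  have h3 : (47 : ℝ) ^ 1 ≤ 47 ^ k0 := pow_le_pow_right₀ (by norm_num) (by omega)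
  linarith

end

/-! ### From one Butterfly to all epochs -/

theorem sum_sum_update_pi {ι : Type*} {α : ι → Type*} [Fintype ι] [DecidableEq ι]
    [∀ i, Fintype (α i)] (i : ι) (f : (∀ i, α i) → ℝ) :
    ∑ U, ∑ c, f (Function.update U i c) = Fintype.card (α i) * ∑ U, f U := by
  let e : (∀ i, α i) × α i ≃ (∀ i, α i) × α i :=
    { toFun := fun x => (Function.update x.1 i x.2, x.1 i)
      invFun := fun x => (Function.update x.1 i x.2, x.1 i)
      left_inv := fun x => by simp
      right_inv := fun x => by simp }
  have h := e.sum_comp fun x => f x.1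
  rw [Fintype.sum_prod_type, Fintype.sum_prod_type] at h
  simp only [e, Equiv.coe_fn_mk, sum_const, card_univ, nsmul_eq_mul] at h
  rw [h, mul_sum]

open Classical in
-- The string of the first edge alone makes the XOR uniform, so it vanishes with probability 2^{-b}.
theorem sum_pathXor_eq_zero {B I b : ℕ} (hI : 0 < I) (q : Path B I) :
    (Fintype.card (Bits b) : ℝ) *
      ∑ X : Assignment B I b, (if pathXor X q.1 q.2 = 0 then 1 else 0) =
      Fintype.card (Assignment B I b) := by
  rw [sum_assignment_translate (pathEdge q.1 q.2 ⟨0, hI⟩)]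
  have he : pathEdge q.1 q.2 ⟨0, hI⟩ ∈ pathEdges q := mem_image_of_mem _ (mem_univ _)
  have h : ∀ X : Assignment B I b, ∑ y : Bits b,
      (if pathXor (X + (Pi.single (pathEdge q.1 q.2 ⟨0, hI⟩) y : Assignment B I b)) q.1 q.2 = 0
        then (1 : ℝ) else 0) = 1 := by
    intro X
    simp only [pathXor_add_single, if_pos he, add_eq_zero_iff_neg_eq]
    simp
  simp only [h]
  simp

namespace DataStructure

variable {w B d b : ℕ} (D : DataStructure w B d b)

theorem memoryAfter_congr {U U' : Updates B d b} (k : ℕ)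
    (h : ∀ j : Fin d, d - (j.val + 1) < k → U j = U' j) :
    D.memoryAfter U k = D.memoryAfter U' k := by
  induction k with
  | zero => rfl
  | succ k ih =>
    have ih' := ih fun j hj => h j (by omega)
    simp only [memoryAfter]
    split_ifs with hk
    · rw [ih', h (Fin.rev ⟨k, hk⟩) (by simp only [Fin.val_rev]; omega)]
    · exact ih'

/-- The cells updated in the epochs after epoch number `i + 1`. -/
def laterCells (U : Updates B d b) (i : Fin d) : Finset (Fin (2 ^ w)) :=
  (univ.filter (· < i)).biUnion (D.updatedCells U)

/-- The final memory with the updates of epoch number `i + 1` undone in all cells that are not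
updated later. -/
def withoutEpoch (U : Updates B d b) (i : Fin d) : Memory w :=
  (D.laterCells U i).piecewise (D.memoryAfter U d) (D.memoryAfter U (d - (i + 1)))

theorem memoryAfter_eq_of_notMem {U : Updates B d b} {i : Fin d} {a : Fin (2 ^ w)}
    (ha : a ∉ D.laterCells U i) {k : ℕ} (hk : d - (i + 1) + 1 ≤ k) (hkd : k ≤ d) :
    D.memoryAfter U k a = D.memoryAfter U (d - (i + 1) + 1) a := by
  induction k, hk using Nat.le_induction with
  | base => rfl
  | succ k hk ih =>
    rw [← ih (by omega)]
    by_contra hne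
    have hi := i.isLt
    refine ha (mem_biUnion.2 ⟨⟨d - (k + 1), by omega⟩, ?_, ?_⟩)
    · simp only [mem_filter, mem_univ, true_and, Fin.lt_def]
      omega
    · have e : d - (d - (k + 1) + 1) = k := by omega
      simp only [updatedCells, e, mem_filter, mem_univ, true_and]
      exact hne

theorem diff_withoutEpoch_subset (U : Updates B d b) (i : Fin d) :
    diff (D.withoutEpoch U i) (D.memoryAfter U d) ⊆ D.updatedCells U i \ D.laterCells U i := by
  intro a ha
  have hi := i.isLt
  rw [mem_diff] at ha
  by_cases hl : a ∈ D.laterCells U i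
  · simp [withoutEpoch, hl] at ha
  · simp only [withoutEpoch, piecewise_eq_of_notMem _ _ _ hl] at ha
    rw [D.memoryAfter_eq_of_notMem hl (by omega) le_rfl] at ha
    simp only [mem_sdiff, updatedCells, mem_filter, mem_univ, true_and]
    exact ⟨ha, hl⟩

theorem diff_memoryAfter_withoutEpoch_subset (U : Updates B d b) (i : Fin d) :
    diff (D.memoryAfter U (d - (i + 1))) (D.withoutEpoch U i) ⊆ D.laterCells U i := by
  intro a ha
  by_contra hl
  simp [withoutEpoch, hl] at ha

/-- A cell that differs when epoch i is undone was changed in epoch i and in no later epoch, so each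
cell counts for at most one epoch. -/
theorem sum_card_diff_inter_le (U : Updates B d b) (S : Finset (Fin (2 ^ w))) :
    ∑ i, #(diff (D.withoutEpoch U i) (D.memoryAfter U d) ∩ S) ≤ #S := by
  have hdisj : ∀ i j : Fin d, i < j → Disjoint
      (diff (D.withoutEpoch U i) (D.memoryAfter U d) ∩ S)
      (diff (D.withoutEpoch U j) (D.memoryAfter U d) ∩ S) := by
    intro i j hij
    rw [disjoint_left]
    intro a ha hb
    have h1 := mem_sdiff.1 (D.diff_withoutEpoch_subset U i (mem_inter.1 ha).1)
    have h2 := mem_sdiff.1 (D.diff_withoutEpoch_subset U j (mem_inter.1 hb).1)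
    exact h2.2 (mem_biUnion.2 ⟨i, by simpa using hij, h1.1⟩)
  rw [← card_biUnion]
  · exact card_le_card (biUnion_subset.2 fun i _ => inter_subset_right)
  · intro i _ j _ hij
    rcases lt_or_gt_of_ne hij with h | h
    · exact hdisj i j h
    · exact (hdisj j i h).symm

open Classical in
-- A union bound over the d Butterflies: the answer is 1 with probability at most d/2^b ≤ 1/64.
theorem sum_isYes_le (hb : 64 * d ≤ 2 ^ b) :
    64 * ∑ U : Updates B d b, ∑ s : Fin (B ^ d), ∑ t : Fin (B ^ d),
      (if IsYes U s t then (1 : ℝ) else 0) ≤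
      Fintype.card (Updates B d b × Fin (B ^ d) × Fin (B ^ d)) := by
  have hbits : (Fintype.card (Bits b) : ℝ) = 2 ^ b := by simp [ZMod.card]
  have h1 : ∀ (i : Fin d) (s t : Fin (B ^ d)), (2 : ℝ) ^ b * ∑ U : Updates B d b,
      (if pathXor (U i) (indexIn i s) (indexIn i t) = 0 then (1 : ℝ) else 0) =
      Fintype.card (Updates B d b) := by
    intro i s t
    have e1 := sum_sum_update_pi (α := fun i : Fin d => Assignment B (i + 1) b) i fun U =>
      if pathXor (U i) (indexIn i s) (indexIn i t) = 0 then (1 : ℝ) else 0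
    have e2 := sum_pathXor_eq_zero (B := B) (b := b) (Nat.succ_pos i.val) (indexIn i s, indexIn i t)
    simp only [Function.update_self, sum_const, card_univ, nsmul_eq_mul] at e1
    have hX : (0 : ℝ) < Fintype.card (Assignment B (i + 1) b) := by exact_mod_cast Fintype.card_pos
    refine mul_left_cancel₀ hX.ne' ?_
    rw [hbits] at e2
    rw [mul_left_comm, ← e1, mul_left_comm]
    simp only at e2
    rw [e2, mul_comm]
  have h2 : ∀ (s t : Fin (B ^ d)), 64 * ∑ U : Updates B d b, (if IsYes U s t then (1 : ℝ) else 0) ≤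
      Fintype.card (Updates B d b) := by
    intro s t
    have h3 : ∑ U : Updates B d b, (if IsYes U s t then (1 : ℝ) else 0) ≤
        ∑ i : Fin d, ∑ U : Updates B d b,
          (if pathXor (U i) (indexIn i s) (indexIn i t) = 0 then (1 : ℝ) else 0) := by
      rw [sum_comm]
      refine sum_le_sum fun U _ => ?_
      split_ifs with hy
      · obtain ⟨i, hi⟩ := hy
        refine le_trans ?_ (single_le_sum (f := fun i : Fin d =>
          if pathXor (U i) (indexIn i s) (indexIn i t) = 0 then (1 : ℝ) else 0)
          (fun i _ => by split_ifs <;> norm_num) (mem_univ i))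
        simp [hi]
      · exact sum_nonneg fun i _ => by split_ifs <;> norm_num
    have h4 : (2 : ℝ) ^ b * ∑ U : Updates B d b, (if IsYes U s t then (1 : ℝ) else 0) ≤
        d * Fintype.card (Updates B d b) := by
      refine (mul_le_mul_of_nonneg_left h3 (by positivity)).trans (le_of_eq ?_)
      rw [mul_sum, sum_congr rfl fun i _ => h1 i s t]
      simp
    have h5 : (64 * d : ℝ) ≤ 2 ^ b := by exact_mod_cast hb
    rcases Nat.eq_zero_or_pos d with rfl | hd
    · have : ∀ U : Updates B 0 b, ¬ IsYes U s t := fun U ⟨i, _⟩ => i.elim0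
      simp [this]
    · have hd' : (0 : ℝ) < d := by exact_mod_cast hd
      have h6 : 0 ≤ ∑ U : Updates B d b, (if IsYes U s t then (1 : ℝ) else 0) :=
        sum_nonneg fun _ _ => by split_ifs <;> norm_num
      refine le_of_mul_le_mul_left ?_ hd'
      nlinarith [mul_le_mul_of_nonneg_right h5 h6]
  have h7 : ∑ U : Updates B d b, ∑ s : Fin (B ^ d), ∑ t : Fin (B ^ d),
      (if IsYes U s t then (1 : ℝ) else 0) = ∑ s : Fin (B ^ d), ∑ t : Fin (B ^ d),
        ∑ U : Updates B d b, (if IsYes U s t then (1 : ℝ) else 0) := by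
    rw [sum_comm]
    exact sum_congr rfl fun s _ => sum_comm
  rw [h7, mul_sum]
  calc _ ≤ ∑ _s : Fin (B ^ d), ∑ _t : Fin (B ^ d), (Fintype.card (Updates B d b) : ℝ) :=
        sum_le_sum fun s _ => by
          rw [mul_sum]
          exact sum_le_sum fun t _ => h2 s t
    _ = _ := by
        simp only [sum_const, card_univ, nsmul_eq_mul, Fintype.card_prod, Nat.cast_mul]
        ring

/-- An index in the Butterfly of depth `d` consists of one in the Butterfly of depth `i + 1` and of
further less significant digits. -/
def indexSplit (B : ℕ) (i : Fin d) : Fin (B ^ ((i : ℕ) + 1)) × Fin (B ^ (d - (i + 1))) ≃ Fin (B ^ d) :=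
  finProdFinEquiv.trans (finCongr (by
    rw [← pow_add]; congr 1; have := i.isLt; omega))

theorem indexIn_indexSplit (i : Fin d) (x : Fin (B ^ ((i : ℕ) + 1)) × Fin (B ^ (d - (i + 1)))) :
    indexIn i (indexSplit B i x) = x.1 := by
  apply Fin.ext
  simp only [indexIn, indexSplit, Equiv.trans_apply, finCongr_apply, Fin.val_cast,
    finProdFinEquiv_apply_val]
  have hpos : 0 < B ^ (d - (i + 1)) := (Nat.zero_le _).trans_lt x.2.isLt
  rw [Nat.add_mul_div_left _ _ hpos, Nat.div_eq_of_lt x.2.isLt, zero_add]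

open Classical in
-- With the updates of the other epochs and the less significant digits of the query fixed, what
-- remains is a uniform query in one Butterfly, to which `Parameters.not_good` applies. Its
-- hypothesis on correctness needs only one direction: an answer 0 excludes a zero XOR in this
-- Butterfly.
theorem sum_good_lt {A p a t m Dg s : ℕ} (hcorrect : D.Correct) (i : Fin d)
    (h : Parameters A B (i + 1) b w p a t m Dg s) (hs : 1 ≤ s)
    (hD : 3 * √(t * s) + 2 * s < (Dg : ℝ) + 1)
    (hp : ∀ U, #(D.laterCells U i) ≤ p) (ha : ∀ U, #(D.updatedCells U i) ≤ a) :
    4 * ∑ U : Updates B d b, ∑ x : Fin (B ^ d), ∑ y : Fin (B ^ d),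
      (if (D.query x y).good t m (D.withoutEpoch U i) (D.memoryAfter U d) then (1 : ℝ) else 0) <
      3 * Fintype.card (Updates B d b × Fin (B ^ d) × Fin (B ^ d)) := by
  have hB : 0 < B := by rw [h.degree]; exact pow_pos (by have := h.two_le; omega) _
  set f : Updates B d b → Fin (B ^ d) → Fin (B ^ d) → ℝ := fun U x y =>
    if (D.query x y).good t m (D.withoutEpoch U i) (D.memoryAfter U d) then (1 : ℝ) else 0 with hf
  have hinner : ∀ (V : Updates B d b) (x'' y'' : Fin (B ^ (d - (i + 1)))),
      4 * ∑ X : Assignment B (i + 1) b, ∑ q : Path B (i + 1),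
        f (Function.update V i X) (indexSplit B i (q.1, x'')) (indexSplit B i (q.2, y'')) <
      3 * (Fintype.card (Assignment B (i + 1) b) * Fintype.card (Path B (i + 1))) := by
    intro V x'' y''
    refine h.not_good hs hD (fun q => D.query (indexSplit B i (q.1, x'')) (indexSplit B i (q.2, y'')))
      (D.memoryAfter V (d - (i + 1))) (fun X => D.withoutEpoch (Function.update V i X) i)
      (fun X => D.memoryAfter (Function.update V i X) d) (fun X => ?_) (fun X => ?_) (fun X q hq => ?_)
    · have e : D.memoryAfter V (d - (i + 1)) = D.memoryAfter (Function.update V i X) (d - (i + 1)) := by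
        refine D.memoryAfter_congr _ fun j hj => ?_
        have : j ≠ i := by rintro rfl; omega
        simp [this]
      rw [e]
      exact (card_le_card (D.diff_memoryAfter_withoutEpoch_subset _ i)).trans (hp _)
    · exact (card_le_card ((D.diff_withoutEpoch_subset _ i).trans sdiff_subset)).trans (ha _)
    · intro hzero
      have hy : IsYes (Function.update V i X) (indexSplit B i (q.1, x'')) (indexSplit B i (q.2, y'')) := by
        refine ⟨i, ?_⟩
        rw [Function.update_self, indexIn_indexSplit, indexIn_indexSplit]
        exact hzero
      have := (hcorrect _ _ _).2 hy
      rw [hq] at this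
      exact absurd this (by simp)
  have hX : (0 : ℝ) < Fintype.card (Assignment B (i + 1) b) := by exact_mod_cast Fintype.card_pos
  refine lt_of_mul_lt_mul_left ?_ hX.le
  have e1 : (Fintype.card (Assignment B (i + 1) b) : ℝ) * (4 * ∑ U : Updates B d b, ∑ x, ∑ y, f U x y) =
      ∑ V : Updates B d b, ∑ x'' : Fin (B ^ (d - (i + 1))), ∑ y'' : Fin (B ^ (d - (i + 1))),
        4 * ∑ X : Assignment B (i + 1) b, ∑ q : Path B (i + 1),
        f (Function.update V i X) (indexSplit B i (q.1, x'')) (indexSplit B i (q.2, y'')) := by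
    have e2 := sum_sum_update_pi (α := fun i : Fin d => Assignment B (i + 1) b) i fun U =>
      ∑ x, ∑ y, f U x y
    rw [mul_left_comm, ← e2, mul_sum]
    refine sum_congr rfl fun V _ => ?_
    have e3 : ∀ X, ∑ x, ∑ y, f (Function.update V i X) x y =
        ∑ x'' : Fin (B ^ (d - (i + 1))), ∑ y'' : Fin (B ^ (d - (i + 1))), ∑ q : Path B (i + 1),
          f (Function.update V i X) (indexSplit B i (q.1, x'')) (indexSplit B i (q.2, y'')) := by
      intro X
      rw [← (indexSplit B i).sum_comp]
      simp only [← (indexSplit B i).sum_comp (fun y => f _ _ y), Fintype.sum_prod_type]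
      rw [sum_comm]
      refine sum_congr rfl fun x'' _ => ?_
      have : ∀ x', ∑ y', ∑ y'', f (Function.update V i X) (indexSplit B i (x', x''))
          (indexSplit B i (y', y'')) = ∑ y'', ∑ y', f (Function.update V i X)
          (indexSplit B i (x', x'')) (indexSplit B i (y', y'')) := fun x' => sum_comm
      simp only [this]
      rw [sum_comm]
    simp only [e3, ← mul_sum]
    congr 1
    rw [sum_comm]
    refine sum_congr rfl fun x'' _ => ?_
    rw [sum_comm]
  rw [e1]
  have hne : (univ : Finset (Fin (B ^ (d - (i + 1))))).Nonempty := ⟨⟨0, by positivity⟩, mem_univ _⟩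
  calc _ < ∑ _V : Updates B d b, ∑ _x'' : Fin (B ^ (d - (i + 1))), ∑ _y'' : Fin (B ^ (d - (i + 1))),
        (3 * (Fintype.card (Assignment B (i + 1) b) * Fintype.card (Path B (i + 1))) : ℝ) :=
        sum_lt_sum_of_nonempty univ_nonempty fun V _ => sum_lt_sum_of_nonempty hne fun x'' _ =>
          sum_lt_sum_of_nonempty hne fun y'' _ => hinner V x'' y''
    _ = _ := by
        have e : (B : ℝ) ^ d = B ^ ((i : ℕ) + 1) * B ^ (d - (i + 1)) := by
          rw [← pow_add]; congr 1; have := i.isLt; omega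
        simp only [sum_const, card_univ, nsmul_eq_mul, Fintype.card_prod, Nat.cast_mul,
          Fintype.card_fin, Nat.cast_pow, e]
        ring

/-- The average number of probes, as a real number. -/
noncomputable def realAverage : ℝ :=
  (∑ U : Updates B d b, ∑ s : Fin (B ^ d), ∑ t : Fin (B ^ d), (D.queryProbes U s t : ℝ)) /
    (Fintype.card (Updates B d b × Fin (B ^ d) × Fin (B ^ d)) : ℝ)

theorem card_inputs_pos (hB : 0 < B) :
    0 < Fintype.card (Updates B d b × Fin (B ^ d) × Fin (B ^ d)) := by
  have : 0 < B ^ d := by positivity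
  simp only [Fintype.card_prod, Fintype.card_fin]
  have : 0 < Fintype.card (Updates B d b) := Fintype.card_pos
  positivity

theorem ofReal_realAverage (hB : 0 < B) : ENNReal.ofReal D.realAverage = D.averageProbes := by
  have hc : (0 : ℝ) < Fintype.card (Updates B d b × Fin (B ^ d) × Fin (B ^ d)) := by
    exact_mod_cast card_inputs_pos hB
  unfold realAverage averageProbes
  rw [ENNReal.ofReal_div_of_pos hc, ENNReal.ofReal_natCast]
  congr 1
  have : (∑ U : Updates B d b, ∑ s : Fin (B ^ d), ∑ t : Fin (B ^ d), (D.queryProbes U s t : ℝ)) =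
      ((∑ U : Updates B d b, ∑ s : Fin (B ^ d), ∑ t : Fin (B ^ d), D.queryProbes U s t : ℕ) : ℝ) := by
    push_cast; rfl
  rw [this, ENNReal.ofReal_natCast]
  push_cast
  rfl

theorem markov_count {ι : Type*} [Fintype ι] (f : ι → ℕ) {c y : ℝ}
    (h : ∑ x, (f x : ℝ) ≤ c) [DecidablePred fun x => ⌊y⌋₊ < f x] :
    y * ∑ x, (if ⌊y⌋₊ < f x then (1 : ℝ) else 0) ≤ c := by
  refine le_trans ?_ h
  rw [mul_sum]
  refine sum_le_sum fun x _ => ?_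
  split_ifs with hx
  · rw [mul_one]; exact (Nat.lt_of_floor_lt hx).le
  · simp

open Classical in
/-- The average number of probes is large if the parameters that belong to a smaller one rule out
simulations. -/
theorem lt_realAverage {A t m Dg s : ℕ} {T : ℝ} (hT : 0 < T) (hd : 1 ≤ d) (hcorrect : D.Correct)
    (p a : Fin d → ℕ) (ht : t = ⌊16 * T⌋₊) (hm : m = ⌊32 * T / d⌋₊) (hb : 64 * d ≤ 2 ^ b)
    (h : ∀ i : Fin d, d ≤ 2 * (i.val + 1) → Parameters A B (i + 1) b w (p i) (a i) t m Dg s)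
    (hs : 1 ≤ s) (hD : 3 * √(t * s) + 2 * s < (Dg : ℝ) + 1)
    (hp : ∀ i U, #(D.laterCells U i) ≤ p i) (ha : ∀ i U, #(D.updatedCells U i) ≤ a i) :
    T < D.realAverage := by
  by_contra hcon
  rw [not_lt] at hcon
  have hd' : (0 : ℝ) < d := by exact_mod_cast hd
  have hBp : 0 < B := by
    have := h ⟨d - 1, by omega⟩ (by simp only; omega)
    rw [this.degree]; exact pow_pos (by have := this.two_le; omega) _
  set n : ℝ := ((Fintype.card (Updates B d b × Fin (B ^ d) × Fin (B ^ d)) : ℕ) : ℝ) with hn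
  have hn0 : 0 < n := by
    rw [hn]
    exact Nat.cast_pos.2 (card_inputs_pos hBp)
  let Inp := Updates B d b × Fin (B ^ d) × Fin (B ^ d)
  have hsum : ∀ g : Updates B d b → Fin (B ^ d) → Fin (B ^ d) → ℝ,
      ∑ U, ∑ s, ∑ t, g U s t = ∑ x : Inp, g x.1 x.2.1 x.2.2 := by
    intro g
    simp only [Inp, Fintype.sum_prod_type]
  have hprobes : ∑ x : Inp, (D.queryProbes x.1 x.2.1 x.2.2 : ℝ) ≤ T * n := by
    unfold realAverage at hcon
    rw [hsum (fun U s t => (D.queryProbes U s t : ℝ)), div_le_iff₀ hn0] at hcon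
    exact hcon
  let c : Fin d → Inp → ℕ := fun i x =>
    #(diff (D.withoutEpoch x.1 i) (D.memoryAfter x.1 d) ∩
      (D.query x.2.1 x.2.2).probed (D.memoryAfter x.1 d))
  -- At least d/2 epochs have depth at least d/2, and together their cells receive at most T probes
  -- on average, so one of these epochs receives at most 2T/d.
  obtain ⟨i, hi, hci⟩ : ∃ i : Fin d, d ≤ 2 * (i.val + 1) ∧ ∑ x : Inp, (c i x : ℝ) ≤ 2 * T / d * n := by
    by_contra hno
    push Not at hno
    have h1 : ∑ i : Fin d, ∑ x : Inp, (c i x : ℝ) ≤ T * n := by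
      rw [sum_comm]
      refine le_trans (sum_le_sum fun x _ => ?_) hprobes
      have h2 := (D.sum_card_diff_inter_le x.1
        ((D.query x.2.1 x.2.2).probed (D.memoryAfter x.1 d))).trans (ProbeTree.card_probed_le _ _)
      exact_mod_cast h2
    have h2 : ∑ i : Fin d, (if d ≤ 2 * (i.val + 1) then 2 * T / d * n else 0) <
        ∑ i : Fin d, ∑ x : Inp, (c i x : ℝ) := by
      refine sum_lt_sum (fun i _ => ?_) ⟨⟨d - 1, by omega⟩, mem_univ _, ?_⟩
      · split_ifs with hi
        · exact (hno i hi).le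
        · exact sum_nonneg fun _ _ => Nat.cast_nonneg _
      · rw [if_pos (by simp only; omega)]
        exact hno _ (by simp only; omega)
    have h3 : (d : ℝ) / 2 ≤ #{i : Fin d | d ≤ 2 * (i.val + 1)} := by
      have h4 : d ≤ 2 * #{i : Fin d | d ≤ 2 * (i.val + 1)} := by
        have h5 : #{i : Fin d | ¬ d ≤ 2 * (i.val + 1)} ≤ #{i : Fin d | d ≤ 2 * (i.val + 1)} := by
          refine card_le_card_of_injOn Fin.rev ?_ Fin.rev_injective.injOn
          intro i hi
          rw [mem_coe, mem_filter] at hi ⊢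
          refine ⟨mem_univ _, ?_⟩
          have := hi.2
          rw [Fin.val_rev]
          omega
        have h6 := card_filter_add_card_filter_not (s := (univ : Finset (Fin d)))
          (fun i => d ≤ 2 * (i.val + 1))
        rw [card_univ, Fintype.card_fin] at h6
        omega
      have : (d : ℝ) ≤ 2 * #{i : Fin d | d ≤ 2 * (i.val + 1)} := by exact_mod_cast h4
      linarith
    rw [← sum_filter, sum_const, nsmul_eq_mul] at h2
    have h7 : T * n ≤ (#{i : Fin d | d ≤ 2 * (i.val + 1)} : ℝ) * (2 * T / d * n) := by
      calc T * n = d / 2 * (2 * T / d * n) := by field_simp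
        _ ≤ _ := by gcongr
    linarith
  have hpar := h i hi
  have hlt := D.sum_good_lt hcorrect i hpar hs hD (hp i) (ha i)
  rw [hsum (fun U x y => if (D.query x y).good t m (D.withoutEpoch U i) (D.memoryAfter U d)
    then (1 : ℝ) else 0), ← hn] at hlt
  have hyes := sum_isYes_le (d := d) (B := B) hb
  rw [hsum (fun U x y => if IsYes U x y then (1 : ℝ) else 0), ← hn] at hyes
  have hm1 := markov_count (fun x : Inp => D.queryProbes x.1 x.2.1 x.2.2) (y := 16 * T)
    hprobes
  have hm2 := markov_count (fun x : Inp => c i x) (y := 32 * T / d) hci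
  rw [← ht] at hm1
  rw [← hm] at hm2
  -- Every input is good, has the answer 1, needs more than t probes or reads more than m cells of
  -- the epoch. The probabilities are less than 3/4 for the first and at most 1/64, 1/16 and 1/16
  -- for the others, with a total below 1.
  have hone : n ≤ ∑ x : Inp, ((if (D.query x.2.1 x.2.2).good t m (D.withoutEpoch x.1 i)
      (D.memoryAfter x.1 d) then (1 : ℝ) else 0) + (if IsYes x.1 x.2.1 x.2.2 then (1 : ℝ) else 0) +
      (if t < D.queryProbes x.1 x.2.1 x.2.2 then (1 : ℝ) else 0) +
      (if m < c i x then (1 : ℝ) else 0)) := by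
    have e : n = ∑ _x : Inp, (1 : ℝ) := by
      rw [sum_const, card_univ, nsmul_eq_mul, mul_one]
    rw [e]
    refine sum_le_sum fun x _ => ?_
    by_cases h1 : IsYes x.1 x.2.1 x.2.2
    · rw [if_pos h1]; split_ifs <;> norm_num
    by_cases h2 : t < D.queryProbes x.1 x.2.1 x.2.2
    · rw [if_pos h2]; split_ifs <;> norm_num
    by_cases h3 : m < c i x
    · rw [if_pos h3]; split_ifs <;> norm_num
    have hg : (D.query x.2.1 x.2.2).good t m (D.withoutEpoch x.1 i) (D.memoryAfter x.1 d) := by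
      refine ⟨?_, not_lt.1 h2, not_lt.1 h3⟩
      by_contra hne
      exact h1 ((hcorrect _ _ _).1 (by simpa using hne))
    rw [if_pos hg]; split_ifs; norm_num
  simp only [sum_add_distrib] at hone
  have hm1' : 16 * ∑ x : Inp, (if t < D.queryProbes x.1 x.2.1 x.2.2 then (1 : ℝ) else 0) ≤ n := by
    refine le_of_mul_le_mul_left ?_ hT
    linarith
  have hm2' : 16 * ∑ x : Inp, (if m < c i x then (1 : ℝ) else 0) ≤ n := by
    have : 0 < 2 * T / d := by positivity
    refine le_of_mul_le_mul_left ?_ this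
    calc _ = 32 * T / d * ∑ x : Inp, (if m < c i x then (1 : ℝ) else 0) := by ring
      _ ≤ _ := hm2
  linarith

end DataStructure

/-! ### Elementary consequences of correctness -/

namespace DataStructure

variable {w B d b : ℕ}

open Classical in
/-- Updates after which a query from the source `s` has the answer `1` exactly if `s ∈ S`. -/
noncomputable def indicatorUpdates (S : Set ℕ) : Updates B d b := fun i e =>
  if e.1.1.val = 0 ∧ (i.val + 1 < d ∨ e.1.2.1.val ∉ S) then 1 else 0

open Classical in
-- Only edges leaving layer 0 can carry a nonzero string, and they start at the source. In the
-- Butterflies of depth below d they always carry the all-ones string, so for b > 0 only the deepest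
-- Butterfly can make the answer 1.
theorem pathXor_indicatorUpdates (S : Set ℕ) (i : Fin d) (s t : Fin (B ^ ((i : ℕ) + 1))) :
    pathXor (indicatorUpdates (b := b) S i) s t = if i.val + 1 < d ∨ s.val ∉ S then 1 else 0 := by
  have hs : pathNode s t 0 = s := by
    unfold pathNode digit
    simp
  unfold pathXor
  rw [Fin.sum_univ_succ, sum_eq_zero fun l _ => ?_, add_zero]
  · simp only [indicatorUpdates, pathEdge, Fin.val_zero, hs, true_and]
  · simp [indicatorUpdates, pathEdge]

theorem isYes_indicatorUpdates (hd : 0 < d) (hb : 0 < b) (S : Set ℕ) (s t : Fin (B ^ d)) :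
    IsYes (indicatorUpdates (b := b) S) s t ↔ s.val ∈ S := by
  have hone : (1 : Bits b) ≠ 0 := fun h => one_ne_zero (congrFun h ⟨0, hb⟩)
  simp only [IsYes, pathXor_indicatorUpdates, ite_eq_right_iff, hone, imp_false, not_or, not_lt,
    not_not]
  constructor
  · rintro ⟨i, h1, h2⟩
    have e : d - (i.val + 1) = 0 := by omega
    simpa [indexIn, e] using h2
  · intro h
    have e : d - (d - 1 + 1) = 0 := by omega
    exact ⟨⟨d - 1, by omega⟩, by simp only; omega, by simpa [indexIn, e] using h⟩

variable (D : DataStructure w B d b)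

/-- Both answers occur for every query, so its decision tree is not a leaf. -/
theorem Correct.one_le_queryProbes {D : DataStructure w B d b} (hD : D.Correct) (hd : 0 < d)
    (hb : 0 < b) (U : Updates B d b) (s t : Fin (B ^ d)) : 1 ≤ D.queryProbes U s t := by
  unfold queryProbes
  have hno := hD (indicatorUpdates ∅) s t
  have hyes := hD (indicatorUpdates Set.univ) s t
  rw [isYes_indicatorUpdates hd hb] at hno hyes
  cases h : D.query s t with
  | answer a => simp_all [ProbeTree.output]
  | probe address next => simp [ProbeTree.probes]

theorem Correct.one_le_realAverage {D : DataStructure w B d b} (hD : D.Correct) (hB : 0 < B)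
    (hd : 0 < d) (hb : 0 < b) : 1 ≤ D.realAverage := by
  have hc : (0 : ℝ) < Fintype.card (Updates B d b × Fin (B ^ d) × Fin (B ^ d)) :=
    Nat.cast_pos.2 (card_inputs_pos hB)
  rw [realAverage, le_div_iff₀ hc, one_mul]
  calc (Fintype.card (Updates B d b × Fin (B ^ d) × Fin (B ^ d)) : ℝ) =
        ∑ _U : Updates B d b, ∑ _s : Fin (B ^ d), ∑ _t : Fin (B ^ d), (1 : ℝ) := by
        simp only [sum_const, card_univ, nsmul_eq_mul, Fintype.card_prod, Nat.cast_mul, mul_one]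
    _ ≤ _ := sum_le_sum fun U _ => sum_le_sum fun s _ => sum_le_sum fun t _ => by
        exact_mod_cast hD.one_le_queryProbes hd hb U s t

/-- The final memory determines the answers and hence the set S of sources encoded by
`indicatorUpdates`, so there are at least as many memories as sets of sources. -/
theorem Correct.two_pow_le {D : DataStructure w B d b} (hD : D.Correct) (hB : 0 < B) (hd : 0 < d)
    (hb : 0 < b) : 2 ^ B ^ d ≤ 2 ^ (w * 2 ^ w) := by
  have hinj : Function.Injective fun S : Finset (Fin (B ^ d)) =>
      D.memoryAfter (indicatorUpdates {n | ∃ s ∈ S, s.val = n}) d := by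
    intro S S' h
    ext s
    have h1 := hD (indicatorUpdates {n | ∃ s ∈ S, s.val = n}) s ⟨0, by positivity⟩
    have h2 := hD (indicatorUpdates {n | ∃ s ∈ S', s.val = n}) s ⟨0, by positivity⟩
    simp only at h
    rw [isYes_indicatorUpdates hd hb] at h1 h2
    rw [h] at h1
    have h3 := h1.symm.trans h2
    simpa [Fin.val_inj] using h3
  have h := Fintype.card_le_of_injective _ hinj
  simpa [pow_mul] using h

theorem Correct.depth_le {D : DataStructure w B d b} (hD : D.Correct) (hd : 0 < d) (hb : 0 < b)
    (hB : 4 ≤ B) : d ≤ w := by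
  have h1 : B ^ d ≤ w * 2 ^ w := (Nat.pow_le_pow_iff_right (by norm_num)).1 (hD.two_pow_le (by omega) hd hb)
  have h2 : 4 ^ d ≤ 4 ^ w := by
    calc 4 ^ d ≤ B ^ d := Nat.pow_le_pow_left hB d
      _ ≤ w * 2 ^ w := h1
      _ ≤ 2 ^ w * 2 ^ w := Nat.mul_le_mul_right _ Nat.lt_two_pow_self.le
      _ = 4 ^ w := by rw [← mul_pow]; norm_num
  exact (Nat.pow_le_pow_iff_right (by norm_num)).1 h2

end DataStructure

/-! ### Number of nodes and choice of the parameters -/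

theorem totalNodes_le {B d : ℕ} (hB : 2 * d ^ 2 ≤ B) (hd : 1 ≤ d) : totalNodes B d ≤ B ^ (2 * d) := by
  have hB1 : 1 ≤ B := by nlinarith
  have h1 : totalNodes B d = ∑ i : Fin d, (i.val + 2) * B ^ (i.val + 1) := by
    simp [totalNodes, Fintype.card_sigma, Node]
  rw [h1]
  calc _ ≤ ∑ _i : Fin d, (d + 1) * B ^ d := sum_le_sum fun i _ =>
        Nat.mul_le_mul (by omega) (Nat.pow_le_pow_right hB1 (by omega))
    _ = d * (d + 1) * B ^ d := by simp [mul_assoc]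
    _ ≤ B ^ 1 * B ^ d := Nat.mul_le_mul_right _ (by nlinarith)
    _ ≤ B ^ d * B ^ d := Nat.mul_le_mul_right _ (Nat.pow_le_pow_right hB1 hd)
    _ = B ^ (2 * d) := by rw [← pow_add, two_mul]

theorem totalNodes_pos {B d : ℕ} (hB : 1 ≤ B) (hd : 1 ≤ d) : 1 ≤ totalNodes B d := by
  have : Nonempty (Σ i : Fin d, Node B (i + 1)) :=
    ⟨⟨0, hd⟩, 0, ⟨0, by positivity⟩⟩
  exact Fintype.card_pos

theorem mul_geom_sum_le {B : ℕ} (hB : 2 ≤ B) (n : ℕ) :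
    B * ∑ j ∈ range n, B ^ j ≤ 2 * B ^ n := by
  induction n with
  | zero => simp
  | succ n ih =>
    rw [sum_range_succ, mul_add, pow_succ]
    nlinarith [Nat.mul_le_mul_right (B ^ n) hB]

theorem DataStructure.card_laterCells_le {w B d b : ℕ} (D : DataStructure w B d b) (hB : 2 ≤ B)
    {C : ℝ} (hC : 0 ≤ C) (U : Updates B d b)
    (h : ∀ i : Fin d, (#(D.updatedCells U i) : ℝ) ≤ C * (B : ℝ) ^ ((i : ℕ) + 1 + 1)) (i : Fin d) :
    (#(D.laterCells U i) : ℝ) ≤ 2 * C * (B : ℝ) ^ ((i : ℕ) + 1) := by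
  have h1 : (#(D.laterCells U i) : ℝ) ≤ ∑ j ∈ univ.filter (· < i), (#(D.updatedCells U j) : ℝ) := by
    exact_mod_cast card_biUnion_le
  have h2 : ∑ j ∈ univ.filter (· < i), (B : ℝ) ^ (j : ℕ) = ∑ j ∈ range i, (B : ℝ) ^ j := by
    refine sum_bij (fun j _ => j.val) (fun j hj => ?_) (fun _ _ _ _ h => Fin.ext h)
      (fun j hj => ?_) fun _ _ => rfl
    · exact mem_range.2 (mem_filter.1 hj).2
    · have := mem_range.1 hj
      exact ⟨⟨j, by omega⟩, mem_filter.2 ⟨mem_univ _, this⟩, rfl⟩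
  have h3 : (B : ℝ) * ∑ j ∈ range i, (B : ℝ) ^ j ≤ 2 * (B : ℝ) ^ (i : ℕ) := by
    exact_mod_cast mul_geom_sum_le hB i
  calc _ ≤ ∑ j ∈ univ.filter (· < i), C * (B : ℝ) ^ ((j : ℕ) + 1 + 1) :=
        h1.trans (sum_le_sum fun j _ => h j)
    _ = C * B * (B * ∑ j ∈ univ.filter (· < i), (B : ℝ) ^ (j : ℕ)) := by
        rw [mul_sum, mul_sum]
        exact sum_congr rfl fun j _ => by ring
    _ ≤ C * B * (2 * (B : ℝ) ^ (i : ℕ)) := by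
        rw [h2]
        gcongr
    _ = _ := by ring

theorem clog_le_logb_add_one {n : ℕ} (hn : 1 ≤ n) : (Nat.clog 2 n : ℝ) ≤ Real.logb 2 n + 1 := by
  have h := Real.natCeil_logb_natCast 2 n
  have h0 : 0 ≤ Real.logb 2 (n : ℝ) := Real.logb_nonneg (by norm_num) (by exact_mod_cast hn)
  have h1 := (Nat.ceil_lt_add_one h0).le
  rw [← h]
  exact_mod_cast h1

theorem eventually_clog_le {ε : ℝ} (hε : 0 < ε) :
    ∀ᶠ d : ℕ in Filter.atTop, (Nat.clog 2 d : ℝ) + 13 ≤ ε * √d := by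
  have h1 : ∀ᶠ x : ℝ in Filter.atTop, |Real.log x| ≤ ε / 4 * |x ^ (1 / 2 : ℝ)| :=
    (isLittleO_log_rpow_atTop (by norm_num : (0 : ℝ) < 1 / 2)).def (by positivity)
  have h2 : Filter.Tendsto (fun d : ℕ => ε / 2 * √(d : ℝ)) Filter.atTop Filter.atTop :=
    (Real.tendsto_sqrt_atTop.comp tendsto_natCast_atTop_atTop).const_mul_atTop (by positivity)
  filter_upwards [tendsto_natCast_atTop_atTop.eventually h1, h2.eventually_ge_atTop 14,
    Filter.eventually_ge_atTop 1] with d h3 h4 h5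
  have h6 := clog_le_logb_add_one h5
  rw [← Real.sqrt_eq_rpow, abs_of_nonneg (Real.sqrt_nonneg _)] at h3
  have h7 : Real.logb 2 (d : ℝ) ≤ 2 * Real.log d := by
    have h8 : 0 ≤ Real.log (d : ℝ) := Real.log_nonneg (by exact_mod_cast h5)
    have h9 := Real.log_two_gt_d9
    rw [Real.logb, div_le_iff₀ (by linarith)]
    nlinarith
  have h8 := (le_abs_self _).trans h3
  linarith

/-- The number of probes that is ruled out, for depth `d` and degree `B`. -/
noncomputable def probeBound (d B : ℕ) : ℝ := (d : ℝ) ^ (3 / 2 : ℝ) / √(Real.logb 2 B)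

/-- Lower bounds on the depth `d` that make the estimates work for update constant `K`. -/
structure LargeDepth (K : ℝ) (d : ℕ) : Prop where
  two_pow_le : 2 ^ 54 ≤ d
  le_depth : 2 * K ≤ d
  clog_le : (Nat.clog 2 d : ℝ) + 13 ≤ 1 / 30000 * √d

theorem eventually_largeDepth (K : ℝ) : ∀ᶠ d : ℕ in Filter.atTop, LargeDepth K d := by
  filter_upwards [Filter.eventually_ge_atTop (2 ^ 54), eventually_clog_le (by norm_num : (0 : ℝ) <
    1 / 30000), tendsto_natCast_atTop_atTop.eventually (Filter.eventually_ge_atTop (2 * K))]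
    with d h1 h2 h3
  exact ⟨h1, h3, h2⟩

theorem sqrt_bound {d B : ℕ} (hB : 2 ≤ B) :
    1 ≤ √(Real.logb 2 B) ∧ probeBound d B = √d ^ 3 / √(Real.logb 2 B) := by
  have h1 : (1 : ℝ) ≤ Real.logb 2 B := by
    rw [Real.le_logb_iff_rpow_le (by norm_num) (by positivity)]
    simpa using (by exact_mod_cast hB : (2 : ℝ) ≤ B)
  refine ⟨Real.one_le_sqrt.2 h1, ?_⟩
  unfold probeBound
  congr 1
  rw [Real.sqrt_eq_rpow, ← Real.rpow_natCast, ← Real.rpow_mul (by positivity)]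
  norm_num

/-- The numerical constraints on the thresholds that do not involve the update times. -/
theorem exists_thresholds {K : ℝ} {d A B t m : ℕ} (h : LargeDepth K d) (hA : d ≤ A)
    (hB : B = A ^ 12) (ht : t = ⌊16 * (1 / 30000 * probeBound d B)⌋₊)
    (hm : m = ⌊32 * (1 / 30000 * probeBound d B) / d⌋₊) :
    ∃ s Dg : ℕ, 1 ≤ s ∧ 3 * √(t * s) + 2 * s < (Dg : ℝ) + 1 ∧ 96 * (m + Dg) ≤ d ∧
      2 * t + 1 ≤ B ∧ (1 / 2 : ℝ) ^ s * (t + 1) ^ m * 2 ^ (Nat.clog 2 d + 6) ≤ 1 / 100 := by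
  have hd54 := h.two_pow_le
  have hd2 : 2 ≤ d := le_trans (by norm_num) hd54
  have hdA2 : d ^ 2 ≤ B := by
    rw [hB]
    calc d ^ 2 ≤ A ^ 2 := Nat.pow_le_pow_left hA 2
      _ ≤ A ^ 12 := Nat.pow_le_pow_right (by omega) (by norm_num)
  have hB2 : 2 ≤ B := by nlinarith
  obtain ⟨hz, hpb⟩ := sqrt_bound (d := d) hB2
  set z := √(Real.logb 2 B) with hzdef
  set y := √(d : ℝ) with hy
  have hd0 : (0 : ℝ) ≤ d := by positivity
  have hyd : y ^ 2 = d := Real.sq_sqrt hd0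
  have hz2 : z ^ 2 = Real.logb 2 B :=
    Real.sq_sqrt (Real.logb_nonneg (by norm_num) (by exact_mod_cast (by omega : 1 ≤ B)))
  have hy1 : 1 ≤ y := Real.one_le_sqrt.2 (by exact_mod_cast (by omega : 1 ≤ d))
  have hy0 : 0 < y := by linarith
  have hz0 : 0 < z := by linarith
  have hclog := h.clog_le
  rw [← hy] at hclog
  have hyle : y ≤ d := by rw [← hyd]; nlinarith
  have htz : (t : ℝ) * z ≤ 16 / 30000 * y ^ 3 := by
    have : (t : ℝ) ≤ 16 * (1 / 30000 * probeBound d B) := by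
      rw [ht]; exact Nat.floor_le (by rw [hpb]; positivity)
    rw [hpb] at this
    calc _ ≤ 16 * (1 / 30000 * (y ^ 3 / z)) * z := by gcongr
      _ = _ := by field_simp
  have hmz : (m : ℝ) * z ≤ 32 / 30000 * y := by
    have : (m : ℝ) ≤ 32 * (1 / 30000 * probeBound d B) / d := by
      rw [hm]; exact Nat.floor_le (by rw [hpb]; positivity)
    rw [hpb, ← hyd] at this
    calc _ ≤ 32 * (1 / 30000 * (y ^ 3 / z)) / y ^ 2 * z := by gcongr
      _ = _ := by field_simp
  have ht0 : (0 : ℝ) ≤ t := by positivity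
  have hm0 : (0 : ℝ) ≤ m := by positivity
  have hty : (t : ℝ) ≤ 16 / 30000 * y ^ 3 := by nlinarith
  have hmy : (m : ℝ) ≤ 32 / 30000 * y := by nlinarith
  have htd : 2 * t + 1 ≤ d ^ 2 := by
    have h1 : (2 * t + 1 : ℝ) ≤ (d : ℝ) ^ 2 := by
      have h2 : y ^ 3 ≤ y ^ 4 := pow_le_pow_right₀ hy1 (by norm_num)
      have h3 : (d : ℝ) ^ 2 = y ^ 4 := by rw [← hyd]; ring
      have h4 : (2 : ℝ) ^ 2 ≤ (d : ℝ) ^ 2 := by gcongr; exact_mod_cast hd2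
      linarith
    exact_mod_cast h1
  set q := Nat.clog 2 (t + 1) with hq
  -- Two bounds on q, which is about lg t: by 2·lg B, used against the factor 1/√(lg B) in both t
  -- and m, and by a small multiple of √d, which makes s itself small compared with d.
  have hq1 : (q : ℝ) ≤ 2 * z ^ 2 := by
    have h1 : q ≤ Nat.clog 2 B := Nat.clog_mono_right 2 (by omega)
    have h2 := clog_le_logb_add_one (n := B) (by omega)
    rw [← hz2] at h2
    have h3 : (q : ℝ) ≤ Nat.clog 2 B := by exact_mod_cast h1
    nlinarith
  have hq2 : (q : ℝ) ≤ 2 * (1 / 30000 * y) := by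
    have h1 : q ≤ Nat.clog 2 d * 2 := by
      refine Nat.clog_le_of_le_pow ?_
      rw [pow_mul]
      exact le_trans (by omega) (Nat.pow_le_pow_left (Nat.le_pow_clog (by norm_num) d) 2)
    have h2 : (q : ℝ) ≤ Nat.clog 2 d * 2 := by exact_mod_cast h1
    linarith
  have hq0 : (0 : ℝ) ≤ q := by positivity
  -- Since t + 1 ≤ 2^q, this s cancels both (t+1)^m and 2^b with b = ⌈lg d⌉ + 6, and leaves the
  -- error 2^{-7}.
  set s : ℕ := m * q + (Nat.clog 2 d + 13) with hs
  have hscast : (s : ℝ) = m * q + (Nat.clog 2 d + 13) := by rw [hs]; push_cast; ring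
  refine ⟨s, ⌊3 * √(t * s) + 2 * s⌋₊, by omega, Nat.lt_floor_add_one _, ?_, by omega, ?_⟩
  · have hmq : (m : ℝ) * q ≤ 1 / 30000 * d := by
      calc (m : ℝ) * q ≤ (32 / 30000 * y) * (2 * (1 / 30000 * y)) := by gcongr
        _ = 64 / 30000 * (1 / 30000) * y ^ 2 := by ring
        _ ≤ 1 / 30000 * d := by rw [hyd]; nlinarith
    have hsd : (s : ℝ) ≤ 2 / 30000 * d := by rw [hscast]; linarith
    have hts : (t : ℝ) * s ≤ (33 / 30000 * d) ^ 2 := by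
      -- The critical constraint: t·m·q is at most 2·(tz)·(mz) with z² = lg B, which is O(d²)
      -- exactly for thresholds of order d^{3/2}/z.
      have h1 : (t : ℝ) * (m * q) ≤ 1024 / 30000 ^ 2 * d ^ 2 := by
        calc (t : ℝ) * (m * q) ≤ t * (m * (2 * z ^ 2)) := by gcongr
          _ = 2 * ((t * z) * (m * z)) := by ring
          _ ≤ 2 * ((16 / 30000 * y ^ 3) * (32 / 30000 * y)) := by gcongr
          _ = 1024 / 30000 ^ 2 * (y ^ 2) ^ 2 := by ring
          _ = _ := by rw [hyd]
      have h2 : (t : ℝ) * (Nat.clog 2 d + 13) ≤ 16 / 30000 ^ 2 * d ^ 2 := by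
        calc (t : ℝ) * (Nat.clog 2 d + 13) ≤ (16 / 30000 * y ^ 3) * (1 / 30000 * y) := by gcongr
          _ = 16 / 30000 ^ 2 * (y ^ 2) ^ 2 := by ring
          _ = _ := by rw [hyd]
      rw [hscast, mul_add]
      nlinarith
    have hsq : √((t : ℝ) * s) ≤ 33 / 30000 * d := by
      rw [Real.sqrt_le_left (by positivity)]
      exact hts
    have hfl : ((⌊3 * √((t : ℝ) * s) + 2 * s⌋₊ : ℕ) : ℝ) ≤ 3 * √(t * s) + 2 * s :=
      Nat.floor_le (by positivity)
    have : (96 * (m + (⌊3 * √((t : ℝ) * s) + 2 * s⌋₊ : ℕ)) : ℝ) ≤ d := by linarith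
    exact_mod_cast this
  · have h1 : ((t : ℝ) + 1) ≤ 2 ^ q := by
      have := Nat.le_pow_clog (b := 2) (by norm_num) (t + 1)
      exact_mod_cast this
    calc (1 / 2 : ℝ) ^ s * (t + 1) ^ m * 2 ^ (Nat.clog 2 d + 6) ≤
          (1 / 2 : ℝ) ^ s * (2 ^ q) ^ m * 2 ^ (Nat.clog 2 d + 6) := by gcongr
      _ = (1 / 2 : ℝ) ^ 7 := by
          have e : (1 / 2 : ℝ) ^ s = (1 / 2) ^ 7 * ((1 / 2) ^ (q * m) * (1 / 2) ^ (Nat.clog 2 d + 6)) := by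
            rw [← pow_add, ← pow_add]; congr 1; rw [hs]; ring
          rw [e, ← pow_mul, one_div, inv_pow 2 (q * m), inv_pow 2 (Nat.clog 2 d + 6)]
          field_simp
      _ ≤ 1 / 100 := by norm_num

theorem spread_bound {A B I : ℕ} (hA : 8 ≤ A) (hI : I ≤ A) (hB : B = A ^ 12) :
    8 * I * (B : ℝ) ^ I * Real.exp (16 * A ^ 2) ≤ 2 ^ (A ^ 4) := by
  have hA2 : (A : ℝ) ≤ 2 ^ A := by exact_mod_cast Nat.lt_two_pow_self.le
  have h1 : (B : ℝ) ^ I ≤ 2 ^ (12 * A ^ 2) := by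
    calc (B : ℝ) ^ I = (A : ℝ) ^ (12 * I) := by rw [hB, Nat.cast_pow, ← pow_mul]
      _ ≤ (2 ^ A) ^ (12 * I) := by gcongr
      _ = 2 ^ (A * (12 * I)) := by rw [← pow_mul]
      _ ≤ 2 ^ (12 * A ^ 2) := pow_le_pow_right₀ (by norm_num) (by nlinarith)
  have h2 : Real.exp (16 * (A : ℝ) ^ 2) ≤ 2 ^ (32 * A ^ 2) := by
    have e : Real.exp (16 * (A : ℝ) ^ 2) = Real.exp 1 ^ (16 * A ^ 2) := by
      rw [← Real.exp_nat_mul]; push_cast; ring_nf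
    have e2 : (2 : ℝ) ^ (32 * A ^ 2) = (2 ^ 2) ^ (16 * A ^ 2) := by rw [← pow_mul]; ring_nf
    rw [e, e2]
    have := Real.exp_one_lt_d9
    gcongr
    linarith
  have h3 : (8 * I : ℝ) ≤ 2 ^ (3 + A) := by
    have : (I : ℝ) ≤ A := by exact_mod_cast hI
    rw [pow_add]
    linarith
  calc _ ≤ (2 : ℝ) ^ (3 + A) * 2 ^ (12 * A ^ 2) * 2 ^ (32 * A ^ 2) := by gcongr
    _ = 2 ^ (3 + A + 12 * A ^ 2 + 32 * A ^ 2) := by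
        rw [pow_add _ _ (32 * A ^ 2), pow_add _ _ (12 * A ^ 2)]
    _ ≤ 2 ^ (A ^ 4) := pow_le_pow_right₀ (by norm_num) (by
        have : 8 * 8 * A ^ 2 ≤ A ^ 2 * A ^ 2 := Nat.mul_le_mul_right _ (by nlinarith)
        nlinarith)

theorem advantage_bound {A B I b d u : ℕ} (hA : 2 ^ 54 ≤ A) (hd : d ≤ A) (hI : 1 ≤ I)
    (hb : 2 ^ b ≤ 128 * d) (hu : 48 * u ≤ I) (hB : B = A ^ 12) :
    (2 ^ 20 * 2 ^ b * (B : ℝ) ^ (2 * u)) ^ 2 * 8 ^ I ≤ (A : ℝ) ^ (6 * I) := by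
  have h1 : (2 ^ 20 * 2 ^ b * B ^ (2 * u)) ^ 2 * 8 ^ I ≤ A ^ (6 * I) := by
    have hA1 : 1 ≤ A := le_trans (by norm_num) hA
    calc (2 ^ 20 * 2 ^ b * B ^ (2 * u)) ^ 2 * 8 ^ I ≤
          (2 ^ 20 * (128 * A) * B ^ (2 * u)) ^ 2 * A ^ I := by
          gcongr
          · exact hb.trans (Nat.mul_le_mul_left _ hd)
          · exact le_trans (by norm_num) hA
      -- The exponent 54 is 2·(20 + 7), from 2^20 and from 2^b ≤ 2^7·d; it is the reason for the
      -- requirement d ≥ 2^54 in `LargeDepth`.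
      _ = 2 ^ 54 * A ^ 2 * A ^ (48 * u) * A ^ I := by
          rw [hB, mul_pow, mul_pow, ← pow_mul, ← pow_mul, mul_pow]
          ring_nf
      _ ≤ A * A ^ 2 * A ^ I * A ^ I := by
          gcongr
      _ = A ^ (3 + 2 * I) := by ring
      _ ≤ A ^ (6 * I) := Nat.pow_le_pow_right hA1 (by omega)
  exact_mod_cast h1

theorem parameters_of_largeDepth {K : ℝ} (hK : 0 < K) {d A B t m s Dg tu w b I : ℕ}
    (h : LargeDepth K d) (htu : 1 ≤ tu) (hw : 1 ≤ w) (hA : A = d * tu * w) (hB : B = A ^ 12)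
    (hI : d ≤ 2 * I) (hId : I ≤ d) (hb : 2 ^ b ≤ 128 * d) (hmD : 96 * (m + Dg) ≤ d)
    (ht : 2 * t + 1 ≤ B) (herror : (1 / 2 : ℝ) ^ s * (t + 1) ^ m * 2 ^ b ≤ 1 / 100) :
    Parameters A B I b w ⌊2 * (K * (tu * d)) * (B : ℝ) ^ I⌋₊ ⌊K * (tu * d) * (B : ℝ) ^ (I + 1)⌋₊
      t m Dg s := by
  have hd54 := h.two_pow_le
  have hdA : d ≤ A := by
    rw [hA, mul_assoc]
    exact Nat.le_mul_of_pos_right _ (Nat.mul_pos htu hw)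
  have hA54 := hd54.trans hdA
  have hA1 : 1 ≤ A := le_trans (by norm_num) hA54
  have hA1' : (1 : ℝ) ≤ A := by exact_mod_cast hA1
  have hAK : 2 * K ≤ A := h.le_depth.trans (by exact_mod_cast hdA)
  have hAr : (A : ℝ) = d * tu * w := by rw [hA]; push_cast; ring
  have hwr : (1 : ℝ) ≤ w := by exact_mod_cast hw
  refine ⟨hB, le_trans (by norm_num) hA54, by omega, ?_, ?_, ?_, ht, herror,
    spread_bound (le_trans (by norm_num) hA54) (hId.trans hdA) hB,
    advantage_bound hA54 hdA (by omega) hb (by omega) hB⟩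
  · have hfl : (⌊2 * (K * (tu * d)) * (B : ℝ) ^ I⌋₊ : ℝ) ≤ 2 * (K * (tu * d)) * (B : ℝ) ^ I :=
      Nat.floor_le (by positivity)
    have : (w : ℝ) * ⌊2 * (K * (tu * d)) * (B : ℝ) ^ I⌋₊ ≤ (A : ℝ) ^ 2 * (A ^ 2 * B ^ I) := by
      calc _ ≤ (w : ℝ) * (2 * (K * (tu * d)) * (B : ℝ) ^ I) := by gcongr
        _ = (2 * K) * A * (B : ℝ) ^ I := by rw [hAr]; ring
        _ ≤ A * A * (B : ℝ) ^ I := by gcongr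
        _ = (A : ℝ) ^ 2 * (1 * (B : ℝ) ^ I) := by ring
        _ ≤ (A : ℝ) ^ 2 * (A ^ 2 * (B : ℝ) ^ I) := by
          gcongr
          exact one_le_pow₀ hA1'
    exact_mod_cast this
  · calc w * (m + Dg) ≤ w * d := Nat.mul_le_mul_left _ (by omega)
      _ ≤ A := by
        rw [hA, mul_comm, mul_right_comm]
        exact Nat.le_mul_of_pos_right _ htu
      _ ≤ A ^ 2 := by nlinarith
  · have hfl : (⌊K * (tu * d) * (B : ℝ) ^ (I + 1)⌋₊ : ℝ) ≤ K * (tu * d) * (B : ℝ) ^ (I + 1) :=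
      Nat.floor_le (by positivity)
    have : (⌊K * (tu * d) * (B : ℝ) ^ (I + 1)⌋₊ : ℝ) ≤ (B : ℝ) * (A ^ 2 * B ^ I) := by
      calc _ ≤ K * (tu * d * 1) * (B : ℝ) ^ (I + 1) := by rw [mul_one]; exact hfl
        _ ≤ A * (tu * d * w) * (B : ℝ) ^ (I + 1) := by
          gcongr
          linarith
        _ = (B : ℝ) * (A ^ 2 * B ^ I) := by rw [hAr]; ring
    exact_mod_cast this

theorem two_pow_clog_le {d : ℕ} (hd : 2 ≤ d) : 2 ^ (Nat.clog 2 d + 6) ≤ 128 * d := by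
  have h1 := Nat.pow_pred_clog_lt_self (b := 2) (by norm_num) hd
  have h2 : 0 < Nat.clog 2 d := Nat.clog_pos (by norm_num) hd
  obtain ⟨k, hk⟩ : ∃ k, Nat.clog 2 d = k + 1 := ⟨Nat.clog 2 d - 1, by omega⟩
  rw [hk] at h1 ⊢
  simp only [Nat.pred_eq_sub_one, Nat.add_sub_cancel] at h1
  rw [pow_add, pow_succ]
  omega

theorem DataStructure.lt_realAverage_of_largeDepth {K : ℝ} (hK : 0 < K) {d B tu w : ℕ}
    (h : LargeDepth K d) (htu : 1 ≤ tu) (hw : 1 ≤ w) (hB : B = (d * tu * w) ^ 12)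
    (D : DataStructure w B d (Nat.clog 2 d + 6)) (hD : D.Correct)
    (hupd : ∀ U i, (#(D.updatedCells U i) : ℝ) ≤ K * (tu * d * (B : ℝ) ^ (((i : ℕ) + 1) + 1))) :
    1 / 30000 * probeBound d B < D.realAverage := by
  have hd2 : 2 ≤ d := le_trans (by norm_num) h.two_pow_le
  have hdA : d ≤ d * tu * w := by
    rw [mul_assoc]
    exact Nat.le_mul_of_pos_right _ (Nat.mul_pos htu hw)
  have hB2 : 2 ≤ B := by
    rw [hB]
    calc 2 ≤ d * tu * w := hd2.trans hdA
      _ ≤ (d * tu * w) ^ 12 := Nat.le_self_pow (by norm_num) _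
  have hpos : 0 < 1 / 30000 * probeBound d B := by
    have := sqrt_bound (d := d) hB2
    have : 0 < √(d : ℝ) := Real.sqrt_pos.2 (by exact_mod_cast (by omega : 0 < d))
    have : 0 < √(Real.logb 2 B) := by linarith
    rw [(sqrt_bound hB2).2]
    positivity
  obtain ⟨s, Dg, hs, hDg, hmD, ht, herror⟩ := exists_thresholds h hdA hB rfl rfl
  have hC : 0 ≤ K * (tu * d) := by positivity
  have hupd' : ∀ U i, (#(D.updatedCells U i) : ℝ) ≤ K * (tu * d) * (B : ℝ) ^ (((i : ℕ) + 1) + 1) := by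
    intro U i
    rw [mul_assoc]
    exact hupd U i
  refine D.lt_realAverage hpos (by omega) hD
    (fun i => ⌊2 * (K * (tu * d)) * (B : ℝ) ^ ((i : ℕ) + 1)⌋₊)
    (fun i => ⌊K * (tu * d) * (B : ℝ) ^ ((i : ℕ) + 1 + 1)⌋₊) rfl rfl ?_
    (fun i hi => parameters_of_largeDepth hK h htu hw rfl hB hi i.isLt (two_pow_clog_le hd2) hmD ht
      herror) hs hDg
    (fun i U => Nat.le_floor (D.card_laterCells_le hB2 hC U (hupd' U) i))
    fun i U => Nat.le_floor (hupd' U i)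
  have := Nat.le_pow_clog (b := 2) (by norm_num) d
  rw [pow_add]
  omega

/-- How large d must be depends on K. The finitely many smaller depths are covered by the trivial
bound of one probe, since `probeBound d B` ≤ d^{3/2} is bounded there; this makes c depend on K, but
not the admissible depths. -/
theorem DataStructure.exists_mul_probeBound_le {K : ℝ} (hK : 0 < K) :
    ∃ c : ℝ, 0 < c ∧ ∀ (d tu w B : ℕ), 2 ≤ d → 1 ≤ tu → 1 ≤ w → B = (d * tu * w) ^ 12 →
      ∀ D : DataStructure w B d (Nat.clog 2 d + 6), D.Correct →
      (∀ U i, (#(D.updatedCells U i) : ℝ) ≤ K * (tu * d * (B : ℝ) ^ (((i : ℕ) + 1) + 1))) →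
      c * probeBound d B ≤ D.realAverage := by
  obtain ⟨N, hN⟩ := Filter.eventually_atTop.1 (eventually_largeDepth K)
  have hN0 : (0 : ℝ) < √((N : ℝ) + 1) ^ 3 := by positivity
  refine ⟨min (1 / 30000) (1 / √((N : ℝ) + 1) ^ 3), by positivity, ?_⟩
  intro d tu w B hd htu hw hB D hD hupd
  have hB2 : 2 ≤ B := by
    rw [hB, mul_assoc]
    calc 2 ≤ d * (tu * w) := hd.trans (Nat.le_mul_of_pos_right _ (Nat.mul_pos htu hw))
      _ ≤ _ := Nat.le_self_pow (by norm_num) _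
  obtain ⟨hz, hpb⟩ := sqrt_bound (d := d) hB2
  have hpos : 0 ≤ probeBound d B := by rw [hpb]; positivity
  by_cases hdN : N ≤ d
  · refine le_trans ?_ (D.lt_realAverage_of_largeDepth hK (hN d hdN) htu hw hB hD hupd).le
    exact mul_le_mul_of_nonneg_right (min_le_left _ _) hpos
  · refine le_trans ?_ (hD.one_le_realAverage (by omega) (by omega) (by omega))
    calc _ ≤ 1 / √((N : ℝ) + 1) ^ 3 * probeBound d B :=
          mul_le_mul_of_nonneg_right (min_le_right _ _) hpos
      _ ≤ 1 / √((N : ℝ) + 1) ^ 3 * √((N : ℝ) + 1) ^ 3 := by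
          gcongr
          rw [hpb]
          refine (div_le_self (by positivity) hz).trans ?_
          gcongr
          have : d ≤ N := by omega
          have : (d : ℝ) ≤ N := by exact_mod_cast this
          linarith
      _ = 1 := by field_simp

/-- For a correct data structure the cells are so large that the bound in terms of `d` and `B` is
one in terms of the number of nodes and of `tu * w`. -/
theorem logb_bound_le {d tu w B : ℕ} (hd : 2 ≤ d) (htu : 1 ≤ tu) (hdw : d ≤ w)
    (hB : B = (d * tu * w) ^ 12) :
    Real.logb 2 (totalNodes B d) ^ (3 / 2 : ℝ) / Real.logb 2 (tu * w) ^ 2 ≤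
      2000 * probeBound d B := by
  have hw : 2 ≤ w := hd.trans hdw
  have htw : 2 ≤ tu * w := le_trans hw (Nat.le_mul_of_pos_left _ htu)
  have hd2B : 2 * d ^ 2 ≤ B := by
    rw [hB]
    calc 2 * d ^ 2 ≤ d * d ^ 2 := Nat.mul_le_mul_right _ hd
      _ = d ^ 3 := by ring
      _ ≤ (d * (tu * w)) ^ 3 := Nat.pow_le_pow_left (Nat.le_mul_of_pos_right _ (by omega)) 3
      _ = (d * tu * w) ^ 3 := by rw [mul_assoc]
      _ ≤ _ := Nat.pow_le_pow_right (by rw [mul_assoc]; positivity) (by norm_num)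
  have hB2 : 2 ≤ B := by nlinarith
  obtain ⟨hz, hpb⟩ := sqrt_bound (d := d) hB2
  have htot := totalNodes_le hd2B (by omega)
  have htot1 := totalNodes_pos (B := B) (d := d) (by omega) (by omega)
  set ℓ := Real.logb 2 (B : ℝ) with hℓ
  set L := Real.logb 2 ((tu : ℝ) * w) with hL
  have hL1 : 1 ≤ L := by
    rw [hL, Real.le_logb_iff_rpow_le (by norm_num) (by positivity)]
    simpa using (by exact_mod_cast htw : (2 : ℝ) ≤ tu * w)
  -- Because of d ≤ w, the base d·tu·w of B is at most (tu·w)².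
  have hℓL : ℓ ≤ 24 * L := by
    have h1 : (B : ℝ) ≤ ((tu : ℝ) * w) ^ 24 := by
      have : B ≤ (tu * w) ^ 24 := by
        rw [hB]
        calc (d * tu * w) ^ 12 ≤ ((tu * w) * (tu * w)) ^ 12 := by
              refine Nat.pow_le_pow_left ?_ 12
              rw [mul_assoc]
              exact Nat.mul_le_mul_right _ (hdw.trans (Nat.le_mul_of_pos_left _ htu))
          _ = _ := by ring
      exact_mod_cast this
    calc ℓ ≤ Real.logb 2 (((tu : ℝ) * w) ^ 24) :=
          Real.logb_le_logb_of_le (by norm_num) (by positivity) h1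
      _ = 24 * L := by rw [Real.logb_pow, ← hL]; norm_num
  have hn : Real.logb 2 (totalNodes B d) ≤ 2 * d * ℓ := by
    calc _ ≤ Real.logb 2 ((B : ℝ) ^ (2 * d)) :=
          Real.logb_le_logb_of_le (by norm_num) (by exact_mod_cast htot1) (by exact_mod_cast htot)
      _ = 2 * d * ℓ := by rw [Real.logb_pow]; push_cast; ring
  have hn0 : 0 ≤ Real.logb 2 (totalNodes B d) :=
    Real.logb_nonneg (by norm_num) (by exact_mod_cast htot1)
  have hℓ0 : 0 ≤ ℓ := Real.logb_nonneg (by norm_num) (by exact_mod_cast (by omega : 1 ≤ B))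
  have hcube : ∀ x : ℝ, 0 ≤ x → x ^ (3 / 2 : ℝ) = √x ^ 3 := by
    intro x hx
    rw [Real.sqrt_eq_rpow, ← Real.rpow_natCast, ← Real.rpow_mul hx]
    norm_num
  set z := √ℓ with hzdef
  have hz2 : z ^ 2 = ℓ := Real.sq_sqrt hℓ0
  have hz0 : 0 < z := by linarith
  have h2 : √2 ^ 3 ≤ 3 := by
    have h3 : √2 ^ 2 = (2 : ℝ) := Real.sq_sqrt (by norm_num)
    have h4 : √2 ≤ (3 / 2 : ℝ) := by rw [Real.sqrt_le_left (by norm_num)]; norm_num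
    nlinarith
  rw [hcube _ hn0, div_le_iff₀ (by positivity), hpb]
  calc √(Real.logb 2 (totalNodes B d)) ^ 3 ≤ √(2 * d * ℓ) ^ 3 := by gcongr
    _ = √2 ^ 3 * √d ^ 3 * z ^ 3 := by
        rw [Real.sqrt_mul (by positivity), Real.sqrt_mul (by norm_num), mul_pow, mul_pow]
    _ ≤ 3 * √d ^ 3 * z ^ 3 := by gcongr
    _ = 3 * √d ^ 3 / z * (z ^ 2) ^ 2 := by field_simp
    _ ≤ 3 * √d ^ 3 / z * (24 * L) ^ 2 := by rw [hz2]; gcongr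
    _ = 1728 * (√d ^ 3 / z) * L ^ 2 := by ring
    _ ≤ 2000 * (√d ^ 3 / z) * L ^ 2 := by gcongr; norm_num

end ButterflyXor

/-- A randomized data structure is a family `D ω` of deterministic ones indexed by the outcomes `ω`
of its random choices, which are drawn from an arbitrary probability space `(Ω, P)`. -/
theorem theorem4 :
    ∃ d₀ : ℕ, ∀ K : ℝ, 0 < K → ∃ c : ℝ, 0 < c ∧
      ∀ (d tu w B : ℕ), d₀ ≤ d → 1 ≤ tu → 1 ≤ w → B = (d * tu * w) ^ 12 →
      ∀ (Ω : Type*) [MeasurableSpace Ω] (P : MeasureTheory.Measure Ω)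
        [MeasureTheory.IsProbabilityMeasure P]
        (D : Ω → ButterflyXor.DataStructure w B d (Nat.clog 2 d + 6)),
        (∀ᵐ ω ∂P, (D ω).Correct) →
        (∀ᵐ ω ∂P, ∀ (U : ButterflyXor.Updates B d (Nat.clog 2 d + 6)) (i : Fin d),
          (((D ω).updatedCells U i).card : ℝ) ≤ K * (tu * d * (B : ℝ) ^ (((i : ℕ) + 1) + 1))) →
        ENNReal.ofReal
            (c * (Real.logb 2 (ButterflyXor.totalNodes B d) ^ (3 / 2 : ℝ) /
              Real.logb 2 (tu * w) ^ 2))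
          ≤ ∫⁻ ω, (D ω).averageProbes ∂P := by
  refine ⟨2, fun K hK => ?_⟩
  obtain ⟨c, hc, hbound⟩ := ButterflyXor.DataStructure.exists_mul_probeBound_le hK
  refine ⟨c / 2000, by positivity, ?_⟩
  intro d tu w B hd htu hw hB Ω _ P _ D hcorrect hupd
  have hB4 : 4 ≤ B := by
    rw [hB, mul_assoc]
    calc 4 ≤ 2 ^ 12 := by norm_num
      _ ≤ (d * (tu * w)) ^ 12 :=
        Nat.pow_le_pow_left (hd.trans (Nat.le_mul_of_pos_right _ (Nat.mul_pos htu hw))) 12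
  -- The input distribution is fixed, so the bound holds for almost every deterministic structure
  -- separately and survives averaging over the random choices.
  have hae : ∀ᵐ ω ∂P, ENNReal.ofReal
      (c / 2000 * (Real.logb 2 (ButterflyXor.totalNodes B d) ^ (3 / 2 : ℝ) /
        Real.logb 2 (tu * w) ^ 2)) ≤ (D ω).averageProbes := by
    filter_upwards [hcorrect, hupd] with ω h1 h2
    rw [← (D ω).ofReal_realAverage (by omega)]
    refine ENNReal.ofReal_le_ofReal (le_trans ?_ (hbound d tu w B hd htu hw hB (D ω) h1 h2))
    have h3 := ButterflyXor.logb_bound_le hd htu (h1.depth_le (by omega) (by omega) hB4) hB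
    calc _ ≤ c / 2000 * (2000 * ButterflyXor.probeBound d B) := by gcongr
      _ = _ := by ring
  refine le_trans ?_ (MeasureTheory.lintegral_mono_ae hae)
  simp
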